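/- Conventions. Let $M$ be a smooth manifold and $H$ a real closed 3-form on $M$. On $TM\oplus T^*M$ put $\langle X+\alpha,Y+\beta\rangle=\tfrac12(\beta(X)+\alpha(Y))$ and $$[[X+\alpha,Y+\beta]]_H=[X,Y]+\mathcal L_X\beta-\mathcal L_Y\alpha-\tfrac12 d(\iota_X\beta-\iota_Y\alpha)+\iota_Y\iota_XH,$$ extended complex bilinearly to $(TM\oplus T^*M)\otimes\mathbb C$; a family of subspaces of $(TM\oplus T^*M)\otimes\mathbb C$ is called involutive if its smooth sections are closed under $[[\cdot,\cdot]]_H$. All endomorphisms of $TM\oplus T^*M$ are smooth bundle endomorphisms, and $^*$ is the adjoint with respect to $\langle\,,\rangle$. For sections $A,B$ of $TM\oplus T^*M$, $A\otimes B$ is the endomorphism $c\mapsto 2\langle B,c\rangle A$. * An $H$-twisted generalized complex structure is an endomorphism $\mathcal J$ with $\mathcal J+\mathcal J^*=0$, $\mathcal J^2=-\mathrm{Id}$ and involutive $\sqrt{-1}$-eigenbundle. A generalized metric is an endomorphism $G$ with $G^*=G$, $G^2=\mathrm{Id}$ and $\langle Ga,a\rangle>0$ for all $a\neq0$. An $H$-twisted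 generalized Kähler structure is a pair of commuting $H$-twisted generalized complex structures $\mathcal J_1,\mathcal J_2$ such that $-\mathcal J_1\mathcal J_2$ is a generalized metric. * A generalized almost contact metric structure $(\Phi,E_\pm,G)$ consists of an endomorphism $\Phi$, smooth sections $E_+,E_-$ of $TM\oplus T^*M$ and a generalized metric $G$ with $\Phi+\Phi^*=0$, $\Phi^2=-\mathrm{Id}+E_+\otimes E_-+E_-\otimes E_+$, $\langle E_\pm,E_\pm\rangle=0$, $2\langle E_+,E_-\rangle=1$ and $-\Phi G\Phi=G-E_+\otimes E_+-E_-\otimes E_-$. * $\Phi$, with sections $E_\pm$, is strong if both $L^\pm=\mathbb C E_\pm\oplus E^{(1,0)}_\Phi$ are involutive, where $E^{(1,0)}_\Phi$ is the $\sqrt{-1}$-eigenbundle of $\Phi$. The structure is normal if $\Phi$ is strong and $[[E_+,E_-]]_H=0$. It is $H$-twisted generalized coKähler if it is normal and $G\Phi$, with the sections $GE_\pm$, is also strong. Theorem. Let $M_1$ and $M_2$ be nonempty odd-dimensional smooth manifolds, let $H_i$ be a real closed 3-form on $M_i$, and let $(\Phi_i,E_{\pm,i},G_i)$ be a generalized almost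 contact metric structure on $M_i$, $i=1,2$. On $M_1\times M_2$ let $\tilde H=H_1+H_2$ (sum of the pullbacks), let $G=G_1\times G_2$, and for $a_i\in TM_i\oplus T^*M_i$ let $$\mathcal J_1(a_1,a_2)=\big(\Phi_1a_1-2\langle E_{+,2},a_2\rangle E_{+,1}-2\langle E_{-,2},a_2\rangle E_{-,1},\ \ \Phi_2a_2+2\langle E_{+,1},a_1\rangle E_{+,2}+2\langle E_{-,1},a_1\rangle E_{-,2}\big),$$ and $\mathcal J_2=G\mathcal J_1$. Then $(\mathcal J_1,\mathcal J_2)$ is an $\tilde H$-twisted generalized Kähler structure on $M_1\times M_2$ if and only if, for both $i=1$ and $i=2$, $(\Phi_i,E_{\pm,i},G_i)$ is $H_i$-twisted generalized coKähler. (The untwisted statement is the case $H_1=H_2=0$.) -/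

import Mathlib

open Bundle
open scoped Manifold ContDiff TensorProduct

noncomputable section

namespace GenGeom

section Forms

variable {E : Type*} [NormedAddCommGroup E] [NormedSpace ℝ E]
  {K : Type*} [TopologicalSpace K] (I : ModelWithCorners ℝ E K)
  {M : Type*} [TopologicalSpace M] [ChartedSpace K M]

/-- The cotangent space `T*_x M`. -/
abbrev Cotangent (x : M) : Type _ := TangentSpace I x →L[ℝ] ℝ

variable (M) in
/-- (Not necessarily smooth) differential forms of degree `k` on `M`. -/
abbrev Form (k : ℕ) : Type _ := ∀ x : M, TangentSpace I x [⋀^Fin k]→L[ℝ] ℝ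

variable {I}

/-- The expression of a form in the preferred chart at `x₀`, that is, its pullback to the model
vector space under the inverse of that chart. -/
def Form.inChart {k : ℕ} (θ : Form I M k) (x₀ : M) (e : E) : E [⋀^Fin k]→L[ℝ] ℝ :=
  (θ ((extChartAt I x₀).symm e)).compContinuousLinearMap
    (mfderivWithin 𝓘(ℝ, E) I (extChartAt I x₀).symm (Set.range I) e)

/-- A form is smooth if its expressions in charts are smooth. -/
def Form.IsSmooth {k : ℕ} (θ : Form I M k) : Prop :=
  ∀ x₀ : M, ContDiffOn ℝ ∞ (θ.inChart x₀) (extChartAt I x₀).target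

/-- The exterior derivative of a form, computed at `x` in the preferred chart at `x` and pulled
back to `M`. -/
def Form.extDer {k : ℕ} (θ : Form I M k) : Form I M (k + 1) := fun x =>
  (extDerivWithin (θ.inChart x) (Set.range I) (extChartAt I x x)).compContinuousLinearMap
    (mfderiv I 𝓘(ℝ, E) (extChartAt I x) x)

/-- A form is closed if `dθ = 0`. -/
def Form.IsClosed {k : ℕ} (θ : Form I M k) : Prop := ∀ x : M, θ.extDer x = 0

/-- A field of covectors, as a form of degree one. -/
def oneForm (α : ∀ x : M, Cotangent I x) : Form I M 1 := fun x =>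
  ContinuousAlternatingMap.ofSubsingleton ℝ (TangentSpace I x) ℝ (0 : Fin 1) (α x)

/-- `ι_X θ` for a two-form `θ` at a point: the covector `v ↦ θ(X, v)`. -/
def contract₁ {x : M} (θ : TangentSpace I x [⋀^Fin 2]→L[ℝ] ℝ) (X : TangentSpace I x) :
    Cotangent I x :=
  θ.toContinuousMultilinearMap.toContinuousLinearMap ![X, 0] 1

/-- `ι_Y ι_X θ` for a three-form `θ` at a point: the covector `v ↦ θ(X, Y, v)`. -/
def contract₂ {x : M} (θ : TangentSpace I x [⋀^Fin 3]→L[ℝ] ℝ) (X Y : TangentSpace I x) :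
    Cotangent I x :=
  θ.toContinuousMultilinearMap.toContinuousLinearMap ![X, Y, 0] 2

theorem contract₁_apply {x : M} (θ : TangentSpace I x [⋀^Fin 2]→L[ℝ] ℝ)
    (X v : TangentSpace I x) : contract₁ θ X v = θ ![X, v] := by
  have h : Function.update ![X, 0] (1 : Fin 2) v = ![X, v] := by
    ext i; fin_cases i <;> rfl
  change θ (Function.update ![X, 0] (1 : Fin 2) v) = _
  rw [h]

theorem contract₂_apply {x : M} (θ : TangentSpace I x [⋀^Fin 3]→L[ℝ] ℝ)
    (X Y v : TangentSpace I x) : contract₂ θ X Y v = θ ![X, Y, v] := by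
  have h : Function.update ![X, Y, 0] (2 : Fin 3) v = ![X, Y, v] := by
    ext i; fin_cases i <;> rfl
  change θ (Function.update ![X, Y, 0] (2 : Fin 3) v) = _
  rw [h]

/-- The Lie derivative `L_X β = ι_X dβ + d(β(X))` of a one-form. -/
def lieDerivative (X : ∀ x : M, TangentSpace I x) (β : ∀ x : M, Cotangent I x) (x : M) :
    Cotangent I x :=
  contract₁ ((oneForm β).extDer x) (X x) + mvfderiv I (fun y => β y (X y)) x

end Forms

section BigTangent

variable {E : Type*} [NormedAddCommGroup E] [NormedSpace ℝ E]
  {K : Type*} [TopologicalSpace K] (I : ModelWithCorners ℝ E K)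
  {M : Type*} [TopologicalSpace M] [ChartedSpace K M]

/-- The fibre `T_x M ⊕ T*_x M` of the big tangent bundle; `(X, α)` stands for `X + α`. -/
abbrev BigTangent (x : M) : Type _ := TangentSpace I x × Cotangent I x

variable (M) in
/-- (Not necessarily smooth) sections of `TM ⊕ T*M`. -/
abbrev BigSection : Type _ := ∀ x : M, BigTangent I x

variable (M) in
/-- (Not necessarily smooth) fields of endomorphisms of `TM ⊕ T*M`. -/
abbrev BigEnd : Type _ := ∀ x : M, BigTangent I x →L[ℝ] BigTangent I x

variable {I}

/-- The neutral metric `⟨X + α, Y + β⟩ = (β(X) + α(Y)) / 2`. -/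
def pairing {x : M} (a b : BigTangent I x) : ℝ := (1 / 2) * (b.2 a.1 + a.2 b.1)

/-- The functional `b ↦ 2⟨a, b⟩` on `T_x M ⊕ T*_x M` given by an element `a` of this space. -/
def dualOf {x : M} (a : BigTangent I x) : BigTangent I x →L[ℝ] ℝ where
  toFun b := b.2 a.1 + a.2 b.1
  map_add' b c := by
    simp only [Prod.fst_add, Prod.snd_add, add_apply, map_add]
    ring
  map_smul' r b := by
    simp only [Prod.smul_fst, Prod.smul_snd, smul_apply, map_smul,
      smul_eq_mul, RingHom.id_apply]
    ring
  cont := ((continuous_eval_const a.1).comp continuous_snd).add (a.2.continuous.comp continuous_fst)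

theorem dualOf_apply {x : M} (a b : BigTangent I x) : dualOf a b = 2 * pairing a b := by
  change b.2 a.1 + a.2 b.1 = 2 * ((1 / 2) * (b.2 a.1 + a.2 b.1))
  ring

/-- The endomorphism `a ⊗ b : c ↦ 2⟨b, c⟩ a`. -/
def tensorEnd {x : M} (a b : BigTangent I x) : BigTangent I x →L[ℝ] BigTangent I x :=
  (dualOf b).smulRight a

/-- The `H`-twisted Courant bracket
`[[X + α, Y + β]]_H = [X, Y] + L_X β - L_Y α - (1/2) d(ι_X β - ι_Y α) + ι_Y ι_X H`. -/
def courant (H : Form I M 3) (s t : BigSection I M) : BigSection I M := fun x =>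
  (VectorField.mlieBracket I (fun y => (s y).1) (fun y => (t y).1) x,
    lieDerivative (fun y => (s y).1) (fun y => (t y).2) x
      - lieDerivative (fun y => (t y).1) (fun y => (s y).2) x
      - (1 / 2 : ℝ) • mvfderiv I (fun y => (t y).2 (s y).1 - (s y).2 (t y).1) x
      + contract₂ (H x) (s x).1 (t x).1)

/-- The element `a + √-1 b` of the complexification of `T_x M ⊕ T*_x M`. -/
def complexElt {x : M} (a b : BigTangent I x) : ℂ ⊗[ℝ] BigTangent I x :=
  (1 : ℂ) ⊗ₜ[ℝ] a + Complex.I ⊗ₜ[ℝ] b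

variable (I M) in
/-- A field of complex subspaces of `(TM ⊕ T*M) ⊗ ℂ`. -/
abbrev ComplexSubbundle : Type _ := ∀ x : M, Submodule ℂ (ℂ ⊗[ℝ] BigTangent I x)

/-- The `√-1`-eigenbundle in `(TM ⊕ T*M) ⊗ ℂ` of an endomorphism of `TM ⊕ T*M`. -/
def eigenbundle (Φ : BigEnd I M) : ComplexSubbundle I M := fun x =>
  Module.End.eigenspace ((Φ x).toLinearMap.baseChange ℂ) Complex.I

/-- The bundle `L_e ⊕ E^{(1,0)}` spanned by a section `e` and the `√-1`-eigenbundle of `Φ`. -/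
def lineSumEigenbundle (Φ : BigEnd I M) (e : BigSection I M) : ComplexSubbundle I M := fun x =>
  Submodule.span ℂ {complexElt (e x) 0} ⊔ eigenbundle Φ x

section Smooth

variable [IsManifold I ∞ M]

/-- Smoothness of a section of the vector bundle `TM ⊕ T*M`. -/
def IsSmoothSection (s : BigSection I M) : Prop :=
  ContMDiff I (I.prod 𝓘(ℝ, E × (E →L[ℝ] ℝ))) ∞
    (fun x => TotalSpace.mk' (E × (E →L[ℝ] ℝ)) x (s x))

/-- Smoothness of an endomorphism of the vector bundle `TM ⊕ T*M`, as a section of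
`End(TM ⊕ T*M)`. -/
def IsSmoothEnd (Φ : BigEnd I M) : Prop :=
  ContMDiff I (I.prod 𝓘(ℝ, (E × (E →L[ℝ] ℝ)) →L[ℝ] (E × (E →L[ℝ] ℝ)))) ∞
    (fun x => TotalSpace.mk' ((E × (E →L[ℝ] ℝ)) →L[ℝ] (E × (E →L[ℝ] ℝ))) x (Φ x))

/-- `L` is involutive: its smooth sections are closed under the `H`-twisted Courant bracket. A
smooth section of `(TM ⊕ T*M) ⊗ ℂ` is written as `a + √-1 b` with smooth sections `a`, `b` of
`TM ⊕ T*M`, and the bracket is extended complex bilinearly. -/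
def IsInvolutive (H : Form I M 3) (L : ComplexSubbundle I M) : Prop :=
  ∀ a b c d : BigSection I M,
    IsSmoothSection a → IsSmoothSection b → IsSmoothSection c → IsSmoothSection d →
    (∀ x, complexElt (a x) (b x) ∈ L x) → (∀ x, complexElt (c x) (d x) ∈ L x) →
    ∀ x, complexElt (courant H a c x - courant H b d x) (courant H a d x + courant H b c x) ∈ L x

/-- `J` is a generalized almost complex structure: `J + J* = 0` and `J² = -Id`. -/
structure IsGenAlmostComplex (J : BigEnd I M) : Prop where
  smooth : IsSmoothEnd J
  skew : ∀ (x : M) (a b : BigTangent I x), pairing (J x a) b + pairing a (J x b) = 0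
  sq : ∀ (x : M) (a : BigTangent I x), J x (J x a) = -a

/-- `J` is an `H`-twisted generalized complex structure. -/
structure IsGenComplex (H : Form I M 3) (J : BigEnd I M) : Prop extends
    IsGenAlmostComplex J where
  involutive : IsInvolutive H (eigenbundle J)

/-- `G` is a generalized Riemannian metric: `G* = G`, `G² = 1`, and `⟨G a, a⟩ > 0` for `a ≠ 0`. -/
structure IsGenMetric (G : BigEnd I M) : Prop where
  smooth : IsSmoothEnd G
  selfAdjoint : ∀ (x : M) (a b : BigTangent I x), pairing (G x a) b = pairing a (G x b)
  sq : ∀ (x : M) (a : BigTangent I x), G x (G x a) = a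
  pos : ∀ (x : M) (a : BigTangent I x), a ≠ 0 → 0 < pairing (G x a) a

/-- `(J₁, J₂)` is an `H`-twisted generalized Kähler structure: `J₁` and `J₂` are commuting
`H`-twisted generalized complex structures such that `-J₁J₂` is a generalized metric. -/
structure IsGenKahler (H : Form I M 3) (J₁ J₂ : BigEnd I M) : Prop where
  genComplex₁ : IsGenComplex H J₁
  genComplex₂ : IsGenComplex H J₂
  comm : ∀ (x : M) (a : BigTangent I x), J₁ x (J₂ x a) = J₂ x (J₁ x a)
  metric : IsGenMetric (fun x => -(J₁ x ∘L J₂ x))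

/-- `(Φ, E₊, E₋)` is a generalized almost contact structure. -/
structure IsGenAlmostContact (Φ : BigEnd I M) (Ep Em : BigSection I M) : Prop where
  smooth : IsSmoothEnd Φ
  smooth_Ep : IsSmoothSection Ep
  smooth_Em : IsSmoothSection Em
  skew : ∀ (x : M) (a b : BigTangent I x), pairing (Φ x a) b + pairing a (Φ x b) = 0
  sq : ∀ x : M, Φ x ∘L Φ x =
    -ContinuousLinearMap.id ℝ (BigTangent I x) + tensorEnd (Ep x) (Em x) + tensorEnd (Em x) (Ep x)
  isotropic_Ep : ∀ x : M, pairing (Ep x) (Ep x) = 0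
  isotropic_Em : ∀ x : M, pairing (Em x) (Em x) = 0
  dual : ∀ x : M, 2 * pairing (Ep x) (Em x) = 1

/-- `(Φ, E₊, E₋, G)` is a generalized almost contact metric structure. -/
structure IsGenAlmostContactMetric (Φ : BigEnd I M) (Ep Em : BigSection I M) (G : BigEnd I M) :
    Prop where
  almostContact : IsGenAlmostContact Φ Ep Em
  metric : IsGenMetric G
  compatible : ∀ x : M, -(Φ x ∘L G x ∘L Φ x) =
    G x - tensorEnd (Ep x) (Ep x) - tensorEnd (Em x) (Em x)

/-- `Φ` (with the sections `E₊`, `E₋`) is strong: `L⁺ = L_{E₊} ⊕ E^{(1,0)}` and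
`L⁻ = L_{E₋} ⊕ E^{(1,0)}` are both closed under the `H`-twisted Courant bracket. -/
def IsStrong (H : Form I M 3) (Φ : BigEnd I M) (Ep Em : BigSection I M) : Prop :=
  IsInvolutive H (lineSumEigenbundle Φ Ep) ∧ IsInvolutive H (lineSumEigenbundle Φ Em)

/-- Normality: `Φ` is strong and `[[E₊, E₋]]_H = 0`. -/
def IsNormal (H : Form I M 3) (Φ : BigEnd I M) (Ep Em : BigSection I M) : Prop :=
  IsStrong H Φ Ep Em ∧ ∀ x : M, courant H Ep Em x = 0

/-- The product `GΦ` of two fields of endomorphisms. -/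
def compEnd (G Φ : BigEnd I M) : BigEnd I M := fun x => G x ∘L Φ x

/-- `(Φ, E₊, E₋, G)` is `H`-twisted generalized coKähler: it is a normal generalized (almost)
contact metric structure and `GΦ`, with its associated sections `G E₊`, `G E₋`, is strong. -/
structure IsGenCoKahler (H : Form I M 3) (Φ : BigEnd I M) (Ep Em : BigSection I M)
    (G : BigEnd I M) : Prop where
  almostContactMetric : IsGenAlmostContactMetric Φ Ep Em G
  normal : IsNormal H Φ Ep Em
  strong : IsStrong H (compEnd G Φ) (fun x => G x (Ep x)) (fun x => G x (Em x))

end Smooth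

end BigTangent

section Product

variable {E₁ : Type*} [NormedAddCommGroup E₁] [NormedSpace ℝ E₁]
  {K₁ : Type*} [TopologicalSpace K₁] {I₁ : ModelWithCorners ℝ E₁ K₁}
  {M₁ : Type*} [TopologicalSpace M₁] [ChartedSpace K₁ M₁]
  {E₂ : Type*} [NormedAddCommGroup E₂] [NormedSpace ℝ E₂]
  {K₂ : Type*} [TopologicalSpace K₂] {I₂ : ModelWithCorners ℝ E₂ K₂}
  {M₂ : Type*} [TopologicalSpace M₂] [ChartedSpace K₂ M₂]

/-! The identification `T_p(M₁ × M₂) = T_{p₁} M₁ × T_{p₂} M₂`. -/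

variable (I₁ I₂) in
/-- The projection `T_p(M₁ × M₂) → T_{p₁} M₁`. -/
def tangentFst (p : M₁ × M₂) : TangentSpace (I₁.prod I₂) p →L[ℝ] TangentSpace I₁ p.1 :=
  ContinuousLinearMap.fst ℝ (TangentSpace I₁ p.1) (TangentSpace I₂ p.2)

variable (I₁ I₂) in
/-- The projection `T_p(M₁ × M₂) → T_{p₂} M₂`. -/
def tangentSnd (p : M₁ × M₂) : TangentSpace (I₁.prod I₂) p →L[ℝ] TangentSpace I₂ p.2 :=
  ContinuousLinearMap.snd ℝ (TangentSpace I₁ p.1) (TangentSpace I₂ p.2)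

variable (I₁ I₂) in
/-- The inclusion `T_{p₁} M₁ → T_p(M₁ × M₂)`. -/
def tangentInl (p : M₁ × M₂) : TangentSpace I₁ p.1 →L[ℝ] TangentSpace (I₁.prod I₂) p :=
  ContinuousLinearMap.inl ℝ (TangentSpace I₁ p.1) (TangentSpace I₂ p.2)

variable (I₁ I₂) in
/-- The inclusion `T_{p₂} M₂ → T_p(M₁ × M₂)`. -/
def tangentInr (p : M₁ × M₂) : TangentSpace I₂ p.2 →L[ℝ] TangentSpace (I₁.prod I₂) p :=
  ContinuousLinearMap.inr ℝ (TangentSpace I₁ p.1) (TangentSpace I₂ p.2)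

variable (I₁ I₂) in
/-- The projection of `T(M₁ × M₂) ⊕ T*(M₁ × M₂)` to `TM₁ ⊕ T*M₁`, at `p`. -/
def bigFst (p : M₁ × M₂) : BigTangent (I₁.prod I₂) p →L[ℝ] BigTangent I₁ p.1 :=
  (tangentFst I₁ I₂ p).prodMap ((tangentInl I₁ I₂ p).precomp ℝ)

variable (I₁ I₂) in
/-- The projection of `T(M₁ × M₂) ⊕ T*(M₁ × M₂)` to `TM₂ ⊕ T*M₂`, at `p`. -/
def bigSnd (p : M₁ × M₂) : BigTangent (I₁.prod I₂) p →L[ℝ] BigTangent I₂ p.2 :=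
  (tangentSnd I₁ I₂ p).prodMap ((tangentInr I₁ I₂ p).precomp ℝ)

variable (I₁ I₂) in
/-- The inclusion of `TM₁ ⊕ T*M₁` in `T(M₁ × M₂) ⊕ T*(M₁ × M₂)`, at `p`. -/
def bigInl (p : M₁ × M₂) : BigTangent I₁ p.1 →L[ℝ] BigTangent (I₁.prod I₂) p :=
  (tangentInl I₁ I₂ p).prodMap ((tangentFst I₁ I₂ p).precomp ℝ)

variable (I₁ I₂) in
/-- The inclusion of `TM₂ ⊕ T*M₂` in `T(M₁ × M₂) ⊕ T*(M₁ × M₂)`, at `p`. -/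
def bigInr (p : M₁ × M₂) : BigTangent I₂ p.2 →L[ℝ] BigTangent (I₁.prod I₂) p :=
  (tangentInr I₁ I₂ p).prodMap ((tangentSnd I₁ I₂ p).precomp ℝ)

/-- The product `(a₁, a₂) ↦ (G₁ a₁, G₂ a₂)` of endomorphisms of the two big tangent bundles. -/
def prodEnd (G₁ : BigEnd I₁ M₁) (G₂ : BigEnd I₂ M₂) : BigEnd (I₁.prod I₂) (M₁ × M₂) := fun p =>
  bigInl I₁ I₂ p ∘L G₁ p.1 ∘L bigFst I₁ I₂ p + bigInr I₁ I₂ p ∘L G₂ p.2 ∘L bigSnd I₁ I₂ p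

/-- The generalized almost complex structure on `M₁ × M₂` induced by generalized almost contact
structures on `M₁` and `M₂`:
`J (a₁, a₂) = (Φ₁ a₁ - 2⟨E₊₂, a₂⟩ E₊₁ - 2⟨E₋₂, a₂⟩ E₋₁, Φ₂ a₂ + 2⟨E₊₁, a₁⟩ E₊₂ + 2⟨E₋₁, a₁⟩ E₋₂)`. -/
def inducedEnd (Φ₁ : BigEnd I₁ M₁) (Ep₁ Em₁ : BigSection I₁ M₁)
    (Φ₂ : BigEnd I₂ M₂) (Ep₂ Em₂ : BigSection I₂ M₂) : BigEnd (I₁.prod I₂) (M₁ × M₂) := fun p =>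
  bigInl I₁ I₂ p ∘L
      (Φ₁ p.1 ∘L bigFst I₁ I₂ p
        - ((dualOf (Ep₂ p.2)).smulRight (Ep₁ p.1)) ∘L bigSnd I₁ I₂ p
        - ((dualOf (Em₂ p.2)).smulRight (Em₁ p.1)) ∘L bigSnd I₁ I₂ p)
    + bigInr I₁ I₂ p ∘L
      (Φ₂ p.2 ∘L bigSnd I₁ I₂ p
        + ((dualOf (Ep₁ p.1)).smulRight (Ep₂ p.2)) ∘L bigFst I₁ I₂ p
        + ((dualOf (Em₁ p.1)).smulRight (Em₂ p.2)) ∘L bigFst I₁ I₂ p)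

theorem bigFst_inducedEnd (Φ₁ : BigEnd I₁ M₁) (Ep₁ Em₁ : BigSection I₁ M₁)
    (Φ₂ : BigEnd I₂ M₂) (Ep₂ Em₂ : BigSection I₂ M₂) (p : M₁ × M₂)
    (c : BigTangent (I₁.prod I₂) p) :
    bigFst I₁ I₂ p (inducedEnd Φ₁ Ep₁ Em₁ Φ₂ Ep₂ Em₂ p c) =
      Φ₁ p.1 (bigFst I₁ I₂ p c) - (2 * pairing (Ep₂ p.2) (bigSnd I₁ I₂ p c)) • Ep₁ p.1
        - (2 * pairing (Em₂ p.2) (bigSnd I₁ I₂ p c)) • Em₁ p.1 := by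
  rw [← dualOf_apply, ← dualOf_apply]
  have h : ∀ (a : BigTangent I₁ p.1) (b : BigTangent I₂ p.2),
      bigFst I₁ I₂ p (bigInl I₁ I₂ p a + bigInr I₁ I₂ p b) = a := by
    intro a b
    refine Prod.ext ?_ (ContinuousLinearMap.ext fun x => ?_)
    · change a.1 + 0 = a.1
      simp
    · change a.2 x + b.2 0 = a.2 x
      simp
  exact h _ _

theorem bigSnd_inducedEnd (Φ₁ : BigEnd I₁ M₁) (Ep₁ Em₁ : BigSection I₁ M₁)
    (Φ₂ : BigEnd I₂ M₂) (Ep₂ Em₂ : BigSection I₂ M₂) (p : M₁ × M₂)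
    (c : BigTangent (I₁.prod I₂) p) :
    bigSnd I₁ I₂ p (inducedEnd Φ₁ Ep₁ Em₁ Φ₂ Ep₂ Em₂ p c) =
      Φ₂ p.2 (bigSnd I₁ I₂ p c) + (2 * pairing (Ep₁ p.1) (bigFst I₁ I₂ p c)) • Ep₂ p.2
        + (2 * pairing (Em₁ p.1) (bigFst I₁ I₂ p c)) • Em₂ p.2 := by
  rw [← dualOf_apply, ← dualOf_apply]
  have h : ∀ (a : BigTangent I₁ p.1) (b : BigTangent I₂ p.2),
      bigSnd I₁ I₂ p (bigInl I₁ I₂ p a + bigInr I₁ I₂ p b) = b := by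
    intro a b
    refine Prod.ext ?_ (ContinuousLinearMap.ext fun x => ?_)
    · change 0 + b.1 = b.1
      simp
    · change a.2 0 + b.2 x = b.2 x
      simp
  exact h _ _

/-- The form `H₁ + H₂` on `M₁ × M₂`, that is, the sum of the pullbacks of `H₁` and `H₂`. -/
def prodForm {k : ℕ} (H₁ : Form I₁ M₁ k) (H₂ : Form I₂ M₂ k) :
    Form (I₁.prod I₂) (M₁ × M₂) k := fun p =>
  (H₁ p.1).compContinuousLinearMap (tangentFst I₁ I₂ p)
    + (H₂ p.2).compContinuousLinearMap (tangentSnd I₁ I₂ p)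

end Product

end GenGeom

end

/-! Write `J` for the induced endomorphism and `G` for the product metric. The proof separates
algebra from integrability.

Algebra. Compatibility forces `G` to exchange `E₊` and `E₋` and to commute with `Φ` on each factor
(`metric_Ep`, `metric_map`). Hence `GJ` is again an induced endomorphism, built from `GᵢΦᵢ` with
`E₊`, `E₋` interchanged on the first factor only (`compEnd_prodEnd_inducedEnd`), and the purely
algebraic Kähler conditions are automatic (`isGenKahler_inducedEnd_iff`). On the other side, `G`
only permutes `E₊` and `E₋`, so coKähler means that `Φ` and `GΦ` are both normal. It remains to show
that an induced `J` is integrable if and only if both of its contact structures are normal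
(`isGenComplex_inducedEnd_iff`).

Integrability. Involutivity of the eigenbundle of `J` is the vanishing of a Nijenhuis expression
`N`, which is tensorial. `N` can therefore be tested at a point on pullbacks from the factors.
Brackets between pullbacks from different factors vanish, and `J` sends `E₊₁` to `E₋₂` and `E₋₁` to
`E₊₂`, so horizontal sections of both factors together with `E₊₁`, `E₋₁` generate everything under
`J`. On these generators `N = 0` becomes a list of bracket relations on each factor, collected in
`NormalBrackets`.

Normality. These relations are equivalent to normality (`isNormal_iff`). In one direction, cyclicity
of the bracket gives `⟨[[u, E₊]], E₋⟩ = ⟨[[E₊, E₋]], u⟩ = 0` for horizontal `u`, so brackets with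
`E₊` that lie in `L⁺` already lie in the eigenbundle; and `L⁺ ∩ L⁻` is the eigenbundle. In the
other, the Leibniz rule expands the bracket of two sections of `L⁺` into the listed brackets modulo
`E₊`.

All bracket identities come from one formula, `pairing_courant`, in terms of the flat connection of
a chart. -/

noncomputable section

namespace GenGeom

/-! ### Sections and endomorphisms of the big tangent bundle in a chart. -/

section LocalExpressions

variable {E : Type*} [NormedAddCommGroup E] [NormedSpace ℝ E]
  {K : Type*} [TopologicalSpace K] {I : ModelWithCorners ℝ E K}
  {M : Type*} [TopologicalSpace M] [ChartedSpace K M]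

variable (I) in
/-- The map from the big tangent space at `φ⁻¹(e)` to the model fibre induced by the chart `φ`
at `p`. -/
def toModel (p : M) (e : E) :
    BigTangent I ((extChartAt I p).symm e) →L[ℝ] E × (E →L[ℝ] ℝ) :=
  ContinuousLinearMap.prodMap
    (show TangentSpace I ((extChartAt I p).symm e) →L[ℝ] E from
      mfderiv I 𝓘(ℝ, E) (extChartAt I p) ((extChartAt I p).symm e))
    (ContinuousLinearMap.precomp ℝ
      (show E →L[ℝ] TangentSpace I ((extChartAt I p).symm e) from
        mfderivWithin 𝓘(ℝ, E) I (extChartAt I p).symm (Set.range I) e))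

variable (I) in
/-- The map from the model fibre to the big tangent space at `φ⁻¹(e)` induced by the chart `φ`
at `p`. -/
def fromModel (p : M) (e : E) :
    E × (E →L[ℝ] ℝ) →L[ℝ] BigTangent I ((extChartAt I p).symm e) :=
  ContinuousLinearMap.prodMap
    (show E →L[ℝ] TangentSpace I ((extChartAt I p).symm e) from
        mfderivWithin 𝓘(ℝ, E) I (extChartAt I p).symm (Set.range I) e)
    (ContinuousLinearMap.precomp ℝ
    (show TangentSpace I ((extChartAt I p).symm e) →L[ℝ] E from
      mfderiv I 𝓘(ℝ, E) (extChartAt I p) ((extChartAt I p).symm e)))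

/-- The expression of a section of `TM ⊕ T*M` in the preferred chart at `p`. -/
def localSection (p : M) (a : BigSection I M) (e : E) : E × (E →L[ℝ] ℝ) :=
  toModel I p e (a ((extChartAt I p).symm e))

/-- The expression of an endomorphism of `TM ⊕ T*M` in the preferred chart at `p`. -/
def localEnd (p : M) (Φ : BigEnd I M) (e : E) :
    (E × (E →L[ℝ] ℝ)) →L[ℝ] (E × (E →L[ℝ] ℝ)) :=
  toModel I p e ∘L Φ ((extChartAt I p).symm e) ∘L fromModel I p e

/-- The neutral metric on the model fibre. -/
def modelPairing (a b : E × (E →L[ℝ] ℝ)) : ℝ := (1 / 2) * (b.2 a.1 + a.2 b.1)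

variable [IsManifold I ∞ M]

section
variable {p : M} {e : E}

theorem isManifold_one : IsManifold I 1 M := IsManifold.of_le (n := ∞) (by norm_num)

theorem mfderiv_comp_symm (he : e ∈ (extChartAt I p).target) (v : E) :
    mfderiv I 𝓘(ℝ, E) (extChartAt I p) ((extChartAt I p).symm e)
      (mfderivWithin 𝓘(ℝ, E) I (extChartAt I p).symm (Set.range I) e v) = v := by
  have : IsManifold I 1 M := isManifold_one
  exact DFunLike.congr_fun (mfderiv_extChartAt_comp_mfderivWithin_extChartAt_symm he) v

theorem symm_comp_mfderiv (he : e ∈ (extChartAt I p).target)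
    (v : TangentSpace I ((extChartAt I p).symm e)) :
    mfderivWithin 𝓘(ℝ, E) I (extChartAt I p).symm (Set.range I) e
      (mfderiv I 𝓘(ℝ, E) (extChartAt I p) ((extChartAt I p).symm e) v) = v := by
  have : IsManifold I 1 M := isManifold_one
  exact DFunLike.congr_fun (mfderivWithin_extChartAt_symm_comp_mfderiv_extChartAt he) v

theorem fromModel_toModel (he : e ∈ (extChartAt I p).target)
    (v : BigTangent I ((extChartAt I p).symm e)) : fromModel I p e (toModel I p e v) = v := by
  refine Prod.ext (symm_comp_mfderiv he v.1) (ContinuousLinearMap.ext fun w => ?_)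
  change v.2 _ = v.2 w
  exact congrArg v.2 (symm_comp_mfderiv he w)

theorem toModel_fromModel (he : e ∈ (extChartAt I p).target)
    (v : E × (E →L[ℝ] ℝ)) : toModel I p e (fromModel I p e v) = v := by
  refine Prod.ext (mfderiv_comp_symm he v.1) (ContinuousLinearMap.ext fun w => ?_)
  change v.2 _ = v.2 w
  exact congrArg v.2 (mfderiv_comp_symm he w)

/-- Vectors are pushed forward by the chart and covectors pulled back by its inverse, so evaluation,
and with it the neutral metric, has constant coefficients in the chart. -/
theorem modelPairing_toModel (he : e ∈ (extChartAt I p).target)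
    (v w : BigTangent I ((extChartAt I p).symm e)) :
    modelPairing (toModel I p e v) (toModel I p e w) = pairing v w := by
  have h : ∀ v w : BigTangent I ((extChartAt I p).symm e),
      (toModel I p e v).2 (toModel I p e w).1 = v.2 w.1 := fun v w =>
    congrArg v.2 (symm_comp_mfderiv he w.1)
  simp only [modelPairing, pairing, h]

theorem localEnd_localSection (he : e ∈ (extChartAt I p).target) (Φ : BigEnd I M)
    (a : BigSection I M) :
    localEnd p Φ e (localSection p a e) = localSection p (fun x => Φ x (a x)) e := by
  simp only [localEnd, localSection, ContinuousLinearMap.comp_apply, fromModel_toModel he]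

theorem localEnd_comp (he : e ∈ (extChartAt I p).target) (Φ Ψ : BigEnd I M) :
    localEnd p Φ e ∘L localEnd p Ψ e = localEnd p (compEnd Φ Ψ) e := by
  refine ContinuousLinearMap.ext fun v => ?_
  simp only [localEnd, compEnd, ContinuousLinearMap.comp_apply, fromModel_toModel he]

theorem trivializationAt_big_apply (he : e ∈ (extChartAt I p).target)
    (v : BigTangent I ((extChartAt I p).symm e)) :
    (trivializationAt (E × (E →L[ℝ] ℝ)) (BigTangent I) p
      ⟨(extChartAt I p).symm e, v⟩).2 = toModel I p e v := by
  have : IsManifold I 1 M := isManifold_one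
  have hs : (extChartAt I p).symm e ∈ (chartAt K p).source := by
    rw [← extChartAt_source I]; exact (extChartAt I p).map_target he
  have h1 := TangentBundle.continuousLinearMapAt_trivializationAt (I := I) hs
  have h2 := TangentBundle.symmL_trivializationAt (I := I) hs
  have hr : extChartAt I p ((extChartAt I p).symm e) = e := (extChartAt I p).right_inv he
  rw [hr] at h2
  refine Prod.ext ?_ ?_
  · change (trivializationAt E (TangentSpace I) p ⟨(extChartAt I p).symm e, v.1⟩).2 = _
    rw [← Trivialization.continuousLinearMapAt_apply_of_mem ℝ _ hs]
    exact DFunLike.congr_fun h1 v.1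
  · change (trivializationAt (E →L[ℝ] ℝ)
      (fun x => TangentSpace I x →L[ℝ] Bundle.Trivial M ℝ x) p ⟨(extChartAt I p).symm e, v.2⟩).2 = _
    rw [hom_trivializationAt_apply]
    refine ContinuousLinearMap.ext fun w => ?_
    change (trivializationAt ℝ (Bundle.Trivial M ℝ) p).continuousLinearMapAt ℝ
      ((extChartAt I p).symm e) (v.2 ((trivializationAt E (TangentSpace I) p).symmL ℝ
      ((extChartAt I p).symm e) w)) = _
    rw [h2, Trivialization.continuousLinearMapAt_apply_of_mem ℝ _ (Set.mem_univ _)]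
    rfl

theorem hom_trivializationAt_big_apply (he : e ∈ (extChartAt I p).target)
    (Φ : BigTangent I ((extChartAt I p).symm e) →L[ℝ] BigTangent I ((extChartAt I p).symm e)) :
    (trivializationAt ((E × (E →L[ℝ] ℝ)) →L[ℝ] (E × (E →L[ℝ] ℝ)))
      (fun x => BigTangent I x →L[ℝ] BigTangent I x) p
      ⟨(extChartAt I p).symm e, Φ⟩).2 = toModel I p e ∘L Φ ∘L fromModel I p e := by
  have hs : (extChartAt I p).symm e ∈ (chartAt K p).source := by
    rw [← extChartAt_source I]; exact (extChartAt I p).map_target he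
  have hb : (extChartAt I p).symm e ∈
      (trivializationAt (E × (E →L[ℝ] ℝ)) (BigTangent I) p).baseSet := by
    exact ⟨hs, hs, Set.mem_univ _⟩
  have h1 : (trivializationAt (E × (E →L[ℝ] ℝ)) (BigTangent I) p).continuousLinearMapAt ℝ
      ((extChartAt I p).symm e) = toModel I p e :=
    ContinuousLinearMap.ext fun v => by
      rw [Trivialization.continuousLinearMapAt_apply_of_mem ℝ _ hb]
      exact trivializationAt_big_apply he v
  have h2 : (trivializationAt (E × (E →L[ℝ] ℝ)) (BigTangent I) p).symmL ℝ
      ((extChartAt I p).symm e) = fromModel I p e :=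
    ContinuousLinearMap.ext fun v => by
      have := Trivialization.symmL_continuousLinearMapAt (R := ℝ)
        (trivializationAt (E × (E →L[ℝ] ℝ)) (BigTangent I) p) hb (fromModel I p e v)
      rw [h1, toModel_fromModel he] at this
      exact this
  rw [hom_trivializationAt_apply]
  simp only [ContinuousLinearMap.inCoordinates, h1, h2]

theorem contMDiffAt_iff_contDiffAt_of_eventuallyEq [I.Boundaryless] {F : Type*}
    [NormedAddCommGroup F] [NormedSpace ℝ F] {f : M → F} {g : E → F}
    (h : ∀ e ∈ (extChartAt I p).target, f ((extChartAt I p).symm e) = g e) :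
    ContMDiffAt I 𝓘(ℝ, F) ∞ f p ↔ ContDiffAt ℝ ∞ g (extChartAt I p p) := by
  rw [contMDiffAt_iff_source, I.range_eq_univ, contMDiffWithinAt_univ, contMDiffAt_iff_contDiffAt]
  have h' : f ∘ (extChartAt I p).symm =ᶠ[nhds (extChartAt I p p)] g := by
    filter_upwards [extChartAt_target_mem_nhds (I := I) p] with e he using h e he
  exact ⟨fun hf => hf.congr_of_eventuallyEq h'.symm, fun hg => hg.congr_of_eventuallyEq h'⟩

theorem isSmoothSection_iff [I.Boundaryless] {a : BigSection I M} :
    IsSmoothSection a ↔ ∀ p, ContDiffAt ℝ ∞ (localSection p a) (extChartAt I p p) := by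
  refine forall_congr' fun p => ?_
  rw [contMDiffAt_section]
  exact contMDiffAt_iff_contDiffAt_of_eventuallyEq fun e he => trivializationAt_big_apply he _

theorem isSmoothEnd_iff [I.Boundaryless] {Φ : BigEnd I M} :
    IsSmoothEnd Φ ↔ ∀ p, ContDiffAt ℝ ∞ (localEnd p Φ) (extChartAt I p p) := by
  refine forall_congr' fun p => ?_
  rw [contMDiffAt_section]
  exact contMDiffAt_iff_contDiffAt_of_eventuallyEq fun e he => hom_trivializationAt_big_apply he _

end

end LocalExpressions

/-! ### The Courant bracket in terms of the flat connection of a chart. -/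

section CourantFormula

variable {E : Type*} [NormedAddCommGroup E] [NormedSpace ℝ E]
  {K : Type*} [TopologicalSpace K] {I : ModelWithCorners ℝ E K}
  {M : Type*} [TopologicalSpace M] [ChartedSpace K M]

/-- The derivative at `p` of a section of `TM ⊕ T*M` with respect to the flat connection of the
preferred chart at `p`. -/
def sectionDeriv (a : BigSection I M) (p : M) : TangentSpace I p →L[ℝ] BigTangent I p :=
  show E →L[ℝ] E × (E →L[ℝ] ℝ) from fderiv ℝ (localSection p a) (extChartAt I p p)

variable [IsManifold I ∞ M] {p : M}

/-- The tangent space at `p` is the model space read through the preferred chart at `p`, so chart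
derivatives at `p` need no further transport. -/
theorem mfderiv_extChartAt_self_apply (v : TangentSpace I p) :
    mfderiv I 𝓘(ℝ, E) (extChartAt I p) p v = v := by
  have : IsManifold I 1 M := isManifold_one
  exact DFunLike.congr_fun (mfderiv_extChartAt_self (I := I) (x := p)) v

theorem mfderivWithin_extChartAt_symm_self_apply (v : E) :
    mfderivWithin 𝓘(ℝ, E) I (extChartAt I p).symm (Set.range I) (extChartAt I p p) v = v := by
  have : IsManifold I 1 M := isManifold_one
  exact DFunLike.congr_fun (mfderivWithin_range_extChartAt_symm (I := I) (x := p)) v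

theorem localSection_self (a : BigSection I M) : localSection p a (extChartAt I p p) = a p := by
  -- The point `φ⁻¹(φ(p))` equals `p` only propositionally, so each fact is stated for a variable
  -- point `x = p` before substituting.
  have h : ∀ x, x = p → ∀ v : E, mfderiv I 𝓘(ℝ, E) (extChartAt I p) x v = v := by
    rintro x rfl v
    exact mfderiv_extChartAt_self_apply v
  have h' : ∀ x, x = p → (a x : E × (E →L[ℝ] ℝ)) = a p := by
    rintro x rfl
    rfl
  rw [← h' _ (extChartAt_to_inv (I := I) p)]
  refine Prod.ext (h _ (extChartAt_to_inv p) _) (ContinuousLinearMap.ext fun w => ?_)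
  exact congrArg (a ((extChartAt I p).symm (extChartAt I p p))).2
    (mfderivWithin_extChartAt_symm_self_apply w)

theorem mvfderiv_eq_of_eqOn [I.Boundaryless] {f : M → ℝ} {g : E → ℝ} {g' : E →L[ℝ] ℝ}
    (h : ∀ e ∈ (extChartAt I p).target, f ((extChartAt I p).symm e) = g e)
    (hg : HasFDerivAt g g' (extChartAt I p p)) (v : TangentSpace I p):
    mvfderiv I f p v = g' v := by
  have : IsManifold I 1 M := isManifold_one
  have h1 : f =ᶠ[nhds p] g ∘ extChartAt I p := by
    filter_upwards [extChartAt_source_mem_nhds (I := I) p] with x hx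
    rw [Function.comp_apply, ← h _ ((extChartAt I p).map_source hx), (extChartAt I p).left_inv hx]
  have h2 := (mdifferentiableAt_extChartAt (I := I) (mem_chart_source K p)).hasMFDerivAt
  have h3 := (hg.hasMFDerivAt.comp p h2).congr_of_eventuallyEq h1
  rw [mvfderiv, h3.mfderiv]
  exact congrArg g' (mfderiv_extChartAt_self_apply v)

theorem mlieBracket_eq [I.Boundaryless] [CompleteSpace E] {a b : BigSection I M}
    (ha : DifferentiableAt ℝ (localSection p a) (extChartAt I p p))
    (hb : DifferentiableAt ℝ (localSection p b) (extChartAt I p p)) :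
    VectorField.mlieBracket I (fun y => (a y).1) (fun y => (b y).1) p
     = (sectionDeriv b p (a p).1).1 - (sectionDeriv a p (b p).1).1 := by
  have hM : IsManifold I 1 M := isManifold_one
  have key : ∀ c : BigSection I M,
     VectorField.mpullbackWithin 𝓘(ℝ, E) I (extChartAt I p).symm (fun y => (c y).1) (Set.range I)
      =ᶠ[nhds (extChartAt I p p)] fun e => (localSection p c e).1 := by
    intro c
    filter_upwards [extChartAt_target_mem_nhds (I := I) p] with e he
    have hi : (mfderivWithin 𝓘(ℝ, E) I (extChartAt I p).symm (Set.range I) e).IsInvertible :=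
      isInvertible_mfderivWithin_extChartAt_symm he
    exact hi.inverse_apply_eq.2 (symm_comp_mfderiv he _).symm
  have h1 : (mfderiv I 𝓘(ℝ, E) (extChartAt I p) p).inverse
      = ContinuousLinearMap.id ℝ (TangentSpace I p) := by
    rw [mfderiv_extChartAt_self]
    exact ContinuousLinearMap.inverse_id
  have hd : ∀ c : BigSection I M, DifferentiableAt ℝ (localSection p c) (extChartAt I p p) →
      fderiv ℝ (fun e => (localSection p c e).1) (extChartAt I p p) =
        ContinuousLinearMap.fst ℝ E (E →L[ℝ] ℝ) ∘L
          fderiv ℝ (localSection p c) (extChartAt I p p) := fun c hc => hc.hasFDerivAt.fst.fderiv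
  rw [← VectorField.mlieBracketWithin_univ, VectorField.mlieBracketWithin_apply, h1,
    Set.preimage_univ, Set.univ_inter,
    ((key a).filter_mono nhdsWithin_le_nhds).lieBracketWithin_vectorField_eq (key a).self_of_nhds
      ((key b).filter_mono nhdsWithin_le_nhds) (key b).self_of_nhds,
    I.range_eq_univ, VectorField.lieBracketWithin_univ, VectorField.lieBracket, hd a ha, hd b hb,
    localSection_self, localSection_self]
  rfl

theorem localSection_snd_fst {e : E} (he : e ∈ (extChartAt I p).target) (a b : BigSection I M) :
    (b ((extChartAt I p).symm e)).2 (a ((extChartAt I p).symm e)).1 =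
      (localSection p b e).2 (localSection p a e).1 :=
  (congrArg (b ((extChartAt I p).symm e)).2 (symm_comp_mfderiv he _)).symm

theorem mvfderiv_snd_fst [I.Boundaryless] {a b : BigSection I M}
    (ha : DifferentiableAt ℝ (localSection p a) (extChartAt I p p))
    (hb : DifferentiableAt ℝ (localSection p b) (extChartAt I p p)) (v : TangentSpace I p) :
    mvfderiv I (fun y => (b y).2 (a y).1) p v =
      (sectionDeriv b p v).2 (a p).1 + (b p).2 (sectionDeriv a p v).1 := by
  have h := hb.hasFDerivAt.snd.clm_apply ha.hasFDerivAt.fst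
  rw [mvfderiv_eq_of_eqOn (fun e he => localSection_snd_fst he a b) h, localSection_self,
    localSection_self]
  exact add_comm _ _

/-- In Cartan's formula `dβ(X, v)` contributes `(D_X β)(v) - (D_v β)(X)` and `d(β(X))(v)`
contributes `(D_v β)(X) + β(D_v X)`; the terms `(D_v β)(X)` cancel. -/
theorem lieDerivative_apply [I.Boundaryless] {a b : BigSection I M}
    (ha : DifferentiableAt ℝ (localSection p a) (extChartAt I p p))
    (hb : DifferentiableAt ℝ (localSection p b) (extChartAt I p p)) (v : TangentSpace I p) :
    lieDerivative (fun y => (a y).1) (fun y => (b y).2) p v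
     = (sectionDeriv b p (a p).1).2 v + (b p).2 (sectionDeriv a p v).1 := by
  have hform : (oneForm fun y => (b y).2).inChart p = fun e =>
    (ContinuousAlternatingMap.ofSubsingletonLIE (0 : Fin 1) :
      (E →L[ℝ] ℝ) ≃ₗᵢ[ℝ] E [⋀^Fin 1]→L[ℝ] ℝ) (localSection p b e).2 := by
    rfl
  have hd : DifferentiableAt ℝ ((oneForm fun y => (b y).2).inChart p) (extChartAt I p p) := by
    rw [hform]
    exact (LinearIsometryEquiv.differentiableAt _).comp _ hb.snd
  have hap : ∀ (u : Fin 1 → E) (v : E),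
      fderiv ℝ (fun e => (oneForm fun y => (b y).2).inChart p e u) (extChartAt I p p) v =
        (fderiv ℝ (localSection p b) (extChartAt I p p) v).2 (u 0) := by
    intro u v
    have h := DFunLike.congr_fun
      (hb.hasFDerivAt.snd.clm_apply (hasFDerivAt_const (u 0) (extChartAt I p p))).fderiv v
    rw [add_apply, ContinuousLinearMap.comp_apply, zero_apply, map_zero, zero_add] at h
    exact h
  rw [lieDerivative, add_apply, mvfderiv_snd_fst ha hb, contract₁_apply, Form.extDer]
  have h3 : extDeriv ((oneForm fun y => (b y).2).inChart p) (extChartAt I p p)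
      ![(a p).1, v] = (sectionDeriv b p (a p).1).2 v - (sectionDeriv b p v).2 (a p).1 := by
    rw [extDeriv_apply hd, Fin.sum_univ_two]
    refine (congrArg₂ (fun r s : ℝ => (-1) ^ 0 • r + (-1) ^ 1 • s)
      (hap ((0 : Fin 2).removeNth ![((a p).1 : E), v]) (a p).1)
      (hap ((1 : Fin 2).removeNth ![((a p).1 : E), v]) v)).trans ?_
    simp only [pow_zero, pow_one, one_smul, neg_smul, ← sub_eq_add_neg]
    rfl
  have h4 : ((extDerivWithin ((oneForm fun y => (b y).2).inChart p) (Set.range I)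
      (extChartAt I p p)).compContinuousLinearMap (mfderiv I 𝓘(ℝ, E) (extChartAt I p) p))
      ![(a p).1, v] = (sectionDeriv b p (a p).1).2 v - (sectionDeriv b p v).2 (a p).1 := by
    rw [← h3, I.range_eq_univ, extDerivWithin_univ, mfderiv_extChartAt_self]
    rfl
  refine (congrArg (· + _) h4).trans ?_
  ring

/-- Pairing with `z` merges the vector and covector parts of the bracket into one expression in the
flat connection, the neutral metric and `H`. The algebraic properties of the bracket follow from it
by linear algebra. -/
theorem pairing_courant [I.Boundaryless] [CompleteSpace E] (H : Form I M 3) {a b : BigSection I M}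
    (ha : DifferentiableAt ℝ (localSection p a) (extChartAt I p p))
    (hb : DifferentiableAt ℝ (localSection p b) (extChartAt I p p)) (z : BigTangent I p) :
    pairing (courant H a b p) z =
      pairing (sectionDeriv b p (a p).1) z - pairing (sectionDeriv a p (b p).1) z
        + (1 / 2) * (pairing (sectionDeriv a p z.1) (b p) - pairing (sectionDeriv b p z.1) (a p))
        + (1 / 2) * H p ![(a p).1, (b p).1, z.1] := by
  have h1 : mvfderiv I (fun y => (b y).2 (a y).1 - (a y).2 (b y).1) p z.1 =
      (sectionDeriv b p z.1).2 (a p).1 + (b p).2 (sectionDeriv a p z.1).1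
      - ((sectionDeriv a p z.1).2 (b p).1 + (a p).2 (sectionDeriv b p z.1).1) := by
    have h := (hb.hasFDerivAt.snd.clm_apply ha.hasFDerivAt.fst).sub
      (ha.hasFDerivAt.snd.clm_apply hb.hasFDerivAt.fst)
    have h2 : ∀ e ∈ (extChartAt I p).target,
        (fun y => (b y).2 (a y).1 - (a y).2 (b y).1) ((extChartAt I p).symm e) =
          (localSection p b e).2 (localSection p a e).1 -
          (localSection p a e).2 (localSection p b e).1 := fun e he =>
      congrArg₂ (fun r s : ℝ => r - s) (localSection_snd_fst he a b) (localSection_snd_fst he b a)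
    rw [mvfderiv_eq_of_eqOn h2 h, localSection_self, localSection_self]
    exact congrArg₂ (fun r s : ℝ => r - s) (add_comm _ _) (add_comm _ _)
  have h2 : (courant H a b p).2 z.1 =
      lieDerivative (fun y => (a y).1) (fun y => (b y).2) p z.1
      - lieDerivative (fun y => (b y).1) (fun y => (a y).2) p z.1
      - (1 / 2) * mvfderiv I (fun y => (b y).2 (a y).1 - (a y).2 (b y).1) p z.1
      + contract₂ (H p) (a p).1 (b p).1 z.1 := rfl
  have h3 : z.2 (courant H a b p).1 =
      z.2 (sectionDeriv b p (a p).1).1 - z.2 (sectionDeriv a p (b p).1).1 :=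
    (congrArg z.2 (mlieBracket_eq ha hb)).trans (map_sub z.2 _ _)
  rw [pairing, h2, h3, h1, lieDerivative_apply ha hb, lieDerivative_apply hb ha, contract₂_apply]
  simp only [pairing]
  ring

end CourantFormula

/-! ### Bilinearity and nondegeneracy of the neutral metric. -/

section PointwiseAlgebra

variable {E : Type*} [NormedAddCommGroup E] [NormedSpace ℝ E]
  {K : Type*} [TopologicalSpace K] {I : ModelWithCorners ℝ E K}
  {M : Type*} [TopologicalSpace M] [ChartedSpace K M] {x : M}

theorem pairing_comm (a b : BigTangent I x) : pairing a b = pairing b a := by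
  simp only [pairing, add_comm]

theorem pairing_add_left (a b c : BigTangent I x) :
    pairing (a + b) c = pairing a c + pairing b c := by
  simp only [pairing, Prod.fst_add, Prod.snd_add, map_add, add_apply]
  ring

theorem pairing_smul_left (r : ℝ) (a b : BigTangent I x) :
    pairing (r • a) b = r * pairing a b := by
  simp only [pairing, Prod.smul_fst, Prod.smul_snd, map_smul, smul_apply, smul_eq_mul]
  ring

theorem pairing_add_right (a b c : BigTangent I x) :
    pairing a (b + c) = pairing a b + pairing a c := by
  rw [pairing_comm, pairing_add_left, pairing_comm b, pairing_comm c]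

theorem pairing_smul_right (r : ℝ) (a b : BigTangent I x) :
    pairing a (r • b) = r * pairing a b := by
  rw [pairing_comm, pairing_smul_left, pairing_comm b]

theorem pairing_neg_left (a b : BigTangent I x) : pairing (-a) b = -pairing a b := by
  rw [← neg_one_smul ℝ a, pairing_smul_left, neg_one_mul]

theorem pairing_neg_right (a b : BigTangent I x) : pairing a (-b) = -pairing a b := by
  rw [← neg_one_smul ℝ b, pairing_smul_right, neg_one_mul]

theorem pairing_sub_left (a b c : BigTangent I x) :
    pairing (a - b) c = pairing a c - pairing b c := by
  rw [sub_eq_add_neg, pairing_add_left, pairing_neg_left, sub_eq_add_neg]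

theorem pairing_sub_right (a b c : BigTangent I x) :
    pairing a (b - c) = pairing a b - pairing a c := by
  rw [sub_eq_add_neg, pairing_add_right, pairing_neg_right, sub_eq_add_neg]

theorem pairing_zero_left (a : BigTangent I x) : pairing 0 a = 0 := by
  simpa using pairing_smul_left 0 a a

theorem pairing_zero_right (a : BigTangent I x) : pairing a 0 = 0 := by
  simpa using pairing_smul_right 0 a a

/-- Testing against covectors recovers the vector part, since the continuous dual separates points;
testing against vectors recovers the covector part. -/
theorem eq_of_forall_pairing_eq {a b : BigTangent I x} (h : ∀ z, pairing a z = pairing b z) :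
    a = b := by
  refine Prod.ext ?_ (ContinuousLinearMap.ext fun v => ?_)
  · refine (SeparatingDual.eq_iff_forall_dual_eq (R := ℝ) (V := E)).2 fun ξ => ?_
    have := h (0, ξ)
    simpa [pairing] using! this
  · have := h (v, 0)
    simpa [pairing] using! this

theorem tensorEnd_apply (a b c : BigTangent I x) : tensorEnd a b c = (2 * pairing b c) • a := by
  rw [← dualOf_apply]
  rfl

end PointwiseAlgebra

/-! ### Smooth sections and the Leibniz rules for the flat connection. -/

section SmoothSections

variable {E : Type*} [NormedAddCommGroup E] [NormedSpace ℝ E]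
  {K : Type*} [TopologicalSpace K] {I : ModelWithCorners ℝ E K}
  {M : Type*} [TopologicalSpace M] [ChartedSpace K M]

/-- The image of a section under a field of endomorphisms. -/
def mapSection (Φ : BigEnd I M) (a : BigSection I M) : BigSection I M := fun x => Φ x (a x)

variable {p : M} {a b c : BigSection I M} {Φ Ψ : BigEnd I M}

theorem localSection_add : localSection p (a + b) = localSection p a + localSection p b :=
  funext fun _ => map_add _ _ _

theorem localSection_smul (r : ℝ) : localSection p (r • a) = r • localSection p a :=
  funext fun e => map_smul (toModel I p e) r _

theorem localSection_fun_smul (f : M → ℝ) :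
    localSection p (fun x => f x • a x) =
      fun e => f ((extChartAt I p).symm e) • localSection p a e :=
  funext fun _ => map_smul _ _ _

variable [IsManifold I ∞ M] [I.Boundaryless]

theorem IsSmoothSection.contDiffAt (ha : IsSmoothSection a) (p : M) :
    ContDiffAt ℝ ∞ (localSection p a) (extChartAt I p p) := isSmoothSection_iff.1 ha p

theorem IsSmoothSection.differentiableAt (ha : IsSmoothSection a) (p : M) :
    DifferentiableAt ℝ (localSection p a) (extChartAt I p p) :=
  (ha.contDiffAt p).differentiableAt (by simp)

theorem IsSmoothEnd.contDiffAt (hΦ : IsSmoothEnd Φ) (p : M) :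
    ContDiffAt ℝ ∞ (localEnd p Φ) (extChartAt I p p) := isSmoothEnd_iff.1 hΦ p

theorem IsSmoothSection.add (ha : IsSmoothSection a) (hb : IsSmoothSection b) :
    IsSmoothSection (a + b) :=
  isSmoothSection_iff.2 fun p => by
    rw [localSection_add]
    exact (ha.contDiffAt p).add (hb.contDiffAt p)

theorem IsSmoothSection.smul (r : ℝ) (ha : IsSmoothSection a) : IsSmoothSection (r • a) :=
  isSmoothSection_iff.2 fun p => by
    rw [localSection_smul]
    exact (ha.contDiffAt p).const_smul r

theorem IsSmoothSection.neg (ha : IsSmoothSection a) : IsSmoothSection (-a) := by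
  rw [← neg_one_smul ℝ a]
  exact ha.smul (-1)

theorem IsSmoothSection.sub (ha : IsSmoothSection a) (hb : IsSmoothSection b) :
    IsSmoothSection (a - b) := by
  rw [sub_eq_add_neg]
  exact ha.add hb.neg

theorem IsSmoothSection.zero : IsSmoothSection (0 : BigSection I M) :=
  isSmoothSection_iff.2 fun p => by
    have h : localSection p (0 : BigSection I M) = fun _ => 0 := funext fun _ => map_zero _
    rw [h]
    exact contDiffAt_const

theorem contMDiffAt_iff_contDiffAt_comp_symm {f : M → ℝ} :
    ContMDiffAt I 𝓘(ℝ, ℝ) ∞ f p ↔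
      ContDiffAt ℝ ∞ (fun e => f ((extChartAt I p).symm e)) (extChartAt I p p) :=
  contMDiffAt_iff_contDiffAt_of_eventuallyEq fun _ _ => rfl

theorem IsSmoothSection.fun_smul {f : M → ℝ} (hf : ContMDiff I 𝓘(ℝ, ℝ) ∞ f)
    (ha : IsSmoothSection a) : IsSmoothSection (fun x => f x • a x) :=
  isSmoothSection_iff.2 fun p => by
    rw [localSection_fun_smul]
    exact (contMDiffAt_iff_contDiffAt_comp_symm.1 (hf p)).smul (ha.contDiffAt p)

theorem IsSmoothSection.contMDiff_pairing (ha : IsSmoothSection a) (hb : IsSmoothSection b) :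
    ContMDiff I 𝓘(ℝ, ℝ) ∞ (fun x => pairing (a x) (b x)) := fun p =>
  (contMDiffAt_iff_contDiffAt_of_eventuallyEq
    (g := fun e => modelPairing (localSection p a e) (localSection p b e))
    (fun _ he => (modelPairing_toModel he _ _).symm)).2
    (contDiffAt_const.mul (((hb.contDiffAt p).snd.clm_apply (ha.contDiffAt p).fst).add
      ((ha.contDiffAt p).snd.clm_apply (hb.contDiffAt p).fst)))

theorem eventuallyEq_localSection_mapSection :
    localSection p (mapSection Φ a) =ᶠ[nhds (extChartAt I p p)]
      fun e => localEnd p Φ e (localSection p a e) := by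
  filter_upwards [extChartAt_target_mem_nhds (I := I) p] with e he
  exact (localEnd_localSection he Φ a).symm

theorem IsSmoothEnd.mapSection (hΦ : IsSmoothEnd Φ) (ha : IsSmoothSection a) :
    IsSmoothSection (mapSection Φ a) :=
  isSmoothSection_iff.2 fun p =>
    ((hΦ.contDiffAt p).clm_apply (ha.contDiffAt p)).congr_of_eventuallyEq
      eventuallyEq_localSection_mapSection

theorem IsSmoothEnd.compEnd (hΦ : IsSmoothEnd Φ) (hΨ : IsSmoothEnd Ψ) :
    IsSmoothEnd (compEnd Φ Ψ) :=
  isSmoothEnd_iff.2 fun p => by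
    refine ((hΦ.contDiffAt p).clm_comp (hΨ.contDiffAt p)).congr_of_eventuallyEq ?_
    filter_upwards [extChartAt_target_mem_nhds (I := I) p] with e he
    exact (localEnd_comp he Φ Ψ).symm

theorem sectionDeriv_add (ha : IsSmoothSection a) (hb : IsSmoothSection b) (v : TangentSpace I p) :
    sectionDeriv (a + b) p v = sectionDeriv a p v + sectionDeriv b p v := by
  rw [sectionDeriv, localSection_add]
  exact DFunLike.congr_fun ((ha.differentiableAt p).hasFDerivAt.add
    (hb.differentiableAt p).hasFDerivAt).fderiv v

theorem sectionDeriv_smul (r : ℝ) (ha : IsSmoothSection a) (v : TangentSpace I p) :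
    sectionDeriv (r • a) p v = r • sectionDeriv a p v := by
  rw [sectionDeriv, localSection_smul]
  exact DFunLike.congr_fun ((ha.differentiableAt p).hasFDerivAt.const_smul r).fderiv v

/-- The functional is the differential of `f`; only its existence matters later. -/
theorem exists_sectionDeriv_fun_smul {f : M → ℝ} (hf : ContMDiff I 𝓘(ℝ, ℝ) ∞ f)
    (ha : IsSmoothSection a) (p : M) : ∃ f' : TangentSpace I p →L[ℝ] ℝ, ∀ v,
      sectionDeriv (fun x => f x • a x) p v = f p • sectionDeriv a p v + f' v • a p := by
  have h1 := ((contMDiffAt_iff_contDiffAt_comp_symm.1 (hf p)).differentiableAt (by simp)).hasFDerivAt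
  refine ⟨fderiv ℝ (fun e => f ((extChartAt I p).symm e)) (extChartAt I p p), fun v => ?_⟩
  have h2 := (h1.smul (ha.differentiableAt p).hasFDerivAt).fderiv
  rw [extChartAt_to_inv, localSection_self] at h2
  rw [sectionDeriv, localSection_fun_smul]
  exact DFunLike.congr_fun h2 v

theorem localEnd_self (Φ : BigEnd I M) (v : BigTangent I p) :
    localEnd p Φ (extChartAt I p p) v = Φ p v := by
  have h : ∀ x, x = p → ∀ v : E, mfderiv I 𝓘(ℝ, E) (extChartAt I p) x v = v := by
    rintro x rfl v
    exact mfderiv_extChartAt_self_apply v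
  have h1 : ∀ v, toModel I p (extChartAt I p p) v = v := fun v =>
    Prod.ext (h _ (extChartAt_to_inv p) _) (ContinuousLinearMap.ext fun w =>
      congrArg v.2 (mfderivWithin_extChartAt_symm_self_apply w))
  have h2 : ∀ v, fromModel I p (extChartAt I p p) v = v := fun v =>
    (h1 _).symm.trans (toModel_fromModel (mem_extChartAt_target p) v)
  have h3 : ∀ x, x = p → ∀ v : E × (E →L[ℝ] ℝ), (Φ x v : E × (E →L[ℝ] ℝ)) = Φ p v := by
    rintro x rfl v
    rfl
  refine (h1 _).trans (Eq.trans ?_ (h3 _ (extChartAt_to_inv (I := I) p) v))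
  exact congrArg _ (h2 v)

/-- The term of the product rule that differentiates `Φ` is applied to `a p = 0`. This drives the
tensoriality of the Nijenhuis expression. -/
theorem sectionDeriv_mapSection_of_eq_zero (hΦ : IsSmoothEnd Φ) (ha : IsSmoothSection a)
    (h0 : a p = 0) (v : TangentSpace I p) :
    sectionDeriv (mapSection Φ a) p v = Φ p (sectionDeriv a p v) := by
  have h1 := (((hΦ.contDiffAt p).differentiableAt (by simp)).hasFDerivAt.clm_apply
    (ha.differentiableAt p).hasFDerivAt).congr_of_eventuallyEq eventuallyEq_localSection_mapSection
  rw [localSection_self, h0] at h1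
  have h2 : ∀ w : E, fderiv ℝ (localSection p (mapSection Φ a)) (extChartAt I p p) w =
      localEnd p Φ (extChartAt I p p) (fderiv ℝ (localSection p a) (extChartAt I p p) w) := by
    intro w
    rw [h1.fderiv, add_apply, ContinuousLinearMap.comp_apply]
    exact (congrArg _ (map_zero
      (fderiv ℝ (localEnd p Φ) (extChartAt I p p) w))).trans (add_zero _)
  exact (h2 v).trans (localEnd_self Φ _)

/-- The flat connection is metric because the neutral metric has constant coefficients in the chart;
here the function being differentiated is constant. -/
theorem pairing_sectionDeriv_add (ha : IsSmoothSection a) (hb : IsSmoothSection b) {r : ℝ}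
    (hr : ∀ x, pairing (a x) (b x) = r) (v : TangentSpace I p) :
    pairing (sectionDeriv a p v) (b p) + pairing (a p) (sectionDeriv b p v) = 0 := by
  have ha' := (ha.differentiableAt p).hasFDerivAt
  have hb' := (hb.differentiableAt p).hasFDerivAt
  have h1 := ((hb'.snd.clm_apply ha'.fst).add (ha'.snd.clm_apply hb'.fst)).const_mul (1 / 2)
  have h2 : (fun e => (1 / 2 : ℝ) * ((localSection p b e).2 (localSection p a e).1
      + (localSection p a e).2 (localSection p b e).1)) =ᶠ[nhds (extChartAt I p p)] fun _ => r := by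
    filter_upwards [extChartAt_target_mem_nhds (I := I) p] with e he
    exact (modelPairing_toModel he _ _).trans (hr _)
  rw [localSection_self, localSection_self] at h1
  have h3 := (h1.congr_of_eventuallyEq h2.symm).unique (hasFDerivAt_const r (extChartAt I p p))
  have h4 : (1 / 2 : ℝ) * (((b p).2 (sectionDeriv a p v).1 + (sectionDeriv b p v).2 (a p).1)
      + ((a p).2 (sectionDeriv b p v).1 + (sectionDeriv a p v).2 (b p).1)) = 0 :=
    DFunLike.congr_fun h3 v
  rw [← h4]
  simp only [pairing]
  ring

end SmoothSections

section BigTangentLinear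

variable {E : Type*} [NormedAddCommGroup E] [NormedSpace ℝ E]
  {K : Type*} [TopologicalSpace K] {I : ModelWithCorners ℝ E K}
  {M : Type*} [TopologicalSpace M] [ChartedSpace K M] {x : M}

/-! Linearity of endomorphisms of `TM ⊕ T*M`, specialized to spare instance searches. -/

theorem bigEnd_add (T : BigTangent I x →L[ℝ] BigTangent I x) (u v : BigTangent I x) :
    T (u + v) = T u + T v := T.map_add u v

theorem bigEnd_sub (T : BigTangent I x →L[ℝ] BigTangent I x) (u v : BigTangent I x) :
    T (u - v) = T u - T v := T.map_sub u v

theorem bigEnd_neg (T : BigTangent I x →L[ℝ] BigTangent I x) (u : BigTangent I x) :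
    T (-u) = -T u := T.map_neg u

theorem bigEnd_zero (T : BigTangent I x →L[ℝ] BigTangent I x) : T 0 = 0 := T.map_zero

theorem bigEnd_smul (T : BigTangent I x →L[ℝ] BigTangent I x) (r : ℝ) (u : BigTangent I x) :
    T (r • u) = r • T u := T.map_smul r u

theorem big_neg_one_smul (u : BigTangent I x) : (-1 : ℝ) • u = -u := neg_one_smul ℝ u

theorem big_smul_neg (r : ℝ) (u : BigTangent I x) : r • (-u) = -(r • u) := smul_neg r u

theorem big_smul_add (r : ℝ) (u v : BigTangent I x) : r • (u + v) = r • u + r • v := smul_add r u v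

theorem big_smul_sub (r : ℝ) (u v : BigTangent I x) : r • (u - v) = r • u - r • v := smul_sub r u v

theorem big_one_smul (u : BigTangent I x) : (1 : ℝ) • u = u := one_smul ℝ u

theorem big_smul_zero (r : ℝ) : r • (0 : BigTangent I x) = 0 := smul_zero r

theorem big_zero_smul (u : BigTangent I x) : (0 : ℝ) • u = 0 := zero_smul ℝ u

end BigTangentLinear

/-! ### Skew-symmetry, bilinearity, Leibniz rule and cyclicity of the Courant bracket. -/

section CourantAlgebra

variable {E : Type*} [NormedAddCommGroup E] [NormedSpace ℝ E]
  {K : Type*} [TopologicalSpace K] {I : ModelWithCorners ℝ E K}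
  {M : Type*} [TopologicalSpace M] [ChartedSpace K M]

theorem alternating_swap {x : M} (θ : TangentSpace I x [⋀^Fin 3]→L[ℝ] ℝ)
    (X Y Z : TangentSpace I x) : θ ![Y, X, Z] = -θ ![X, Y, Z] := by
  have h := θ.toAlternatingMap.map_swap ![X, Y, Z] (i := 0) (j := 1) (by decide)
  have h' : ![X, Y, Z] ∘ Equiv.swap (0 : Fin 3) 1 = ![Y, X, Z] := by
    ext i; fin_cases i <;> rfl
  rw [h'] at h
  exact h

theorem alternating_rotate {x : M} (θ : TangentSpace I x [⋀^Fin 3]→L[ℝ] ℝ)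
    (X Y Z : TangentSpace I x) : θ ![Y, Z, X] = θ ![X, Y, Z] := by
  have h := θ.toAlternatingMap.map_swap ![Y, X, Z] (i := 1) (j := 2) (by decide)
  have h' : ![Y, X, Z] ∘ Equiv.swap (1 : Fin 3) 2 = ![Y, Z, X] := by
    ext i; fin_cases i <;> rfl
  rw [h'] at h
  have h2 : θ ![Y, Z, X] = -θ ![Y, X, Z] := h
  rw [h2, alternating_swap, neg_neg]

variable [IsManifold I ∞ M] [I.Boundaryless] [CompleteSpace E]
  {H : Form I M 3} {a a' b c : BigSection I M} {p : M}

theorem pairing_courant_of_smooth (H : Form I M 3) (ha : IsSmoothSection a)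
    (hb : IsSmoothSection b) (p : M) (z : BigTangent I p) :
    pairing (courant H a b p) z =
      pairing (sectionDeriv b p (a p).1) z - pairing (sectionDeriv a p (b p).1) z
        + (1 / 2) * (pairing (sectionDeriv a p z.1) (b p) - pairing (sectionDeriv b p z.1) (a p))
        + (1 / 2) * H p ![(a p).1, (b p).1, z.1] :=
  pairing_courant H (ha.differentiableAt p) (hb.differentiableAt p) z

theorem courant_swap (ha : IsSmoothSection a) (hb : IsSmoothSection b) (p : M) :
    courant H b a p = -courant H a b p := by
  refine eq_of_forall_pairing_eq fun z => ?_
  rw [pairing_neg_left, pairing_courant_of_smooth H ha hb, pairing_courant_of_smooth H hb ha,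
    alternating_swap (H p) (a p).1]
  ring

theorem courant_self (ha : IsSmoothSection a) (p : M) : courant H a a p = 0 := by
  have h : (2 : ℝ) • courant H a a p = 0 := by
    rw [two_smul ℝ (courant H a a p)]
    nth_rw 1 [courant_swap ha ha]
    exact neg_add_cancel _
  exact (smul_eq_zero_iff_right two_ne_zero).1 h

theorem courant_add_left (ha : IsSmoothSection a) (ha' : IsSmoothSection a')
    (hb : IsSmoothSection b) (p : M) :
    courant H (a + a') b p = courant H a b p + courant H a' b p := by
  refine eq_of_forall_pairing_eq fun z => ?_
  have h1 : H p ![(a p).1 + (a' p).1, (b p).1, z.1] =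
      H p ![(a p).1, (b p).1, z.1] + H p ![(a' p).1, (b p).1, z.1] :=
    (H p).toMultilinearMap.cons_add ![(b p).1, z.1] (a p).1 (a' p).1
  simp only [pairing_add_left, pairing_courant_of_smooth H ha hb, pairing_courant_of_smooth H ha' hb,
    pairing_courant_of_smooth H (ha.add ha') hb, Pi.add_apply, sectionDeriv_add ha ha',
    Prod.fst_add, map_add, pairing_add_right, h1]
  ring

theorem courant_smul_left (r : ℝ) (ha : IsSmoothSection a) (hb : IsSmoothSection b) (p : M) :
    courant H (r • a) b p = r • courant H a b p := by
  refine eq_of_forall_pairing_eq fun z => ?_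
  have h1 : H p ![r • (a p).1, (b p).1, z.1] = r * H p ![(a p).1, (b p).1, z.1] :=
    (H p).toMultilinearMap.cons_smul ![(b p).1, z.1] r (a p).1
  simp only [pairing_smul_left, pairing_courant_of_smooth H ha hb,
    pairing_courant_of_smooth H (ha.smul r) hb, Pi.smul_apply, sectionDeriv_smul r ha,
    Prod.smul_fst, map_smul, pairing_smul_right, h1]
  ring

theorem courant_neg_left (ha : IsSmoothSection a) (hb : IsSmoothSection b) (p : M) :
    courant H (-a) b p = -courant H a b p := by
  rw [← neg_one_smul ℝ a, courant_smul_left _ ha hb, big_neg_one_smul]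

theorem courant_zero_left (hb : IsSmoothSection b) (p : M) : courant H 0 b p = 0 := by
  simpa using courant_smul_left (H := H) 0 IsSmoothSection.zero hb p

theorem courant_add_right (ha : IsSmoothSection a) (ha' : IsSmoothSection a')
    (hb : IsSmoothSection b) (p : M) :
    courant H b (a + a') p = courant H b a p + courant H b a' p := by
  rw [courant_swap (ha.add ha') hb, courant_add_left ha ha' hb, neg_add, ← courant_swap ha hb,
    ← courant_swap ha' hb]

theorem courant_smul_right (r : ℝ) (ha : IsSmoothSection a) (hb : IsSmoothSection b) (p : M) :
    courant H b (r • a) p = r • courant H b a p := by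
  rw [courant_swap (ha.smul r) hb, courant_smul_left r ha hb, ← big_smul_neg, ← courant_swap ha hb]

theorem courant_neg_right (ha : IsSmoothSection a) (hb : IsSmoothSection b) (p : M) :
    courant H b (-a) p = -courant H b a p := by
  rw [← neg_one_smul ℝ a, courant_smul_right _ ha hb, big_neg_one_smul]

theorem courant_zero_right (hb : IsSmoothSection b) (p : M) : courant H b 0 p = 0 := by
  rw [courant_swap .zero hb, courant_zero_left hb, neg_zero]

/-- The Leibniz rule for the Courant bracket of orthogonal elements. -/
theorem exists_courant_fun_smul {f : M → ℝ} (hf : ContMDiff I 𝓘(ℝ, ℝ) ∞ f)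
    (ha : IsSmoothSection a) (hb : IsSmoothSection b) (p : M) (hab : pairing (a p) (b p) = 0) :
    ∃ r : ℝ, courant H a (fun x => f x • b x) p = f p • courant H a b p + r • b p := by
  obtain ⟨f', hf'⟩ := exists_sectionDeriv_fun_smul hf hb p
  -- The coefficient is the derivative of `f` along the vector part of `a`. The only other term
  -- containing `df` carries the factor `⟨a, b⟩ = 0`.
  refine ⟨f' (a p).1, eq_of_forall_pairing_eq fun z => ?_⟩
  have h1 : H p ![(a p).1, f p • (b p).1, z.1] = f p * H p ![(a p).1, (b p).1, z.1] := by
    rw [alternating_swap, alternating_swap (H p) (b p).1, mul_neg]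
    exact congrArg Neg.neg ((H p).toMultilinearMap.cons_smul ![(a p).1, z.1] (f p) (b p).1)
  rw [pairing_comm] at hab
  simp only [pairing_add_left, pairing_smul_left, pairing_courant_of_smooth H ha hb,
    pairing_courant_of_smooth H ha (hb.fun_smul hf), hf', Prod.smul_fst, map_smul,
    pairing_smul_right, h1, hab]
  ring

/-- For sections with constant pairings, the Courant bracket is cyclic. -/
theorem pairing_courant_rotate (ha : IsSmoothSection a) (hb : IsSmoothSection b)
    (hc : IsSmoothSection c) {r s t : ℝ} (hab : ∀ x, pairing (a x) (b x) = r)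
    (hbc : ∀ x, pairing (b x) (c x) = s) (hca : ∀ x, pairing (c x) (a x) = t) (p : M) :
    pairing (courant H a b p) (c p) = pairing (courant H b c p) (a p) := by
  -- Differentiating each constant pairing along the third section turns both sides into the cyclic
  -- sum `⟨D_a b, c⟩ + ⟨D_b c, a⟩ + ⟨D_c a, b⟩` plus the same multiple of `H`.
  have h1 := pairing_sectionDeriv_add ha hb hab (c p).1
  have h2 := pairing_sectionDeriv_add hb hc hbc (a p).1
  have h3 := pairing_sectionDeriv_add hc ha hca (b p).1
  rw [pairing_comm (a p)] at h1
  rw [pairing_comm (b p)] at h2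
  rw [pairing_comm (c p)] at h3
  rw [pairing_courant_of_smooth H ha hb, pairing_courant_of_smooth H hb hc,
    alternating_rotate (H p) (a p).1]
  linarith

end CourantAlgebra

/-! ### The Nijenhuis expression of a generalized almost complex structure. -/

section Nijenhuis

variable {E : Type*} [NormedAddCommGroup E] [NormedSpace ℝ E]
  {K : Type*} [TopologicalSpace K] {I : ModelWithCorners ℝ E K}
  {M : Type*} [TopologicalSpace M] [ChartedSpace K M]

/-- The Nijenhuis expression `[[a, b]] - [[Ja, Jb]] + J([[a, Jb]] + [[Ja, b]])`. -/
def nijenhuis (H : Form I M 3) (J : BigEnd I M) (a b : BigSection I M) : BigSection I M :=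
  fun x => courant H a b x - courant H (mapSection J a) (mapSection J b) x
    + J x (courant H a (mapSection J b) x + courant H (mapSection J a) b x)

theorem mapSection_add (J : BigEnd I M) (a b : BigSection I M) :
    mapSection J (a + b) = mapSection J a + mapSection J b := funext fun _ => bigEnd_add _ _ _

theorem mapSection_smul (J : BigEnd I M) (r : ℝ) (a : BigSection I M) :
    mapSection J (r • a) = r • mapSection J a := funext fun x => bigEnd_smul (J x) _ _

variable [IsManifold I ∞ M]

theorem IsGenAlmostComplex.mapSection_mapSection {J : BigEnd I M} (hJ : IsGenAlmostComplex J)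
    (a : BigSection I M) : mapSection J (mapSection J a) = -a := funext fun x => hJ.sq x (a x)

variable [I.Boundaryless] [CompleteSpace E]
  {H : Form I M 3} {J : BigEnd I M} {a a' b c : BigSection I M} {p : M}

theorem nijenhuis_add_left (hJ : IsSmoothEnd J) (ha : IsSmoothSection a)
    (ha' : IsSmoothSection a') (hb : IsSmoothSection b) (p : M) :
    nijenhuis H J (a + a') b p = nijenhuis H J a b p + nijenhuis H J a' b p := by
  simp only [nijenhuis, mapSection_add, courant_add_left ha ha' hb,
    courant_add_left ha ha' (hJ.mapSection hb),
    courant_add_left (hJ.mapSection ha) (hJ.mapSection ha') hb,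
    courant_add_left (hJ.mapSection ha) (hJ.mapSection ha') (hJ.mapSection hb), bigEnd_add]
  abel

theorem nijenhuis_smul_left (hJ : IsSmoothEnd J) (r : ℝ) (ha : IsSmoothSection a)
    (hb : IsSmoothSection b) (p : M) :
    nijenhuis H J (r • a) b p = r • nijenhuis H J a b p := by
  simp only [nijenhuis, mapSection_smul, courant_smul_left r ha hb,
    courant_smul_left r ha (hJ.mapSection hb), courant_smul_left r (hJ.mapSection ha) hb,
    courant_smul_left r (hJ.mapSection ha) (hJ.mapSection hb), bigEnd_add, bigEnd_smul, big_smul_add,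
    big_smul_sub]

theorem nijenhuis_swap (hJ : IsSmoothEnd J) (ha : IsSmoothSection a) (hb : IsSmoothSection b)
    (p : M) : nijenhuis H J b a p = -nijenhuis H J a b p := by
  simp only [nijenhuis, courant_swap ha hb, courant_swap ha (hJ.mapSection hb),
    courant_swap (hJ.mapSection ha) hb, courant_swap (hJ.mapSection ha) (hJ.mapSection hb),
    bigEnd_add, bigEnd_neg]
  abel

/-- Antilinearity over `J`, from `J² = -1`. Vanishing on `e` passes to `Je`, which halves the set of
generators to be tested. -/
theorem nijenhuis_mapSection_left (hJ : IsGenAlmostComplex J) (ha : IsSmoothSection a)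
    (hb : IsSmoothSection b) (p : M) :
    nijenhuis H J (mapSection J a) b p = -J p (nijenhuis H J a b p) := by
  simp only [nijenhuis, hJ.mapSection_mapSection, courant_neg_left ha hb,
    courant_neg_left ha (hJ.smooth.mapSection hb), bigEnd_add, bigEnd_sub, bigEnd_neg, hJ.sq]
  abel

/-- The Nijenhuis expression is tensorial. -/
theorem nijenhuis_eq_zero_of_eq_zero (hJ : IsGenAlmostComplex J) (ha : IsSmoothSection a)
    (hb : IsSmoothSection b) (h0 : a p = 0) : nijenhuis H J a b p = 0 := by
  have hJa := hJ.smooth.mapSection ha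
  have hJb := hJ.smooth.mapSection hb
  have hJ0 : mapSection J a p = 0 := by rw [mapSection, h0, bigEnd_zero]
  have hH : ∀ Y Z, H p ![0, Y, Z] = 0 := fun Y Z =>
    (H p).toAlternatingMap.map_coord_zero (m := ![0, Y, Z]) 0 rfl
  have hskew : ∀ u v : BigTangent I p, pairing (J p u) v = -pairing u (J p v) := fun u v =>
    eq_neg_of_add_eq_zero_left (hJ.skew p u v)
  refine eq_of_forall_pairing_eq fun z => ?_
  -- With `a p = 0` only derivatives of `a` survive, and `J` passes through them. They cancel
  -- because `J` is skew and `J² = -1`.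
  have hD : ∀ v, sectionDeriv (mapSection J a) p v = J p (sectionDeriv a p v) :=
    sectionDeriv_mapSection_of_eq_zero hJ.smooth ha h0
  simp only [nijenhuis, pairing_add_left, pairing_sub_left, hskew (_ + _) z,
    pairing_courant_of_smooth H ha hb, pairing_courant_of_smooth H ha hJb,
    pairing_courant_of_smooth H hJa hb, pairing_courant_of_smooth H hJa hJb, h0, hJ0, hD,
    Prod.fst_zero, map_zero, bigEnd_zero, hH, pairing_zero_left, pairing_zero_right]
  simp only [mapSection, hskew, hJ.sq, pairing_neg_right]
  ring

theorem nijenhuis_congr_left (hJ : IsGenAlmostComplex J) (ha : IsSmoothSection a)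
    (ha' : IsSmoothSection a') (hb : IsSmoothSection b) (h : a p = a' p) :
    nijenhuis H J a b p = nijenhuis H J a' b p := by
  have h1 := nijenhuis_add_left (H := H) hJ.smooth (ha.sub ha') ha' hb p
  rw [sub_add_cancel, nijenhuis_eq_zero_of_eq_zero hJ (ha.sub ha') hb (sub_eq_zero.2 h),
    zero_add] at h1
  exact h1

end Nijenhuis

/-! ### Real and imaginary parts in the complexified bundle. -/

section Complexification

variable {E : Type*} [NormedAddCommGroup E] [NormedSpace ℝ E]
  {K : Type*} [TopologicalSpace K] {I : ModelWithCorners ℝ E K}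
  {M : Type*} [TopologicalSpace M] [ChartedSpace K M] {x : M}

theorem complexElt_inj {a b a' b' : BigTangent I x} :
    complexElt a b = complexElt a' b' ↔ a = a' ∧ b = b' := by
  refine ⟨fun h => ?_, fun h => by rw [h.1, h.2]⟩
  -- Contracting the factor `ℂ` with a real functional; the real and imaginary part functionals
  -- recover the two components.
  let f : (ℂ →ₗ[ℝ] ℝ) → ℂ ⊗[ℝ] BigTangent I x →ₗ[ℝ] BigTangent I x := fun g =>
    (TensorProduct.lid ℝ (BigTangent I x)).toLinearMap ∘ₗ g.rTensor (BigTangent I x)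
  have hf : ∀ (g : ℂ →ₗ[ℝ] ℝ) (a b : BigTangent I x),
      f g (complexElt a b) = g 1 • a + g Complex.I • b := by
    intro g a b
    simp [f, complexElt]
  have h1 := congrArg (f Complex.reLm) h
  have h2 := congrArg (f Complex.imLm) h
  rw [hf, hf] at h1 h2
  constructor
  · simpa using! h1
  · simpa using! h2

theorem complexElt_sub (a b a' b' : BigTangent I x) :
    complexElt a b - complexElt a' b' = complexElt (a - a') (b - b') := by
  simp only [complexElt, TensorProduct.tmul_sub]
  abel

theorem smul_complexElt (z : ℂ) (a : BigTangent I x) :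
    z • complexElt a 0 = complexElt (z.re • a) (z.im • a) := by
  simp only [complexElt, TensorProduct.tmul_zero, add_zero, TensorProduct.smul_tmul',
    TensorProduct.tmul_smul]
  rw [← TensorProduct.add_tmul]
  congr 1
  simp

/-- These are the real and imaginary parts of `Φ(a + ib) = i(a + ib) = -b + ia`. Both are needed,
since `Φ² = -1` is not assumed. -/
theorem mem_eigenbundle_iff {Φ : BigEnd I M} {a b : BigTangent I x} :
    complexElt a b ∈ eigenbundle Φ x ↔ Φ x a = -b ∧ Φ x b = a := by
  have h1 : (Φ x).toLinearMap.baseChange ℂ (complexElt a b) = complexElt (Φ x a) (Φ x b) := by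
    simp [complexElt]
  have h2 : Complex.I • complexElt a b = complexElt (-b) a := by
    simp [complexElt, smul_add, TensorProduct.smul_tmul', TensorProduct.neg_tmul,
      TensorProduct.tmul_neg, add_comm]
  rw [eigenbundle, Module.End.mem_eigenspace_iff, h1, h2, complexElt_inj]

theorem mem_lineSumEigenbundle_iff {Φ : BigEnd I M} {e : BigSection I M} {a b : BigTangent I x} :
    complexElt a b ∈ lineSumEigenbundle Φ e x ↔
      ∃ r s : ℝ, complexElt (a - r • e x) (b - s • e x) ∈ eigenbundle Φ x := by
  rw [lineSumEigenbundle, Submodule.mem_sup]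
  constructor
  · rintro ⟨y, hy, w, hw, h⟩
    obtain ⟨z, rfl⟩ := Submodule.mem_span_singleton.1 hy
    refine ⟨z.re, z.im, ?_⟩
    rw [← complexElt_sub, ← smul_complexElt, ← h, add_sub_cancel_left]
    exact hw
  · rintro ⟨r, s, h⟩
    refine ⟨(⟨r, s⟩ : ℂ) • complexElt (e x) 0, Submodule.mem_span_singleton.2 ⟨_, rfl⟩, _, h, ?_⟩
    rw [smul_complexElt, ← complexElt_sub, add_sub_cancel]

theorem eigenbundle_le_lineSumEigenbundle {Φ : BigEnd I M} {e : BigSection I M} :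
    eigenbundle Φ x ≤ lineSumEigenbundle Φ e x := le_sup_right

theorem complexElt_mem_lineSumEigenbundle (Φ : BigEnd I M) (e : BigSection I M) (x : M) :
    complexElt (e x) 0 ∈ lineSumEigenbundle Φ e x :=
  Submodule.mem_sup_left (Submodule.mem_span_singleton_self _)

end Complexification

/-! ### Involutivity as vanishing of the Nijenhuis expression. -/

section Involutive

variable {E : Type*} [NormedAddCommGroup E] [NormedSpace ℝ E]
  {K : Type*} [TopologicalSpace K] {I : ModelWithCorners ℝ E K}
  {M : Type*} [TopologicalSpace M] [ChartedSpace K M]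
  [IsManifold I ∞ M] [I.Boundaryless] [CompleteSpace E]
  {H : Form I M 3}

/-- Sections of the eigenbundle are exactly `a - iJa`. The bracket of `a - iJa` and `b - iJb` is
`([[a, b]] - [[Ja, Jb]]) - i([[a, Jb]] + [[Ja, b]])`, and the eigenvector equation for it is `N(a,
b) = 0`. -/
theorem isInvolutive_eigenbundle_iff {J : BigEnd I M} (hJ : IsGenAlmostComplex J) :
    IsInvolutive H (eigenbundle J) ↔ ∀ a b : BigSection I M, IsSmoothSection a →
      IsSmoothSection b → ∀ x, nijenhuis H J a b x = 0 := by
  have key : ∀ {a b : BigSection I M}, IsSmoothSection a → IsSmoothSection b → ∀ x,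
      complexElt (courant H a b x - courant H (-mapSection J a) (-mapSection J b) x)
        (courant H a (-mapSection J b) x + courant H (-mapSection J a) b x) ∈ eigenbundle J x ↔
      nijenhuis H J a b x = 0 := by
    intro a b ha hb x
    have hJa := hJ.smooth.mapSection ha
    have hJb := hJ.smooth.mapSection hb
    rw [mem_eigenbundle_iff, courant_neg_left hJa hJb.neg, courant_neg_right hJb hJa, neg_neg,
      courant_neg_right hJb ha, courant_neg_left hJa hb, ← neg_add, neg_neg, bigEnd_neg, nijenhuis,
      add_eq_zero_iff_eq_neg]
    refine ⟨fun h => h.2.symm, fun h => ⟨?_, h.symm⟩⟩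
    have h1 := congrArg (J x) h
    rwa [bigEnd_neg, hJ.sq, neg_neg] at h1
  constructor
  · intro h a b ha hb x
    have hm : ∀ a : BigSection I M, ∀ x, complexElt (a x) ((-mapSection J a) x) ∈ eigenbundle J x :=
      fun a x => mem_eigenbundle_iff.2 ⟨(neg_neg (J x (a x))).symm, by
        rw [Pi.neg_apply, bigEnd_neg, mapSection, hJ.sq, neg_neg]⟩
    exact (key ha hb x).1 (h a _ b _ ha (hJ.smooth.mapSection ha).neg hb
      (hJ.smooth.mapSection hb).neg (hm a) (hm b) x)
  · intro h a b c d ha _ hc _ hab hcd x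
    have e : ∀ {a b : BigSection I M}, (∀ x, complexElt (a x) (b x) ∈ eigenbundle J x) →
        b = -mapSection J a := fun h => funext fun x => by
      rw [Pi.neg_apply, mapSection, (mem_eigenbundle_iff.1 (h x)).1, neg_neg]
    rw [e hab, e hcd]
    exact (key ha hc x).2 (h a c ha hc x)

end Involutive

/-! ### Pointwise algebra of generalized almost contact structures. -/

section Contact

variable {E : Type*} [NormedAddCommGroup E] [NormedSpace ℝ E]
  {K : Type*} [TopologicalSpace K] {I : ModelWithCorners ℝ E K}
  {M : Type*} [TopologicalSpace M] [ChartedSpace K M]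

/-- A section in the sum of the `±√-1`-eigenspaces of `Φ`, that is, with `Φ² u = -u`. -/
def IsHorizontal (Φ : BigEnd I M) (u : BigSection I M) : Prop := ∀ x, Φ x (Φ x (u x)) = -u x

theorem IsHorizontal.mapSection {Φ : BigEnd I M} {u : BigSection I M} (hu : IsHorizontal Φ u) :
    IsHorizontal Φ (mapSection Φ u) := fun x => by
  rw [GenGeom.mapSection, hu, bigEnd_neg]

/-- The bracket relations that characterize normality. -/
structure NormalBrackets (H : Form I M 3) (Φ : BigEnd I M) (Ep Em : BigSection I M)
    [IsManifold I ∞ M] : Prop where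
  horizontal : ∀ u v : BigSection I M, IsSmoothSection u → IsSmoothSection v → IsHorizontal Φ u →
    IsHorizontal Φ v → ∀ x,
    complexElt (courant H u v x - courant H (mapSection Φ u) (mapSection Φ v) x)
      (-(courant H u (mapSection Φ v) x + courant H (mapSection Φ u) v x)) ∈ eigenbundle Φ x
  plus : ∀ u : BigSection I M, IsSmoothSection u → IsHorizontal Φ u → ∀ x,
    complexElt (courant H u Ep x) (-courant H (mapSection Φ u) Ep x) ∈ eigenbundle Φ x
  minus : ∀ u : BigSection I M, IsSmoothSection u → IsHorizontal Φ u → ∀ x,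
    complexElt (courant H u Em x) (-courant H (mapSection Φ u) Em x) ∈ eigenbundle Φ x
  reeb : ∀ x, courant H Ep Em x = 0

variable [IsManifold I ∞ M] {H : Form I M 3} {Φ : BigEnd I M} {Ep Em : BigSection I M}

namespace IsGenAlmostContact

set_option synthInstance.maxHeartbeats 200000 in
theorem symm (h : IsGenAlmostContact Φ Ep Em) : IsGenAlmostContact Φ Em Ep where
  smooth := h.smooth
  smooth_Ep := h.smooth_Em
  smooth_Em := h.smooth_Ep
  skew := h.skew
  sq x := by
    rw [h.sq]
    exact add_right_comm (G := BigTangent I x →L[ℝ] BigTangent I x) _ _ _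
  isotropic_Ep := h.isotropic_Em
  isotropic_Em := h.isotropic_Ep
  dual x := by rw [pairing_comm, h.dual]

theorem skew' (h : IsGenAlmostContact Φ Ep Em) {x : M} (a b : BigTangent I x) :
    pairing (Φ x a) b = -pairing a (Φ x b) := eq_neg_of_add_eq_zero_left (h.skew x a b)

theorem sq_apply (h : IsGenAlmostContact Φ Ep Em) {x : M} (a : BigTangent I x) :
    Φ x (Φ x a) = -a + (2 * pairing (Em x) a) • Ep x + (2 * pairing (Ep x) a) • Em x := by
  have h1 := DFunLike.congr_fun (h.sq x) a
  refine h1.trans ?_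
  rw [← tensorEnd_apply, ← tensorEnd_apply]
  rfl

theorem map_Ep (h : IsGenAlmostContact Φ Ep Em) (x : M) : Φ x (Ep x) = 0 := by
  have h0 : Φ x (Φ x (Ep x)) = 0 := by
    rw [h.sq_apply, pairing_comm, h.dual, h.isotropic_Ep, mul_zero, big_zero_smul, add_zero]
    exact (congrArg _ (one_smul ℝ (Ep x))).trans (neg_add_cancel _)
  -- `Φ E₊` lies in the kernel of `Φ²`, which is spanned by `E₊` and `E₋`
  have h1 := h.sq_apply (Φ x (Ep x))
  have h2 : pairing (Ep x) (Φ x (Ep x)) = 0 := by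
    have := h.skew' (Ep x) (Ep x)
    rw [pairing_comm] at this
    linarith
  rw [h0, bigEnd_zero, h2, mul_zero, big_zero_smul, add_zero] at h1
  obtain ⟨k, hk⟩ : ∃ k : ℝ, Φ x (Ep x) = k • Ep x := ⟨_, (neg_add_eq_zero.1 h1.symm)⟩
  -- Now `Φ² E₊ = k² E₊ = 0`, and pairing with `E₋` gives `k² = 0`.
  rw [hk, bigEnd_smul, hk] at h0
  have h3 := congrArg (fun v => pairing v (Em x)) h0
  simp only [pairing_smul_left, pairing_zero_left] at h3
  have h4 : k * k = 0 := by linear_combination 2 * h3 - k * k * h.dual x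
  rw [hk, mul_self_eq_zero.1 h4, big_zero_smul]

theorem map_Em (h : IsGenAlmostContact Φ Ep Em) (x : M) : Φ x (Em x) = 0 := h.symm.map_Ep x

theorem pairing_Ep_map (h : IsGenAlmostContact Φ Ep Em) {x : M} (a : BigTangent I x) :
    pairing (Ep x) (Φ x a) = 0 := by
  rw [pairing_comm, h.skew', h.map_Ep, pairing_zero_right, neg_zero]

theorem isHorizontal_mapSection (h : IsGenAlmostContact Φ Ep Em) (a : BigSection I M) :
    IsHorizontal Φ (mapSection Φ a) := fun x => by
  rw [h.sq_apply, mapSection, pairing_comm, h.skew', pairing_comm (Ep x), h.skew', h.map_Ep,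
    h.map_Em, pairing_zero_right, neg_zero, mul_zero, big_zero_smul, big_zero_smul, add_zero,
    add_zero]

/-- Such an `a` is `-Φ(Φa)`, and `Φ` is skew and kills `E₊`. -/
theorem pairing_Ep_eq_zero (h : IsGenAlmostContact Φ Ep Em) {x : M} {a : BigTangent I x}
    (ha : Φ x (Φ x a) = -a) : pairing a (Ep x) = 0 := by
  rw [← neg_neg a, ← ha, pairing_neg_left, h.skew', h.map_Ep, pairing_zero_right, neg_zero,
    neg_zero]

theorem sq_of_mem_eigenbundle {x : M} {a b : BigTangent I x}
    (h : complexElt a b ∈ eigenbundle Φ x) : Φ x (Φ x a) = -a ∧ Φ x (Φ x b) = -b := by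
  obtain ⟨h1, h2⟩ := mem_eigenbundle_iff.1 h
  exact ⟨by rw [h1, bigEnd_neg, h2], by rw [h2, h1]⟩

/-- Horizontal elements are orthogonal to `E₋`, and `2⟨E₊, E₋⟩ = 1`. The coefficient along `E₊` in
`L⁺` is thus a pairing, so it is unique and depends smoothly on the point for smooth sections. -/
theorem coeff_eq_of_sub_smul (h : IsGenAlmostContact Φ Ep Em) {x : M} {a : BigTangent I x} {r : ℝ}
    (ha : Φ x (Φ x (a - r • Ep x)) = -(a - r • Ep x)) : r = 2 * pairing a (Em x) := by
  have h1 := h.symm.pairing_Ep_eq_zero ha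
  rw [pairing_sub_left, pairing_smul_left] at h1
  have := h.dual x
  linear_combination (-2) * h1 + (-r) * this

end IsGenAlmostContact

end Contact

/-! ### Normality in terms of brackets of horizontal sections with each other and with `E₊`, `E₋`.
-/

section Normal

variable {E : Type*} [NormedAddCommGroup E] [NormedSpace ℝ E]
  {K : Type*} [TopologicalSpace K] {I : ModelWithCorners ℝ E K}
  {M : Type*} [TopologicalSpace M] [ChartedSpace K M]
  [IsManifold I ∞ M] [I.Boundaryless] [CompleteSpace E]
  {H : Form I M 3} {Φ : BigEnd I M} {Ep Em : BigSection I M}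

theorem NormalBrackets.symm (h : NormalBrackets H Φ Ep Em) (hp : IsSmoothSection Ep)
    (hm : IsSmoothSection Em) : NormalBrackets H Φ Em Ep where
  horizontal := h.horizontal
  plus := h.minus
  minus := h.plus
  reeb x := by rw [courant_swap hp hm, h.reeb, neg_zero]

namespace IsGenAlmostContact

variable (h : IsGenAlmostContact Φ Ep Em)

include h

theorem complexElt_mem_lineSum {u : BigSection I M} (hu : IsHorizontal Φ u) (x : M) :
    complexElt (u x) ((-mapSection Φ u) x) ∈ lineSumEigenbundle Φ Ep x :=
  eigenbundle_le_lineSumEigenbundle (mem_eigenbundle_iff.2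
    ⟨(neg_neg (Φ x (u x))).symm, by rw [Pi.neg_apply, bigEnd_neg, mapSection, hu, neg_neg]⟩)

/-- Since `u`, `E₊`, `E₋` have constant pairings, cyclicity moves the expression to `⟨[[E₊, E₋]],
u⟩`. This is where the condition `[[E₊, E₋]] = 0` enters normality. -/
theorem pairing_courant_Ep_Em {u : BigSection I M} (hus : IsSmoothSection u)
    (hu : IsHorizontal Φ u) (hr : ∀ x, courant H Ep Em x = 0) (x : M) :
    pairing (courant H u Ep x) (Em x) = 0 := by
  rw [pairing_courant_rotate hus h.smooth_Ep h.smooth_Em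
    (fun x => h.pairing_Ep_eq_zero (hu x)) (fun x => (eq_div_of_mul_eq two_ne_zero
      (by rw [mul_comm, h.dual])))
    (fun x => (pairing_comm _ _).trans (h.symm.pairing_Ep_eq_zero (hu x))), hr, pairing_zero_left]

/-- The element is the bracket of `u - iΦu` with `E₊`, hence lies in `L⁺`; its coefficients along
`E₊` are pairings with `E₋`, which vanish by `pairing_courant_Ep_Em`. -/
theorem mem_eigenbundle_of_courant_Ep {u : BigSection I M} (hus : IsSmoothSection u)
    (hu : IsHorizontal Φ u) (hr : ∀ x, courant H Ep Em x = 0)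
    (hs : IsInvolutive H (lineSumEigenbundle Φ Ep)) (x : M) :
    complexElt (courant H u Ep x) (-courant H (mapSection Φ u) Ep x) ∈ eigenbundle Φ x := by
  have hΦu := h.smooth.mapSection hus
  have h1 := hs u (-mapSection Φ u) Ep 0 hus hΦu.neg h.smooth_Ep .zero
    (h.complexElt_mem_lineSum hu) (complexElt_mem_lineSumEigenbundle Φ Ep) x
  rw [courant_zero_right hΦu.neg, courant_zero_right hus, sub_zero, zero_add,
    courant_neg_left hΦu h.smooth_Ep] at h1
  obtain ⟨r, s, hrs⟩ := mem_lineSumEigenbundle_iff.1 h1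
  obtain ⟨h2, h3⟩ := sq_of_mem_eigenbundle hrs
  have hr0 := h.coeff_eq_of_sub_smul h2
  have hs0 := h.coeff_eq_of_sub_smul h3
  rw [h.pairing_courant_Ep_Em hus hu hr, mul_zero] at hr0
  rw [pairing_neg_left, h.pairing_courant_Ep_Em hΦu hu.mapSection hr, neg_zero, mul_zero] at hs0
  rwa [hr0, hs0, big_zero_smul, sub_zero, sub_zero] at hrs

/-- Elements of `L⁻` are orthogonal to `E₋`, because `E₋` is isotropic and orthogonal to horizontal
elements. Their coefficient along `E₊` in `L⁺` is therefore zero. -/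
theorem mem_eigenbundle_of_mem_lineSum {x : M} {a b : BigTangent I x}
    (hp : complexElt a b ∈ lineSumEigenbundle Φ Ep x)
    (hm : complexElt a b ∈ lineSumEigenbundle Φ Em x) : complexElt a b ∈ eigenbundle Φ x := by
  obtain ⟨r, s, hrs⟩ := mem_lineSumEigenbundle_iff.1 hp
  obtain ⟨r', s', hrs'⟩ := mem_lineSumEigenbundle_iff.1 hm
  obtain ⟨h2, h3⟩ := sq_of_mem_eigenbundle hrs
  obtain ⟨h2', h3'⟩ := sq_of_mem_eigenbundle hrs'
  have h4 : ∀ {v : BigTangent I x} {t : ℝ}, Φ x (Φ x (v - t • Em x)) = -(v - t • Em x) →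
      pairing v (Em x) = 0 := fun hv => by
    have := h.symm.pairing_Ep_eq_zero hv
    rwa [pairing_sub_left, pairing_smul_left, h.isotropic_Em, mul_zero, sub_zero] at this
  have hr0 := h.coeff_eq_of_sub_smul h2
  have hs0 := h.coeff_eq_of_sub_smul h3
  rw [h4 h2', mul_zero] at hr0
  rw [h4 h3', mul_zero] at hs0
  rwa [hr0, hs0, big_zero_smul, sub_zero, sub_zero] at hrs

theorem normalBrackets_of_isNormal (hn : IsNormal H Φ Ep Em) : NormalBrackets H Φ Ep Em where
  horizontal u v hus hvs hu hv x := by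
    have hΦu := h.smooth.mapSection hus
    have hΦv := h.smooth.mapSection hvs
    have h1 := hn.1.1 u (-mapSection Φ u) v (-mapSection Φ v) hus hΦu.neg hvs hΦv.neg
      (h.complexElt_mem_lineSum hu) (h.complexElt_mem_lineSum hv) x
    have h2 := hn.1.2 u (-mapSection Φ u) v (-mapSection Φ v) hus hΦu.neg hvs hΦv.neg
      (h.symm.complexElt_mem_lineSum hu) (h.symm.complexElt_mem_lineSum hv) x
    have h3 := h.mem_eigenbundle_of_mem_lineSum h1 h2
    rwa [courant_neg_left hΦu hΦv.neg, courant_neg_right hΦv hΦu, neg_neg,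
      courant_neg_right hΦv hus, courant_neg_left hΦu hvs, ← neg_add] at h3
  plus u hus hu x := h.mem_eigenbundle_of_courant_Ep hus hu hn.2 hn.1.1 x
  minus u hus hu x := h.symm.mem_eigenbundle_of_courant_Ep hus hu
    (fun x => by rw [courant_swap h.smooth_Ep h.smooth_Em, hn.2, neg_zero]) hn.1.2 x
  reeb := hn.2

/-- The Leibniz rule for orthogonal sections applies to every term, as `E₊` is isotropic and
orthogonal to `u` and `v`. All derivatives of `f` and `g` fall on `E₊`, a direction inside `L⁺`, so
their sum `k` need not be known. -/
theorem exists_courant_add_fun_smul {u v : BigSection I M} (hus : IsSmoothSection u)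
    (hvs : IsSmoothSection v) (hu : IsHorizontal Φ u) (hv : IsHorizontal Φ v) {f g : M → ℝ}
    (hf : ContMDiff I 𝓘(ℝ, ℝ) ∞ f) (hg : ContMDiff I 𝓘(ℝ, ℝ) ∞ g) (x : M) :
    ∃ k : ℝ, courant H (u + fun x => f x • Ep x) (v + fun x => g x • Ep x) x =
      courant H u v x + g x • courant H u Ep x - f x • courant H v Ep x + k • Ep x := by
  have he := h.smooth_Ep
  have hfe := he.fun_smul hf
  have hge := he.fun_smul hg
  obtain ⟨k₁, h₁⟩ := exists_courant_fun_smul (H := H) hg hus he x (h.pairing_Ep_eq_zero (hu x))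
  obtain ⟨k₂, h₂⟩ := exists_courant_fun_smul (H := H) hf hvs he x (h.pairing_Ep_eq_zero (hv x))
  obtain ⟨k₃, h₃⟩ := exists_courant_fun_smul (H := H) hg hfe he x
    (by rw [pairing_smul_left, h.isotropic_Ep, mul_zero])
  obtain ⟨k₄, h₄⟩ := exists_courant_fun_smul (H := H) hf he he x (h.isotropic_Ep x)
  rw [courant_self he] at h₄
  refine ⟨k₁ - k₂ + k₃ - g x * k₄, ?_⟩
  rw [courant_add_left hus hfe (hvs.add hge), courant_add_right hvs hge hus,
    courant_add_right hvs hge hfe, courant_swap hvs hfe, h₁, h₂, h₃, courant_swap he hfe, h₄]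
  module

/-- A smooth section of `L⁺` is `u - iΦu + (f + ig)E₊` with `u` smooth horizontal and `f`, `g`
smooth. Modulo `E₊`, the bracket of two of these is a combination of the brackets controlled by
`NormalBrackets`. -/
theorem isInvolutive_lineSum (hn : NormalBrackets H Φ Ep Em) :
    IsInvolutive H (lineSumEigenbundle Φ Ep) := by
  have decomp : ∀ a b : BigSection I M, IsSmoothSection a → IsSmoothSection b →
      (∀ x, complexElt (a x) (b x) ∈ lineSumEigenbundle Φ Ep x) →
      ∃ (u : BigSection I M) (f g : M → ℝ), IsSmoothSection u ∧ IsHorizontal Φ u ∧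
        ContMDiff I 𝓘(ℝ, ℝ) ∞ f ∧ ContMDiff I 𝓘(ℝ, ℝ) ∞ g ∧
        a = (u + fun x => f x • Ep x) ∧ b = (-mapSection Φ u + fun x => g x • Ep x) := by
    intro a b ha hb hab
    have hf : ContMDiff I 𝓘(ℝ, ℝ) ∞ fun x => 2 * pairing (a x) (Em x) := fun x =>
      contMDiffAt_const.mul (ha.contMDiff_pairing h.smooth_Em x)
    have hg : ContMDiff I 𝓘(ℝ, ℝ) ∞ fun x => 2 * pairing (b x) (Em x) := fun x =>
      contMDiffAt_const.mul (hb.contMDiff_pairing h.smooth_Em x)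
    have key : ∀ x, complexElt (a x - (2 * pairing (a x) (Em x)) • Ep x)
        (b x - (2 * pairing (b x) (Em x)) • Ep x) ∈ eigenbundle Φ x := by
      intro x
      obtain ⟨r, s, hrs⟩ := mem_lineSumEigenbundle_iff.1 (hab x)
      obtain ⟨h2, h3⟩ := sq_of_mem_eigenbundle hrs
      rwa [h.coeff_eq_of_sub_smul h2, h.coeff_eq_of_sub_smul h3] at hrs
    refine ⟨a - fun x => (2 * pairing (a x) (Em x)) • Ep x, _, _, ha.sub (h.smooth_Ep.fun_smul hf),
      fun x => (sq_of_mem_eigenbundle (key x)).1, hf, hg, (sub_add_cancel a _).symm,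
      funext fun x => ?_⟩
    have h4 : Φ x (a x - (2 * pairing (a x) (Em x)) • Ep x) =
        -(b x - (2 * pairing (b x) (Em x)) • Ep x) := (mem_eigenbundle_iff.1 (key x)).1
    change b x = -Φ x (a x - (2 * pairing (a x) (Em x)) • Ep x) + _
    rw [h4, neg_neg, sub_add_cancel]
  intro a b c d ha hb hc hd hab hcd x
  obtain ⟨u, f, g, hus, hu, hf, hg, rfl, rfl⟩ := decomp a b ha hb hab
  obtain ⟨v, f', g', hvs, hv, hf', hg', rfl, rfl⟩ := decomp c d hc hd hcd
  have hΦu := h.smooth.mapSection hus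
  have hΦv := h.smooth.mapSection hvs
  have neg : ∀ {w : BigSection I M}, IsHorizontal Φ w → IsHorizontal Φ (-w) := fun hw x => by
    rw [Pi.neg_apply, bigEnd_neg, bigEnd_neg, hw]
  have hu' := neg hu.mapSection
  have hv' := neg hv.mapSection
  obtain ⟨k₁, h₁⟩ := h.exists_courant_add_fun_smul (H := H) hus hvs hu hv hf hf' x
  obtain ⟨k₂, h₂⟩ := h.exists_courant_add_fun_smul (H := H) hΦu.neg hΦv.neg hu' hv' hg hg' x
  obtain ⟨k₃, h₃⟩ := h.exists_courant_add_fun_smul (H := H) hus hΦv.neg hu hv' hf hg' x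
  obtain ⟨k₄, h₄⟩ := h.exists_courant_add_fun_smul (H := H) hΦu.neg hvs hu' hv hg hf' x
  rw [courant_neg_left hΦu hΦv.neg, courant_neg_right hΦv hΦu, neg_neg,
    courant_neg_left hΦu h.smooth_Ep, courant_neg_left hΦv h.smooth_Ep] at h₂
  rw [courant_neg_right hΦv hus, courant_neg_left hΦv h.smooth_Ep] at h₃
  rw [courant_neg_left hΦu hvs, courant_neg_left hΦu h.smooth_Ep] at h₄
  obtain ⟨a₁, a₂⟩ := mem_eigenbundle_iff.1 (hn.horizontal u v hus hvs hu hv x)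
  obtain ⟨b₁, b₂⟩ := mem_eigenbundle_iff.1 (hn.plus u hus hu x)
  obtain ⟨c₁, c₂⟩ := mem_eigenbundle_iff.1 (hn.plus v hvs hv x)
  rw [bigEnd_sub, neg_neg] at a₁
  rw [bigEnd_neg, bigEnd_add] at a₂
  rw [neg_neg] at b₁ c₁
  rw [bigEnd_neg] at b₂ c₂
  -- The real part of the complex bracket is the first real bracket minus the second, and the
  -- imaginary part the third plus the fourth; their components along `E₊` combine in the same way.
  refine mem_lineSumEigenbundle_iff.2 ⟨k₁ - k₂, k₃ + k₄, mem_eigenbundle_iff.2 ?_⟩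
  rw [h₁, h₂, h₃, h₄]
  simp only [bigEnd_add, bigEnd_sub, bigEnd_neg, bigEnd_smul, h.map_Ep, b₁, c₁,
    neg_eq_iff_eq_neg.1 b₂, neg_eq_iff_eq_neg.1 c₂]
  constructor
  · linear_combination (norm := module) a₁
  · linear_combination (norm := module) a₂

theorem isNormal_iff : IsNormal H Φ Ep Em ↔ NormalBrackets H Φ Ep Em :=
  ⟨h.normalBrackets_of_isNormal, fun hn => ⟨⟨h.isInvolutive_lineSum hn,
    h.symm.isInvolutive_lineSum (hn.symm h.smooth_Ep h.smooth_Em)⟩, hn.reeb⟩⟩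

end IsGenAlmostContact

end Normal

/-! ### Splitting of the model fibre of a product. -/

section ModelMaps

variable (E₁ : Type*) [NormedAddCommGroup E₁] [NormedSpace ℝ E₁]
  (E₂ : Type*) [NormedAddCommGroup E₂] [NormedSpace ℝ E₂]

/-- The projection of the model fibres of the big tangent bundles to the first factor. -/
def modelFst : (E₁ × E₂) × ((E₁ × E₂) →L[ℝ] ℝ) →L[ℝ] E₁ × (E₁ →L[ℝ] ℝ) :=
  (ContinuousLinearMap.fst ℝ E₁ E₂).prodMap ((ContinuousLinearMap.inl ℝ E₁ E₂).precomp ℝ)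

/-- The projection of the model fibres of the big tangent bundles to the second factor. -/
def modelSnd : (E₁ × E₂) × ((E₁ × E₂) →L[ℝ] ℝ) →L[ℝ] E₂ × (E₂ →L[ℝ] ℝ) :=
  (ContinuousLinearMap.snd ℝ E₁ E₂).prodMap ((ContinuousLinearMap.inr ℝ E₁ E₂).precomp ℝ)

/-- The inclusion of the model fibres of the big tangent bundles of the first factor. -/
def modelInl : E₁ × (E₁ →L[ℝ] ℝ) →L[ℝ] (E₁ × E₂) × ((E₁ × E₂) →L[ℝ] ℝ) :=
  (ContinuousLinearMap.inl ℝ E₁ E₂).prodMap ((ContinuousLinearMap.fst ℝ E₁ E₂).precomp ℝ)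

/-- The inclusion of the model fibres of the big tangent bundles of the second factor. -/
def modelInr : E₂ × (E₂ →L[ℝ] ℝ) →L[ℝ] (E₁ × E₂) × ((E₁ × E₂) →L[ℝ] ℝ) :=
  (ContinuousLinearMap.inr ℝ E₁ E₂).prodMap ((ContinuousLinearMap.snd ℝ E₁ E₂).precomp ℝ)

end ModelMaps

/-! ### Splitting of the big tangent bundle of a product; pullbacks and slices. -/

section ProductAlgebra

variable {E₁ : Type*} [NormedAddCommGroup E₁] [NormedSpace ℝ E₁]
  {K₁ : Type*} [TopologicalSpace K₁] {I₁ : ModelWithCorners ℝ E₁ K₁}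
  {M₁ : Type*} [TopologicalSpace M₁] [ChartedSpace K₁ M₁]
  {E₂ : Type*} [NormedAddCommGroup E₂] [NormedSpace ℝ E₂]
  {K₂ : Type*} [TopologicalSpace K₂] {I₂ : ModelWithCorners ℝ E₂ K₂}
  {M₂ : Type*} [TopologicalSpace M₂] [ChartedSpace K₂ M₂] {p : M₁ × M₂}

theorem bigFst_bigInl (a : BigTangent I₁ p.1) : bigFst I₁ I₂ p (bigInl I₁ I₂ p a) = a := rfl

theorem bigSnd_bigInr (a : BigTangent I₂ p.2) : bigSnd I₁ I₂ p (bigInr I₁ I₂ p a) = a := rfl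

theorem bigFst_bigInr (a : BigTangent I₂ p.2) : bigFst I₁ I₂ p (bigInr I₁ I₂ p a) = 0 :=
  Prod.ext rfl (ContinuousLinearMap.ext fun _ => map_zero a.2)

theorem bigSnd_bigInl (a : BigTangent I₁ p.1) : bigSnd I₁ I₂ p (bigInl I₁ I₂ p a) = 0 :=
  Prod.ext rfl (ContinuousLinearMap.ext fun _ => map_zero a.2)

theorem bigInl_bigFst_add (c : BigTangent (I₁.prod I₂) p) :
    bigInl I₁ I₂ p (bigFst I₁ I₂ p c) + bigInr I₁ I₂ p (bigSnd I₁ I₂ p c) = c := by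
  refine Prod.ext (Prod.ext (add_zero c.1.1) (zero_add c.1.2)) (ContinuousLinearMap.ext fun v => ?_)
  exact (map_add c.2 ((v.1, 0) : E₁ × E₂) (0, v.2)).symm.trans
    (congrArg c.2 (Prod.ext (add_zero v.1) (zero_add v.2)))

theorem pairing_bigInl (a : BigTangent I₁ p.1) (c : BigTangent (I₁.prod I₂) p) :
    pairing (bigInl I₁ I₂ p a) c = pairing a (bigFst I₁ I₂ p c) := rfl

theorem pairing_bigInr (a : BigTangent I₂ p.2) (c : BigTangent (I₁.prod I₂) p) :
    pairing (bigInr I₁ I₂ p a) c = pairing a (bigSnd I₁ I₂ p c) := rfl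

theorem big_ext {c d : BigTangent (I₁.prod I₂) p} (h₁ : bigFst I₁ I₂ p c = bigFst I₁ I₂ p d)
    (h₂ : bigSnd I₁ I₂ p c = bigSnd I₁ I₂ p d) : c = d := by
  rw [← bigInl_bigFst_add c, h₁, h₂, bigInl_bigFst_add]

variable (I₂ M₂) in
/-- The pullback to `M₁ × M₂` of a section on `M₁`. -/
def pullFst (a : BigSection I₁ M₁) : BigSection (I₁.prod I₂) (M₁ × M₂) :=
  fun p => bigInl I₁ I₂ p (a p.1)

variable (I₁ M₁) in
/-- The pullback to `M₁ × M₂` of a section on `M₂`. -/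
def pullSnd (a : BigSection I₂ M₂) : BigSection (I₁.prod I₂) (M₁ × M₂) :=
  fun p => bigInr I₁ I₂ p (a p.2)

/-- The section on `M₁` obtained by restricting the first component of a section on `M₁ × M₂` to
`M₁ × {q}`. -/
def sliceFst (c : BigSection (I₁.prod I₂) (M₁ × M₂)) (q : M₂) : BigSection I₁ M₁ :=
  fun x => bigFst I₁ I₂ (x, q) (c (x, q))

/-- The section on `M₂` obtained by restricting the second component of a section on `M₁ × M₂` to
`{q} × M₂`. -/
def sliceSnd (c : BigSection (I₁.prod I₂) (M₁ × M₂)) (q : M₁) : BigSection I₂ M₂ :=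
  fun x => bigSnd I₁ I₂ (q, x) (c (q, x))

variable (I₂ M₂) in
/-- The endomorphism `(a₁, a₂) ↦ (Φ a₁, 0)` on `M₁ × M₂`. -/
def pullEndFst (Φ : BigEnd I₁ M₁) : BigEnd (I₁.prod I₂) (M₁ × M₂) := fun p =>
  bigInl I₁ I₂ p ∘L Φ p.1 ∘L bigFst I₁ I₂ p

variable (I₁ M₁) in
/-- The endomorphism `(a₁, a₂) ↦ (0, Φ a₂)` on `M₁ × M₂`. -/
def pullEndSnd (Φ : BigEnd I₂ M₂) : BigEnd (I₁.prod I₂) (M₁ × M₂) := fun p =>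
  bigInr I₁ I₂ p ∘L Φ p.2 ∘L bigSnd I₁ I₂ p

end ProductAlgebra

/-! ### Product charts and local expressions of pullbacks and slices. -/

section ProductSmooth

variable {E₁ : Type*} [NormedAddCommGroup E₁] [NormedSpace ℝ E₁]
  {K₁ : Type*} [TopologicalSpace K₁] {I₁ : ModelWithCorners ℝ E₁ K₁}
  {M₁ : Type*} [TopologicalSpace M₁] [ChartedSpace K₁ M₁] [IsManifold I₁ ∞ M₁]
  {E₂ : Type*} [NormedAddCommGroup E₂] [NormedSpace ℝ E₂]
  {K₂ : Type*} [TopologicalSpace K₂] {I₂ : ModelWithCorners ℝ E₂ K₂}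
  {M₂ : Type*} [TopologicalSpace M₂] [ChartedSpace K₂ M₂] [IsManifold I₂ ∞ M₂]
  {p : M₁ × M₂} {e : E₁ × E₂}

theorem mem_target_prod_iff : e ∈ (extChartAt (I₁.prod I₂) p).target ↔
    e.1 ∈ (extChartAt I₁ p.1).target ∧ e.2 ∈ (extChartAt I₂ p.2).target := by
  rw [extChartAt_prod]
  exact Set.mem_prod

theorem mfderiv_extChartAt_prod_apply (he : e ∈ (extChartAt (I₁.prod I₂) p).target)
    (w : TangentSpace (I₁.prod I₂) ((extChartAt (I₁.prod I₂) p).symm e)) :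
    (mfderiv (I₁.prod I₂) 𝓘(ℝ, E₁ × E₂) (extChartAt (I₁.prod I₂) p)
      ((extChartAt (I₁.prod I₂) p).symm e) w : E₁ × E₂) =
    (mfderiv I₁ 𝓘(ℝ, E₁) (extChartAt I₁ p.1) ((extChartAt I₁ p.1).symm e.1) w.1,
      mfderiv I₂ 𝓘(ℝ, E₂) (extChartAt I₂ p.2) ((extChartAt I₂ p.2).symm e.2) w.2) := by
  have : IsManifold I₁ 1 M₁ := isManifold_one
  have : IsManifold I₂ 1 M₂ := isManifold_one
  obtain ⟨h₁, h₂⟩ := mem_target_prod_iff.1 he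
  have hs₁ : (extChartAt I₁ p.1).symm e.1 ∈ (chartAt K₁ p.1).source := by
    rw [← extChartAt_source I₁]; exact (extChartAt I₁ p.1).map_target h₁
  have hs₂ : (extChartAt I₂ p.2).symm e.2 ∈ (chartAt K₂ p.2).source := by
    rw [← extChartAt_source I₂]; exact (extChartAt I₂ p.2).map_target h₂
  have d₁ := (mdifferentiableAt_extChartAt (I := I₁) hs₁).hasMFDerivAt
  have d₂ := (mdifferentiableAt_extChartAt (I := I₂) hs₂).hasMFDerivAt
  have d₁' := HasMFDerivAt.comp ((extChartAt (I₁.prod I₂) p).symm e) (f := Prod.fst) d₁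
    (hasMFDerivAt_fst (I := I₁) (I' := I₂) _)
  have d₂' := HasMFDerivAt.comp ((extChartAt (I₁.prod I₂) p).symm e) (f := Prod.snd) d₂
    (hasMFDerivAt_snd (I := I₁) (I' := I₂) _)
  have hφ : (extChartAt (I₁.prod I₂) p : M₁ × M₂ → E₁ × E₂) =
      fun x => ((extChartAt I₁ p.1 ∘ Prod.fst) x, (extChartAt I₂ p.2 ∘ Prod.snd) x) := by
    rw [extChartAt_prod]; rfl
  have d : HasMFDerivAt (I₁.prod I₂) 𝓘(ℝ, E₁ × E₂)
      (fun x => ((extChartAt I₁ p.1 ∘ Prod.fst) x, (extChartAt I₂ p.2 ∘ Prod.snd) x))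
      ((extChartAt (I₁.prod I₂) p).symm e) _ := ⟨d₁'.1.prodMk d₂'.1, d₁'.2.prodMk d₂'.2⟩
  have d' : HasMFDerivAt (I₁.prod I₂) 𝓘(ℝ, E₁ × E₂) (extChartAt (I₁.prod I₂) p)
      ((extChartAt (I₁.prod I₂) p).symm e) _ := hφ ▸ d
  rw [d'.mfderiv]
  rfl

/-- The differential of the product chart is block diagonal and carries the proposed vector to `v`;
inverting it gives the claim without differentiating the inverse chart. -/
theorem mfderivWithin_extChartAt_symm_prod_apply (he : e ∈ (extChartAt (I₁.prod I₂) p).target)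
    (v : E₁ × E₂) :
    mfderivWithin 𝓘(ℝ, E₁ × E₂) (I₁.prod I₂) (extChartAt (I₁.prod I₂) p).symm
      (Set.range (I₁.prod I₂)) e v =
    (show E₁ × E₂ from
      (mfderivWithin 𝓘(ℝ, E₁) I₁ (extChartAt I₁ p.1).symm (Set.range I₁) e.1 v.1,
      mfderivWithin 𝓘(ℝ, E₂) I₂ (extChartAt I₂ p.2).symm (Set.range I₂) e.2 v.2)) := by
  obtain ⟨h₁, h₂⟩ := mem_target_prod_iff.1 he
  let w : TangentSpace (I₁.prod I₂) ((extChartAt (I₁.prod I₂) p).symm e) :=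
    (show E₁ × E₂ from
      (mfderivWithin 𝓘(ℝ, E₁) I₁ (extChartAt I₁ p.1).symm (Set.range I₁) e.1 v.1,
      mfderivWithin 𝓘(ℝ, E₂) I₂ (extChartAt I₂ p.2).symm (Set.range I₂) e.2 v.2))
  have h := symm_comp_mfderiv he w
  have hw : (mfderiv (I₁.prod I₂) 𝓘(ℝ, E₁ × E₂) (extChartAt (I₁.prod I₂) p)
      ((extChartAt (I₁.prod I₂) p).symm e) w : E₁ × E₂) = v :=
    (mfderiv_extChartAt_prod_apply he w).trans
      (Prod.ext (mfderiv_comp_symm h₁ v.1) (mfderiv_comp_symm h₂ v.2))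
  exact (congrArg _ hw).symm.trans h

theorem toModel_bigFst (he : e ∈ (extChartAt (I₁.prod I₂) p).target)
    (c : BigTangent (I₁.prod I₂) ((extChartAt (I₁.prod I₂) p).symm e)) :
    toModel I₁ p.1 e.1 (bigFst I₁ I₂ ((extChartAt (I₁.prod I₂) p).symm e) c) =
      modelFst E₁ E₂ (toModel (I₁.prod I₂) p e c) := by
  refine Prod.ext (congrArg Prod.fst (mfderiv_extChartAt_prod_apply he c.1)).symm
    (ContinuousLinearMap.ext fun w => ?_)
  refine congrArg c.2 (Eq.trans ?_ (mfderivWithin_extChartAt_symm_prod_apply he (w, 0)).symm)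
  exact Prod.ext rfl (map_zero _).symm

theorem toModel_bigInl (he : e ∈ (extChartAt (I₁.prod I₂) p).target)
    (a : BigTangent I₁ ((extChartAt I₁ p.1).symm e.1)) :
    toModel (I₁.prod I₂) p e (bigInl I₁ I₂ ((extChartAt (I₁.prod I₂) p).symm e) a) =
      modelInl E₁ E₂ (toModel I₁ p.1 e.1 a) := by
  refine Prod.ext ((mfderiv_extChartAt_prod_apply he _).trans (Prod.ext rfl (map_zero _)))
    (ContinuousLinearMap.ext fun w => ?_)
  exact congrArg a.2 (congrArg Prod.fst (mfderivWithin_extChartAt_symm_prod_apply he w))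

theorem fromModel_modelFst (he : e ∈ (extChartAt (I₁.prod I₂) p).target)
    (v : (E₁ × E₂) × ((E₁ × E₂) →L[ℝ] ℝ)) :
    fromModel I₁ p.1 e.1 (modelFst E₁ E₂ v) =
      bigFst I₁ I₂ ((extChartAt (I₁.prod I₂) p).symm e) (fromModel (I₁.prod I₂) p e v) := by
  have h := toModel_bigFst he (fromModel (I₁.prod I₂) p e v)
  rw [toModel_fromModel he] at h
  rw [← h]
  exact fromModel_toModel (mem_target_prod_iff.1 he).1 _

theorem localSection_pullFst (he : e ∈ (extChartAt (I₁.prod I₂) p).target)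
    (a : BigSection I₁ M₁) :
    localSection p (pullFst I₂ M₂ a) e = modelInl E₁ E₂ (localSection p.1 a e.1) :=
  toModel_bigInl he _

theorem localEnd_pullEndFst (he : e ∈ (extChartAt (I₁.prod I₂) p).target) (Φ : BigEnd I₁ M₁) :
    localEnd p (pullEndFst I₂ M₂ Φ) e =
      modelInl E₁ E₂ ∘L localEnd p.1 Φ e.1 ∘L modelFst E₁ E₂ := by
  refine ContinuousLinearMap.ext fun v => (toModel_bigInl he _).trans ?_
  exact congrArg (fun w => modelInl E₁ E₂ (toModel I₁ p.1 e.1 (Φ _ w)))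
    (fromModel_modelFst he v).symm

theorem localSection_sliceFst {e : E₁} (he : e ∈ (extChartAt I₁ p.1).target)
    (c : BigSection (I₁.prod I₂) (M₁ × M₂)) :
    localSection p.1 (sliceFst c p.2) e =
      modelFst E₁ E₂ (localSection p c (e, extChartAt I₂ p.2 p.2)) := by
  refine Eq.trans ?_ (toModel_bigFst
    (mem_target_prod_iff.2 ⟨he, mem_extChartAt_target p.2⟩) _)
  exact congrArg (fun q => toModel I₁ p.1 e (bigFst I₁ I₂ ((extChartAt I₁ p.1).symm e, q) (c _)))
    (extChartAt_to_inv (I := I₂) p.2).symm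

theorem toModel_bigSnd (he : e ∈ (extChartAt (I₁.prod I₂) p).target)
    (c : BigTangent (I₁.prod I₂) ((extChartAt (I₁.prod I₂) p).symm e)) :
    toModel I₂ p.2 e.2 (bigSnd I₁ I₂ ((extChartAt (I₁.prod I₂) p).symm e) c) =
      modelSnd E₁ E₂ (toModel (I₁.prod I₂) p e c) := by
  refine Prod.ext (congrArg Prod.snd (mfderiv_extChartAt_prod_apply he c.1)).symm
    (ContinuousLinearMap.ext fun w => ?_)
  refine congrArg c.2 (Eq.trans ?_ (mfderivWithin_extChartAt_symm_prod_apply he (0, w)).symm)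
  exact Prod.ext (map_zero _).symm rfl

theorem toModel_bigInr (he : e ∈ (extChartAt (I₁.prod I₂) p).target)
    (a : BigTangent I₂ ((extChartAt I₂ p.2).symm e.2)) :
    toModel (I₁.prod I₂) p e (bigInr I₁ I₂ ((extChartAt (I₁.prod I₂) p).symm e) a) =
      modelInr E₁ E₂ (toModel I₂ p.2 e.2 a) := by
  refine Prod.ext ((mfderiv_extChartAt_prod_apply he _).trans (Prod.ext (map_zero _) rfl))
    (ContinuousLinearMap.ext fun w => ?_)
  exact congrArg a.2 (congrArg Prod.snd (mfderivWithin_extChartAt_symm_prod_apply he w))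

theorem fromModel_modelSnd (he : e ∈ (extChartAt (I₁.prod I₂) p).target)
    (v : (E₁ × E₂) × ((E₁ × E₂) →L[ℝ] ℝ)) :
    fromModel I₂ p.2 e.2 (modelSnd E₁ E₂ v) =
      bigSnd I₁ I₂ ((extChartAt (I₁.prod I₂) p).symm e) (fromModel (I₁.prod I₂) p e v) := by
  have h := toModel_bigSnd he (fromModel (I₁.prod I₂) p e v)
  rw [toModel_fromModel he] at h
  rw [← h]
  exact fromModel_toModel (mem_target_prod_iff.1 he).2 _

theorem localSection_pullSnd (he : e ∈ (extChartAt (I₁.prod I₂) p).target)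
    (a : BigSection I₂ M₂) :
    localSection p (pullSnd I₁ M₁ a) e = modelInr E₁ E₂ (localSection p.2 a e.2) :=
  toModel_bigInr he _

theorem localEnd_pullEndSnd (he : e ∈ (extChartAt (I₁.prod I₂) p).target) (Φ : BigEnd I₂ M₂) :
    localEnd p (pullEndSnd I₁ M₁ Φ) e =
      modelInr E₁ E₂ ∘L localEnd p.2 Φ e.2 ∘L modelSnd E₁ E₂ := by
  refine ContinuousLinearMap.ext fun v => (toModel_bigInr he _).trans ?_
  exact congrArg (fun w => modelInr E₁ E₂ (toModel I₂ p.2 e.2 (Φ _ w)))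
    (fromModel_modelSnd he v).symm

theorem localSection_sliceSnd {e : E₂} (he : e ∈ (extChartAt I₂ p.2).target)
    (c : BigSection (I₁.prod I₂) (M₁ × M₂)) :
    localSection p.2 (sliceSnd c p.1) e =
      modelSnd E₁ E₂ (localSection p c (extChartAt I₁ p.1 p.1, e)) := by
  refine Eq.trans ?_ (toModel_bigSnd
    (mem_target_prod_iff.2 ⟨mem_extChartAt_target p.1, he⟩) _)
  exact congrArg (fun q => toModel I₂ p.2 e (bigSnd I₁ I₂ (q, (extChartAt I₂ p.2).symm e) (c _)))
    (extChartAt_to_inv (I := I₁) p.1).symm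

end ProductSmooth

/-! ### Smoothness of sums, differences and tensors of sections. -/

section EndSmooth

variable {E : Type*} [NormedAddCommGroup E] [NormedSpace ℝ E]
  {K : Type*} [TopologicalSpace K] {I : ModelWithCorners ℝ E K}
  {M : Type*} [TopologicalSpace M] [ChartedSpace K M] [IsManifold I ∞ M] [I.Boundaryless]
  {Φ Ψ : BigEnd I M} {a b : BigSection I M}

theorem IsSmoothEnd.of_eventuallyEq
    (h : ∀ p : M, ∃ g : E → (E × (E →L[ℝ] ℝ)) →L[ℝ] (E × (E →L[ℝ] ℝ)),
      ContDiffAt ℝ ∞ g (extChartAt I p p) ∧ ∀ e ∈ (extChartAt I p).target, ∀ v,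
        localEnd p Φ e v = g e v) : IsSmoothEnd Φ :=
  isSmoothEnd_iff.2 fun p => by
    obtain ⟨g, hg, h⟩ := h p
    refine hg.congr_of_eventuallyEq ?_
    filter_upwards [extChartAt_target_mem_nhds (I := I) p] with e he
    exact ContinuousLinearMap.ext (h e he)

theorem IsSmoothEnd.add (hΦ : IsSmoothEnd Φ) (hΨ : IsSmoothEnd Ψ) :
    IsSmoothEnd (fun x => Φ x + Ψ x) :=
  .of_eventuallyEq fun p => ⟨_, (hΦ.contDiffAt p).add (hΨ.contDiffAt p), fun e _ _ =>
    (toModel I p e).map_add _ _⟩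

theorem IsSmoothEnd.sub (hΦ : IsSmoothEnd Φ) (hΨ : IsSmoothEnd Ψ) :
    IsSmoothEnd (fun x => Φ x - Ψ x) :=
  .of_eventuallyEq fun p => ⟨_, (hΦ.contDiffAt p).sub (hΨ.contDiffAt p), fun e _ _ =>
    (toModel I p e).map_sub _ _⟩

variable (E) in
/-- The functional `v ↦ 2⟨b, v⟩` on the model fibre. -/
def modelDual (b : E × (E →L[ℝ] ℝ)) : E × (E →L[ℝ] ℝ) →L[ℝ] ℝ :=
  ContinuousLinearMap.apply ℝ ℝ b.1 ∘L ContinuousLinearMap.snd ℝ E (E →L[ℝ] ℝ)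
    + b.2 ∘L ContinuousLinearMap.fst ℝ E (E →L[ℝ] ℝ)

theorem modelDual_apply (b v : E × (E →L[ℝ] ℝ)) : modelDual E b v = 2 * modelPairing b v := by
  change v.2 b.1 + b.2 v.1 = 2 * ((1 / 2) * (v.2 b.1 + b.2 v.1))
  ring

theorem contDiff_modelDual : ContDiff ℝ ∞ (modelDual E) := by
  have h1 : ContDiff ℝ ∞ fun b : E × (E →L[ℝ] ℝ) =>
      (ContinuousLinearMap.apply ℝ ℝ : E →L[ℝ] (E →L[ℝ] ℝ) →L[ℝ] ℝ) b.1 :=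
    (ContinuousLinearMap.contDiff _).comp contDiff_fst
  have h2 := h1.clm_comp (contDiff_const (c := ContinuousLinearMap.snd ℝ E (E →L[ℝ] ℝ)))
  have h3 : ContDiff ℝ ∞ fun b : E × (E →L[ℝ] ℝ) => b.2 ∘L ContinuousLinearMap.fst ℝ E (E →L[ℝ] ℝ) :=
    contDiff_snd.clm_comp contDiff_const
  exact h2.add h3

theorem IsSmoothSection.tensorEnd (ha : IsSmoothSection a) (hb : IsSmoothSection b) :
    IsSmoothEnd (fun x => tensorEnd (a x) (b x)) :=
  .of_eventuallyEq fun p => by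
    refine ⟨fun e => (modelDual E (localSection p b e)).smulRight (localSection p a e),
      (contDiff_modelDual (E := E)).contDiffAt.comp _ (hb.contDiffAt p) |>.smulRight
        (ha.contDiffAt p),
      fun e he v => ?_⟩
    have h1 : modelPairing (localSection p b e) v =
        pairing (b ((extChartAt I p).symm e)) (fromModel I p e v) := by
      rw [← modelPairing_toModel he, toModel_fromModel he]
      rfl
    change toModel I p e (GenGeom.tensorEnd _ _ _) = modelDual E (localSection p b e) v • _
    rw [tensorEnd_apply, modelDual_apply, h1]
    exact (toModel I p e).map_smul _ _

end EndSmooth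

/-! ### Brackets of sections pulled back from the factors. -/

section ProductSections

variable {E₁ : Type*} [NormedAddCommGroup E₁] [NormedSpace ℝ E₁]
  {K₁ : Type*} [TopologicalSpace K₁] {I₁ : ModelWithCorners ℝ E₁ K₁}
  {M₁ : Type*} [TopologicalSpace M₁] [ChartedSpace K₁ M₁] [IsManifold I₁ ∞ M₁] [I₁.Boundaryless]
  {E₂ : Type*} [NormedAddCommGroup E₂] [NormedSpace ℝ E₂]
  {K₂ : Type*} [TopologicalSpace K₂] {I₂ : ModelWithCorners ℝ E₂ K₂}
  {M₂ : Type*} [TopologicalSpace M₂] [ChartedSpace K₂ M₂] [IsManifold I₂ ∞ M₂] [I₂.Boundaryless]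
  {p : M₁ × M₂}

theorem eventuallyEq_localSection_pullFst (a : BigSection I₁ M₁) :
    localSection p (pullFst I₂ M₂ a) =ᶠ[nhds (extChartAt (I₁.prod I₂) p p)]
      fun e => modelInl E₁ E₂ (localSection p.1 a e.1) := by
  filter_upwards [extChartAt_target_mem_nhds (I := I₁.prod I₂) p] with e he
  exact localSection_pullFst he a

theorem IsSmoothSection.pullFst {a : BigSection I₁ M₁} (ha : IsSmoothSection a) :
    IsSmoothSection (pullFst I₂ M₂ a) :=
  isSmoothSection_iff.2 fun p => ((modelInl E₁ E₂).contDiff.contDiffAt.comp _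
    (ContDiffAt.comp (extChartAt (I₁.prod I₂) p p) (f := Prod.fst) (ha.contDiffAt p.1)
      contDiffAt_fst)).congr_of_eventuallyEq (eventuallyEq_localSection_pullFst a)

theorem sectionDeriv_pullFst {a : BigSection I₁ M₁} (ha : IsSmoothSection a)
    (v : TangentSpace (I₁.prod I₂) p) :
    sectionDeriv (pullFst I₂ M₂ a) p v = bigInl I₁ I₂ p (sectionDeriv a p.1 v.1) := by
  have h := ((modelInl E₁ E₂).hasFDerivAt.comp _
    (HasFDerivAt.comp (extChartAt (I₁.prod I₂) p p) (f := Prod.fst)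
      (ha.differentiableAt p.1).hasFDerivAt hasFDerivAt_fst)).congr_of_eventuallyEq
        (eventuallyEq_localSection_pullFst a)
  exact DFunLike.congr_fun h.fderiv v

theorem IsSmoothSection.sliceFst {c : BigSection (I₁.prod I₂) (M₁ × M₂)} (hc : IsSmoothSection c)
    (q : M₂) : IsSmoothSection (sliceFst c q) :=
  isSmoothSection_iff.2 fun x => by
    have h : ContDiffAt ℝ ∞ (fun e : E₁ => modelFst E₁ E₂
        (localSection (x, q) c (e, extChartAt I₂ q q))) (extChartAt I₁ x x) :=
      (modelFst E₁ E₂).contDiff.contDiffAt.comp _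
        (ContDiffAt.comp (extChartAt I₁ x x) (f := fun e : E₁ => (e, extChartAt I₂ q q))
          (hc.contDiffAt (x, q)) (contDiffAt_id.prodMk contDiffAt_const))
    refine h.congr_of_eventuallyEq ?_
    filter_upwards [extChartAt_target_mem_nhds (I := I₁) x] with e he
    exact localSection_sliceFst (p := (x, q)) he c

theorem IsSmoothEnd.pullEndFst {Φ : BigEnd I₁ M₁} (hΦ : IsSmoothEnd Φ) :
    IsSmoothEnd (pullEndFst I₂ M₂ Φ) :=
  .of_eventuallyEq fun p => ⟨_, contDiffAt_const.clm_comp ((ContDiffAt.comp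
    (extChartAt (I₁.prod I₂) p p) (f := Prod.fst) (hΦ.contDiffAt p.1) contDiffAt_fst).clm_comp
      contDiffAt_const), fun _ he v => DFunLike.congr_fun (localEnd_pullEndFst he Φ) v⟩

/-- In `pairing_courant` only the first component of `z` is seen, and the pullback of `H₂` vanishes
because its first argument has no component along `M₂`. -/
theorem courant_pullFst [CompleteSpace E₁] [CompleteSpace E₂] {H₁ : Form I₁ M₁ 3}
    {H₂ : Form I₂ M₂ 3} {a b : BigSection I₁ M₁} (ha : IsSmoothSection a)
    (hb : IsSmoothSection b) (p : M₁ × M₂) :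
    courant (prodForm H₁ H₂) (pullFst I₂ M₂ a) (pullFst I₂ M₂ b) p =
      bigInl I₁ I₂ p (courant H₁ a b p.1) := by
  refine eq_of_forall_pairing_eq fun z => ?_
  have hH : prodForm H₁ H₂ p ![(pullFst I₂ M₂ a p).1, (pullFst I₂ M₂ b p).1, z.1] =
      H₁ p.1 ![(a p.1).1, (b p.1).1, (bigFst I₁ I₂ p z).1] := by
    have h1 : tangentFst I₁ I₂ p ∘ ![(pullFst I₂ M₂ a p).1, (pullFst I₂ M₂ b p).1, z.1] =
        ![(a p.1).1, (b p.1).1, (bigFst I₁ I₂ p z).1] := by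
      ext i; fin_cases i <;> rfl
    have h2 : H₂ p.2 (tangentSnd I₁ I₂ p ∘
        ![(pullFst I₂ M₂ a p).1, (pullFst I₂ M₂ b p).1, z.1]) = 0 :=
      (H₂ p.2).toAlternatingMap.map_coord_zero 0 rfl
    refine (congrArg₂ (· + ·) (congrArg (H₁ p.1) h1) h2).trans (add_zero _)
  rw [pairing_bigInl, pairing_courant_of_smooth _ ha.pullFst hb.pullFst,
    pairing_courant_of_smooth _ ha hb, hH]
  simp only [sectionDeriv_pullFst ha, sectionDeriv_pullFst hb, pairing_bigInl]
  rfl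

theorem eventuallyEq_localSection_pullSnd (a : BigSection I₂ M₂) :
    localSection p (pullSnd I₁ M₁ a) =ᶠ[nhds (extChartAt (I₁.prod I₂) p p)]
      fun e => modelInr E₁ E₂ (localSection p.2 a e.2) := by
  filter_upwards [extChartAt_target_mem_nhds (I := I₁.prod I₂) p] with e he
  exact localSection_pullSnd he a

theorem IsSmoothSection.pullSnd {a : BigSection I₂ M₂} (ha : IsSmoothSection a) :
    IsSmoothSection (pullSnd I₁ M₁ a) :=
  isSmoothSection_iff.2 fun p => ((modelInr E₁ E₂).contDiff.contDiffAt.comp _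
    (ContDiffAt.comp (extChartAt (I₁.prod I₂) p p) (f := Prod.snd) (ha.contDiffAt p.2)
      contDiffAt_snd)).congr_of_eventuallyEq (eventuallyEq_localSection_pullSnd a)

theorem sectionDeriv_pullSnd {a : BigSection I₂ M₂} (ha : IsSmoothSection a)
    (v : TangentSpace (I₁.prod I₂) p) :
    sectionDeriv (pullSnd I₁ M₁ a) p v = bigInr I₁ I₂ p (sectionDeriv a p.2 v.2) := by
  have h := ((modelInr E₁ E₂).hasFDerivAt.comp _
    (HasFDerivAt.comp (extChartAt (I₁.prod I₂) p p) (f := Prod.snd)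
      (ha.differentiableAt p.2).hasFDerivAt hasFDerivAt_snd)).congr_of_eventuallyEq
        (eventuallyEq_localSection_pullSnd a)
  exact DFunLike.congr_fun h.fderiv v

theorem IsSmoothSection.sliceSnd {c : BigSection (I₁.prod I₂) (M₁ × M₂)} (hc : IsSmoothSection c)
    (q : M₁) : IsSmoothSection (sliceSnd c q) :=
  isSmoothSection_iff.2 fun x => by
    have h : ContDiffAt ℝ ∞ (fun e : E₂ => modelSnd E₁ E₂
        (localSection (q, x) c (extChartAt I₁ q q, e))) (extChartAt I₂ x x) :=
      (modelSnd E₁ E₂).contDiff.contDiffAt.comp _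
        (ContDiffAt.comp (extChartAt I₂ x x) (f := fun e : E₂ => (extChartAt I₁ q q, e))
          (hc.contDiffAt (q, x)) (contDiffAt_const.prodMk contDiffAt_id))
    refine h.congr_of_eventuallyEq ?_
    filter_upwards [extChartAt_target_mem_nhds (I := I₂) x] with e he
    exact localSection_sliceSnd (p := (q, x)) he c

theorem IsSmoothEnd.pullEndSnd {Φ : BigEnd I₂ M₂} (hΦ : IsSmoothEnd Φ) :
    IsSmoothEnd (pullEndSnd I₁ M₁ Φ) :=
  .of_eventuallyEq fun p => ⟨_, contDiffAt_const.clm_comp ((ContDiffAt.comp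
    (extChartAt (I₁.prod I₂) p p) (f := Prod.snd) (hΦ.contDiffAt p.2) contDiffAt_snd).clm_comp
      contDiffAt_const), fun _ he v => DFunLike.congr_fun (localEnd_pullEndSnd he Φ) v⟩

theorem courant_pullSnd [CompleteSpace E₁] [CompleteSpace E₂] {H₁ : Form I₁ M₁ 3}
    {H₂ : Form I₂ M₂ 3} {a b : BigSection I₂ M₂} (ha : IsSmoothSection a)
    (hb : IsSmoothSection b) (p : M₁ × M₂) :
    courant (prodForm H₁ H₂) (pullSnd I₁ M₁ a) (pullSnd I₁ M₁ b) p =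
      bigInr I₁ I₂ p (courant H₂ a b p.2) := by
  refine eq_of_forall_pairing_eq fun z => ?_
  have hH : prodForm H₁ H₂ p ![(pullSnd I₁ M₁ a p).1, (pullSnd I₁ M₁ b p).1, z.1] =
      H₂ p.2 ![(a p.2).1, (b p.2).1, (bigSnd I₁ I₂ p z).1] := by
    have h1 : tangentSnd I₁ I₂ p ∘ ![(pullSnd I₁ M₁ a p).1, (pullSnd I₁ M₁ b p).1, z.1] =
        ![(a p.2).1, (b p.2).1, (bigSnd I₁ I₂ p z).1] := by
      ext i; fin_cases i <;> rfl
    have h2 : H₁ p.1 (tangentFst I₁ I₂ p ∘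
        ![(pullSnd I₁ M₁ a p).1, (pullSnd I₁ M₁ b p).1, z.1]) = 0 :=
      (H₁ p.1).toAlternatingMap.map_coord_zero 0 rfl
    refine (congrArg₂ (· + ·) h2 (congrArg (H₂ p.2) h1)).trans (zero_add _)
  rw [pairing_bigInr, pairing_courant_of_smooth _ ha.pullSnd hb.pullSnd,
    pairing_courant_of_smooth _ ha hb, hH]
  simp only [sectionDeriv_pullSnd ha, sectionDeriv_pullSnd hb, pairing_bigInr]
  rfl

/-- Each section is constant along the other factor, the two summands of the big tangent bundle are
orthogonal, and both pulled back three-forms have a zero argument. -/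
theorem courant_pullFst_pullSnd [CompleteSpace E₁] [CompleteSpace E₂] {H₁ : Form I₁ M₁ 3}
    {H₂ : Form I₂ M₂ 3} {a : BigSection I₁ M₁} {b : BigSection I₂ M₂} (ha : IsSmoothSection a)
    (hb : IsSmoothSection b) (p : M₁ × M₂) :
    courant (prodForm H₁ H₂) (pullFst I₂ M₂ a) (pullSnd I₁ M₁ b) p = 0 := by
  refine eq_of_forall_pairing_eq fun z => ?_
  have hH : prodForm H₁ H₂ p ![(pullFst I₂ M₂ a p).1, (pullSnd I₁ M₁ b p).1, z.1] = 0 := by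
    have h1 : H₁ p.1 (tangentFst I₁ I₂ p ∘
        ![(pullFst I₂ M₂ a p).1, (pullSnd I₁ M₁ b p).1, z.1]) = 0 :=
      (H₁ p.1).toAlternatingMap.map_coord_zero 1 rfl
    have h2 : H₂ p.2 (tangentSnd I₁ I₂ p ∘
        ![(pullFst I₂ M₂ a p).1, (pullSnd I₁ M₁ b p).1, z.1]) = 0 :=
      (H₂ p.2).toAlternatingMap.map_coord_zero 0 rfl
    exact (congrArg₂ (· + ·) h1 h2).trans (add_zero _)
  have h1 : sectionDeriv b p.2 (bigInl I₁ I₂ p (a p.1)).1.2 = 0 := map_zero (sectionDeriv b p.2)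
  have h2 : sectionDeriv a p.1 (bigInr I₁ I₂ p (b p.2)).1.1 = 0 := map_zero (sectionDeriv a p.1)
  rw [pairing_courant_of_smooth _ ha.pullFst hb.pullSnd, hH]
  simp only [sectionDeriv_pullFst ha, sectionDeriv_pullSnd hb, pairing_bigInl, pairing_bigInr,
    h1, h2, pullFst, pullSnd, bigFst_bigInr, bigSnd_bigInl, pairing_zero_left, pairing_zero_right]
  ring

end ProductSections

/-! ### The induced generalized almost complex structure on the product. -/

section InducedStructure

variable {E₁ : Type*} [NormedAddCommGroup E₁] [NormedSpace ℝ E₁]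
  {K₁ : Type*} [TopologicalSpace K₁] {I₁ : ModelWithCorners ℝ E₁ K₁}
  {M₁ : Type*} [TopologicalSpace M₁] [ChartedSpace K₁ M₁] [IsManifold I₁ ∞ M₁]
  {E₂ : Type*} [NormedAddCommGroup E₂] [NormedSpace ℝ E₂]
  {K₂ : Type*} [TopologicalSpace K₂] {I₂ : ModelWithCorners ℝ E₂ K₂}
  {M₂ : Type*} [TopologicalSpace M₂] [ChartedSpace K₂ M₂] [IsManifold I₂ ∞ M₂]
  {Φ₁ : BigEnd I₁ M₁} {Ep₁ Em₁ : BigSection I₁ M₁} {Φ₂ : BigEnd I₂ M₂} {Ep₂ Em₂ : BigSection I₂ M₂}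
  {H₁ : Form I₁ M₁ 3} {H₂ : Form I₂ M₂ 3}

theorem pairing_eq_add {p : M₁ × M₂} (c d : BigTangent (I₁.prod I₂) p) :
    pairing c d = pairing (bigFst I₁ I₂ p c) (bigFst I₁ I₂ p d)
      + pairing (bigSnd I₁ I₂ p c) (bigSnd I₁ I₂ p d) := by
  conv_lhs => rw [← bigInl_bigFst_add c]
  rw [pairing_add_left, pairing_bigInl, pairing_bigInr]

theorem big_ext_iff_zero {p : M₁ × M₂} {c : BigTangent (I₁.prod I₂) p} :
    c = 0 ↔ bigFst I₁ I₂ p c = 0 ∧ bigSnd I₁ I₂ p c = 0 := by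
  have h1 : bigFst I₁ I₂ p 0 = 0 := (bigFst I₁ I₂ p).map_zero
  have h2 : bigSnd I₁ I₂ p 0 = 0 := (bigSnd I₁ I₂ p).map_zero
  exact ⟨fun h => by rw [h]; exact ⟨h1, h2⟩,
    fun h => big_ext (h.1.trans h1.symm) (h.2.trans h2.symm)⟩

/-- On horizontal elements `J` is `Φᵢ`, whose square is `-1`. On the span of the `E₊`, `E₋` of both
factors, which the `Φᵢ` kill, `J` acts by `E₊₁ ↦ E₋₂ ↦ -E₊₁` and `E₋₁ ↦ E₊₂ ↦ -E₋₁`, which supplies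
the missing part of `-1`. -/
theorem isGenAlmostComplex_inducedEnd [I₁.Boundaryless] [I₂.Boundaryless]
    (h₁ : IsGenAlmostContact Φ₁ Ep₁ Em₁) (h₂ : IsGenAlmostContact Φ₂ Ep₂ Em₂) :
    IsGenAlmostComplex (inducedEnd Φ₁ Ep₁ Em₁ Φ₂ Ep₂ Em₂) where
  smooth := by
    -- Smoothness is seen by writing `J` as pulled back endomorphisms plus tensors of pulled back
    -- sections.
    have h := ((((h₁.smooth.pullEndFst (I₂ := I₂) (M₂ := M₂)).sub
      (h₁.smooth_Ep.pullFst.tensorEnd h₂.smooth_Ep.pullSnd)).sub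
      (h₁.smooth_Em.pullFst.tensorEnd h₂.smooth_Em.pullSnd)).add
      (((h₂.smooth.pullEndSnd (I₁ := I₁) (M₁ := M₁)).add
      (h₂.smooth_Ep.pullSnd.tensorEnd h₁.smooth_Ep.pullFst)).add
      (h₂.smooth_Em.pullSnd.tensorEnd h₁.smooth_Em.pullFst)))
    refine (funext fun p => ContinuousLinearMap.ext fun c => ?_ :
      inducedEnd Φ₁ Ep₁ Em₁ Φ₂ Ep₂ Em₂ = _) ▸ h
    change bigInl I₁ I₂ p (_ - _ - _) + bigInr I₁ I₂ p (_ + _ + _) =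
      (bigInl I₁ I₂ p (Φ₁ p.1 (bigFst I₁ I₂ p c)) - tensorEnd _ _ c - tensorEnd _ _ c)
      + (bigInr I₁ I₂ p (Φ₂ p.2 (bigSnd I₁ I₂ p c)) + tensorEnd _ _ c + tensorEnd _ _ c)
    have t₁ : ∀ (a : BigTangent I₁ p.1) (b : BigTangent I₂ p.2),
        bigInl I₁ I₂ p ((dualOf b).smulRight a (bigSnd I₁ I₂ p c)) =
          tensorEnd (bigInl I₁ I₂ p a) (bigInr I₁ I₂ p b) c := fun _ _ =>
      (bigInl I₁ I₂ p).map_smul _ _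
    have t₂ : ∀ (a : BigTangent I₁ p.1) (b : BigTangent I₂ p.2),
        bigInr I₁ I₂ p ((dualOf a).smulRight b (bigFst I₁ I₂ p c)) =
          tensorEnd (bigInr I₁ I₂ p b) (bigInl I₁ I₂ p a) c := fun _ _ =>
      (bigInr I₁ I₂ p).map_smul _ _
    rw [(bigInl I₁ I₂ p).map_sub, (bigInl I₁ I₂ p).map_sub, (bigInr I₁ I₂ p).map_add,
      (bigInr I₁ I₂ p).map_add]
    exact congrArg₂ (· + ·) (congrArg₂ (· - ·) (congrArg₂ (· - ·) rfl (t₁ _ _)) (t₁ _ _))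
      (congrArg₂ (· + ·) (congrArg₂ (· + ·) rfl (t₂ _ _)) (t₂ _ _))
  skew p a b := by
    rw [pairing_eq_add, pairing_eq_add a, bigFst_inducedEnd, bigFst_inducedEnd, bigSnd_inducedEnd,
      bigSnd_inducedEnd]
    simp only [pairing_sub_left, pairing_sub_right, pairing_add_left, pairing_add_right,
      pairing_smul_left, pairing_smul_right, h₁.skew', h₂.skew']
    rw [pairing_comm (bigFst I₁ I₂ p a) (Ep₁ p.1), pairing_comm (bigFst I₁ I₂ p a) (Em₁ p.1),
      pairing_comm (bigSnd I₁ I₂ p a) (Ep₂ p.2), pairing_comm (bigSnd I₁ I₂ p a) (Em₂ p.2)]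
    ring
  sq p a := by
    have hp₁ := eq_div_of_mul_eq two_ne_zero ((mul_comm _ _).trans (h₁.dual p.1))
    have hm₁ := eq_div_of_mul_eq two_ne_zero ((mul_comm _ _).trans (h₁.symm.dual p.1))
    have hp₂ := eq_div_of_mul_eq two_ne_zero ((mul_comm _ _).trans (h₂.dual p.2))
    have hm₂ := eq_div_of_mul_eq two_ne_zero ((mul_comm _ _).trans (h₂.symm.dual p.2))
    refine big_ext ?_ ?_
    · rw [bigFst_inducedEnd, bigFst_inducedEnd, bigSnd_inducedEnd, (bigFst I₁ I₂ p).map_neg]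
      simp only [pairing_add_right, bigEnd_sub, bigEnd_smul, h₁.map_Ep, h₁.map_Em, h₁.sq_apply,
        pairing_smul_right, h₂.isotropic_Ep, h₂.isotropic_Em, h₂.pairing_Ep_map,
        h₂.symm.pairing_Ep_map, hp₂, hm₂]
      module
    · rw [bigSnd_inducedEnd, bigSnd_inducedEnd, bigFst_inducedEnd, (bigSnd I₁ I₂ p).map_neg]
      simp only [pairing_sub_right, bigEnd_add, bigEnd_smul, h₂.map_Ep, h₂.map_Em, h₂.sq_apply,
        pairing_smul_right, h₁.isotropic_Ep, h₁.isotropic_Em, h₁.pairing_Ep_map,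
        h₁.symm.pairing_Ep_map, hp₁, hm₁]
      module

theorem inducedEnd_bigInl (p : M₁ × M₂) (a : BigTangent I₁ p.1) :
    inducedEnd Φ₁ Ep₁ Em₁ Φ₂ Ep₂ Em₂ p (bigInl I₁ I₂ p a) = bigInl I₁ I₂ p (Φ₁ p.1 a)
      + bigInr I₁ I₂ p ((2 * pairing (Ep₁ p.1) a) • Ep₂ p.2 + (2 * pairing (Em₁ p.1) a) • Em₂ p.2)
      := by
  refine big_ext ?_ ?_
  · rw [bigFst_inducedEnd, (bigFst I₁ I₂ p).map_add, bigFst_bigInl, bigFst_bigInl, bigFst_bigInr,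
      bigSnd_bigInl, pairing_zero_right, pairing_zero_right, mul_zero, big_zero_smul, big_zero_smul,
      sub_zero, sub_zero, add_zero]
  · rw [bigSnd_inducedEnd, (bigSnd I₁ I₂ p).map_add, bigSnd_bigInr, bigSnd_bigInl, bigSnd_bigInl,
      bigFst_bigInl, bigEnd_zero, zero_add, zero_add]

theorem inducedEnd_bigInr (p : M₁ × M₂) (a : BigTangent I₂ p.2) :
    inducedEnd Φ₁ Ep₁ Em₁ Φ₂ Ep₂ Em₂ p (bigInr I₁ I₂ p a) = bigInr I₁ I₂ p (Φ₂ p.2 a)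
      - bigInl I₁ I₂ p ((2 * pairing (Ep₂ p.2) a) • Ep₁ p.1 + (2 * pairing (Em₂ p.2) a) • Em₁ p.1)
      := by
  refine big_ext ?_ ?_
  · rw [bigFst_inducedEnd, (bigFst I₁ I₂ p).map_sub, bigFst_bigInl, bigFst_bigInr, bigFst_bigInr,
      bigSnd_bigInr, bigEnd_zero, zero_sub, zero_sub, neg_add, sub_eq_add_neg]
  · rw [bigSnd_inducedEnd, (bigSnd I₁ I₂ p).map_sub, bigSnd_bigInr, bigSnd_bigInr, bigSnd_bigInl,
      bigFst_bigInr, pairing_zero_right, pairing_zero_right, mul_zero, big_zero_smul, big_zero_smul,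
      sub_zero, add_zero, add_zero]

variable (h₁ : IsGenAlmostContact Φ₁ Ep₁ Em₁) (h₂ : IsGenAlmostContact Φ₂ Ep₂ Em₂)

include h₁ h₂

theorem inducedEnd_pullFst {u : BigSection I₁ M₁} (hu : IsHorizontal Φ₁ u) :
    mapSection (inducedEnd Φ₁ Ep₁ Em₁ Φ₂ Ep₂ Em₂) (pullFst I₂ M₂ u) =
      pullFst I₂ M₂ (mapSection Φ₁ u) := funext fun p => by
  have hp := h₁.pairing_Ep_eq_zero (hu p.1)
  have hm := h₁.symm.pairing_Ep_eq_zero (hu p.1)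
  rw [mapSection, pullFst, inducedEnd_bigInl, pairing_comm, hp, pairing_comm, hm, mul_zero,
    big_zero_smul, big_zero_smul, add_zero, (bigInr I₁ I₂ p).map_zero, add_zero]
  rfl

theorem inducedEnd_pullSnd {u : BigSection I₂ M₂} (hu : IsHorizontal Φ₂ u) :
    mapSection (inducedEnd Φ₁ Ep₁ Em₁ Φ₂ Ep₂ Em₂) (pullSnd I₁ M₁ u) =
      pullSnd I₁ M₁ (mapSection Φ₂ u) := funext fun p => by
  have hp := h₂.pairing_Ep_eq_zero (hu p.2)
  have hm := h₂.symm.pairing_Ep_eq_zero (hu p.2)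
  rw [mapSection, pullSnd, inducedEnd_bigInr, pairing_comm, hp, pairing_comm, hm, mul_zero,
    big_zero_smul, big_zero_smul, add_zero, (bigInl I₁ I₂ p).map_zero, sub_zero]
  rfl

theorem inducedEnd_pullFst_Ep :
    mapSection (inducedEnd Φ₁ Ep₁ Em₁ Φ₂ Ep₂ Em₂) (pullFst I₂ M₂ Ep₁) = pullSnd I₁ M₁ Em₂ :=
  funext fun p => by
    rw [mapSection, pullFst, inducedEnd_bigInl, h₁.map_Ep, h₁.isotropic_Ep, h₁.symm.dual, mul_zero,
      big_zero_smul, zero_add, big_one_smul, (bigInl I₁ I₂ p).map_zero, zero_add]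
    rfl

theorem inducedEnd_pullFst_Em :
    mapSection (inducedEnd Φ₁ Ep₁ Em₁ Φ₂ Ep₂ Em₂) (pullFst I₂ M₂ Em₁) = pullSnd I₁ M₁ Ep₂ :=
  funext fun p => by
    rw [mapSection, pullFst, inducedEnd_bigInl, h₁.map_Em, h₁.isotropic_Em, h₁.dual, mul_zero,
      big_zero_smul, add_zero, big_one_smul, (bigInl I₁ I₂ p).map_zero, zero_add]
    rfl

theorem inducedEnd_pullSnd_Ep :
    mapSection (inducedEnd Φ₁ Ep₁ Em₁ Φ₂ Ep₂ Em₂) (pullSnd I₁ M₁ Ep₂) = -pullFst I₂ M₂ Em₁ :=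
  funext fun p => by
    rw [mapSection, pullSnd, inducedEnd_bigInr, h₂.map_Ep, h₂.isotropic_Ep, h₂.symm.dual, mul_zero,
      big_zero_smul, zero_add, big_one_smul, (bigInr I₁ I₂ p).map_zero, zero_sub]
    rfl

theorem inducedEnd_pullSnd_Em :
    mapSection (inducedEnd Φ₁ Ep₁ Em₁ Φ₂ Ep₂ Em₂) (pullSnd I₁ M₁ Em₂) = -pullFst I₂ M₂ Ep₁ :=
  funext fun p => by
    rw [mapSection, pullSnd, inducedEnd_bigInr, h₂.map_Em, h₂.isotropic_Em, h₂.dual, mul_zero,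
      big_zero_smul, add_zero, big_one_smul, (bigInr I₁ I₂ p).map_zero, zero_sub]
    rfl

/-- The component along `M₂` says that `w` is orthogonal to `E₊₁` and `E₋₁`, hence horizontal; the
component along `M₁` says `x = -Φ₁w`. This converts vanishing of `N` into membership in an
eigenbundle on `M₁`. -/
theorem bigInl_add_inducedEnd_eq_zero_iff {p : M₁ × M₂} {x w : BigTangent I₁ p.1} :
    bigInl I₁ I₂ p x + inducedEnd Φ₁ Ep₁ Em₁ Φ₂ Ep₂ Em₂ p (bigInl I₁ I₂ p w) = 0 ↔
      complexElt x (-w) ∈ eigenbundle Φ₁ p.1 := by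
  rw [inducedEnd_bigInl, big_ext_iff_zero, (bigFst I₁ I₂ p).map_add, (bigFst I₁ I₂ p).map_add,
    (bigSnd I₁ I₂ p).map_add, (bigSnd I₁ I₂ p).map_add, bigFst_bigInl, bigFst_bigInl, bigFst_bigInr,
    bigSnd_bigInl, bigSnd_bigInl, bigSnd_bigInr, add_zero, zero_add, zero_add, mem_eigenbundle_iff,
    neg_neg, bigEnd_neg]
  constructor
  · rintro ⟨h3, h4⟩
    have h5 := congrArg (pairing · (Ep₂ p.2)) h4
    have h6 := congrArg (pairing · (Em₂ p.2)) h4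
    simp only [pairing_add_left, pairing_smul_left, pairing_zero_left, h₂.isotropic_Ep,
      h₂.isotropic_Em, mul_zero, zero_add, add_zero] at h5 h6
    have h7 : 2 * pairing (Em₁ p.1) w = 0 := by
      linear_combination 2 * h5 - 2 * pairing (Em₁ p.1) w * h₂.symm.dual p.2
    have h8 : 2 * pairing (Ep₁ p.1) w = 0 := by
      linear_combination 2 * h6 - 2 * pairing (Ep₁ p.1) w * h₂.dual p.2
    have h9 : -Φ₁ p.1 w = x := (eq_neg_of_add_eq_zero_left h3).symm
    refine ⟨?_, h9⟩
    rw [← h9, bigEnd_neg, h₁.sq_apply, h7, h8, big_zero_smul, big_zero_smul, add_zero, add_zero,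
      neg_neg]
  · rintro ⟨h3, h4⟩
    rw [← h3, h₁.pairing_Ep_map, h₁.symm.pairing_Ep_map, mul_zero, big_zero_smul, big_zero_smul,
      h3, add_zero, ← h4]
    exact ⟨neg_add_cancel _, rfl⟩

theorem bigInr_add_inducedEnd_eq_zero_iff {p : M₁ × M₂} {x w : BigTangent I₂ p.2} :
    bigInr I₁ I₂ p x + inducedEnd Φ₁ Ep₁ Em₁ Φ₂ Ep₂ Em₂ p (bigInr I₁ I₂ p w) = 0 ↔
      complexElt x (-w) ∈ eigenbundle Φ₂ p.2 := by
  rw [inducedEnd_bigInr, big_ext_iff_zero, (bigFst I₁ I₂ p).map_add, (bigFst I₁ I₂ p).map_sub,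
    (bigSnd I₁ I₂ p).map_add, (bigSnd I₁ I₂ p).map_sub, bigSnd_bigInr, bigSnd_bigInr, bigSnd_bigInl,
    bigFst_bigInr, bigFst_bigInr, bigFst_bigInl, sub_zero, zero_add, zero_sub, mem_eigenbundle_iff,
    neg_neg, bigEnd_neg, neg_eq_zero]
  constructor
  · rintro ⟨h4, h3⟩
    have h5 := congrArg (pairing · (Ep₁ p.1)) h4
    have h6 := congrArg (pairing · (Em₁ p.1)) h4
    simp only [pairing_add_left, pairing_smul_left, pairing_zero_left, h₁.isotropic_Ep,
      h₁.isotropic_Em, mul_zero, zero_add, add_zero] at h5 h6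
    have h7 : 2 * pairing (Em₂ p.2) w = 0 := by
      linear_combination 2 * h5 - 2 * pairing (Em₂ p.2) w * h₁.symm.dual p.1
    have h8 : 2 * pairing (Ep₂ p.2) w = 0 := by
      linear_combination 2 * h6 - 2 * pairing (Ep₂ p.2) w * h₁.dual p.1
    have h9 : -Φ₂ p.2 w = x := (eq_neg_of_add_eq_zero_left h3).symm
    refine ⟨?_, h9⟩
    rw [← h9, bigEnd_neg, h₂.sq_apply, h7, h8, big_zero_smul, big_zero_smul, add_zero, add_zero,
      neg_neg]
  · rintro ⟨h3, h4⟩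
    rw [← h3, h₂.pairing_Ep_map, h₂.symm.pairing_Ep_map, mul_zero, big_zero_smul, big_zero_smul,
      h3, add_zero, ← h4]
    exact ⟨rfl, neg_add_cancel _⟩

end InducedStructure

/-! ### Vanishing of the Nijenhuis expression on combinations of generators. -/

section

variable {E : Type*} [NormedAddCommGroup E] [NormedSpace ℝ E] [CompleteSpace E]
  {K : Type*} [TopologicalSpace K] {I : ModelWithCorners ℝ E K} [I.Boundaryless]
  {M : Type*} [TopologicalSpace M] [ChartedSpace K M] [IsManifold I ∞ M]
  {H : Form I M 3} {J : BigEnd I M} {p : M}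

theorem nijenhuis_self (hJ : IsSmoothEnd J) {c : BigSection I M} (hc : IsSmoothSection c) :
    nijenhuis H J c c p = 0 := by
  have hJc := hJ.mapSection hc
  rw [nijenhuis, courant_self hc, courant_self hJc, courant_swap hc hJc, add_neg_cancel,
    bigEnd_zero, sub_zero, add_zero]

theorem nijenhuis_eq_zero_swap (hJ : IsSmoothEnd J) {a b : BigSection I M}
    (ha : IsSmoothSection a) (hb : IsSmoothSection b) (h : nijenhuis H J a b p = 0) :
    nijenhuis H J b a p = 0 := by
  rw [nijenhuis_swap hJ ha hb, h, neg_zero]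

theorem nijenhuis_eq_zero_of_combination (hJ : IsGenAlmostComplex J)
    {a b u v e f : BigSection I M} (ha : IsSmoothSection a) (hb : IsSmoothSection b)
    (hu : IsSmoothSection u) (hv : IsSmoothSection v) (he : IsSmoothSection e)
    (hf : IsSmoothSection f) (r s t w : ℝ)
    (h : a p = (u + v + r • e + s • f + mapSection J (t • e + w • f)) p)
    (hub : nijenhuis H J u b p = 0) (hvb : nijenhuis H J v b p = 0)
    (heb : nijenhuis H J e b p = 0) (hfb : nijenhuis H J f b p = 0) :
    nijenhuis H J a b p = 0 := by
  have st := (he.smul t).add (hf.smul w)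
  have s1 := hu.add hv
  have s2 := s1.add (he.smul r)
  have s3 := s2.add (hf.smul s)
  rw [nijenhuis_congr_left hJ ha (s3.add (hJ.smooth.mapSection st)) hb h,
    nijenhuis_add_left hJ.smooth s3 (hJ.smooth.mapSection st) hb,
    nijenhuis_add_left hJ.smooth s2 (hf.smul s) hb, nijenhuis_add_left hJ.smooth s1 (he.smul r) hb,
    nijenhuis_add_left hJ.smooth hu hv hb, nijenhuis_mapSection_left hJ st hb,
    nijenhuis_add_left hJ.smooth (he.smul t) (hf.smul w) hb,
    nijenhuis_smul_left hJ.smooth r he hb, nijenhuis_smul_left hJ.smooth s hf hb,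
    nijenhuis_smul_left hJ.smooth t he hb, nijenhuis_smul_left hJ.smooth w hf hb,
    hub, hvb, heb, hfb]
  simp only [big_smul_zero, add_zero, bigEnd_zero, neg_zero]

theorem nijenhuis_eq_zero_of_mapSection_eq_neg (hJ : IsGenAlmostComplex J) {b e f : BigSection I M}
    (hb : IsSmoothSection b) (hf : IsSmoothSection f)
    (h : mapSection J f = -e) (hfb : nijenhuis H J f b p = 0) : nijenhuis H J e b p = 0 := by
  have h' : e = (-1 : ℝ) • mapSection J f := funext fun x => by
    rw [h, Pi.smul_apply, Pi.neg_apply, big_neg_one_smul, neg_neg]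
  rw [h', nijenhuis_smul_left hJ.smooth _ (hJ.smooth.mapSection hf) hb,
    nijenhuis_mapSection_left hJ hf hb, hfb, bigEnd_zero, neg_zero, big_smul_zero]

end

/-! ### Integrability of the induced structure. -/

section InducedIntegrability

variable {E₁ : Type*} [NormedAddCommGroup E₁] [NormedSpace ℝ E₁] [CompleteSpace E₁]
  {K₁ : Type*} [TopologicalSpace K₁] {I₁ : ModelWithCorners ℝ E₁ K₁} [I₁.Boundaryless]
  {M₁ : Type*} [TopologicalSpace M₁] [ChartedSpace K₁ M₁] [IsManifold I₁ ∞ M₁]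
  {E₂ : Type*} [NormedAddCommGroup E₂] [NormedSpace ℝ E₂] [CompleteSpace E₂]
  {K₂ : Type*} [TopologicalSpace K₂] {I₂ : ModelWithCorners ℝ E₂ K₂} [I₂.Boundaryless]
  {M₂ : Type*} [TopologicalSpace M₂] [ChartedSpace K₂ M₂] [IsManifold I₂ ∞ M₂]
  {Φ₁ : BigEnd I₁ M₁} {Ep₁ Em₁ : BigSection I₁ M₁} {Φ₂ : BigEnd I₂ M₂} {Ep₂ Em₂ : BigSection I₂ M₂}
  {H₁ : Form I₁ M₁ 3} {H₂ : Form I₂ M₂ 3} {p : M₁ × M₂}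

theorem courant_pullSnd_pullFst {a : BigSection I₁ M₁} {b : BigSection I₂ M₂}
    (ha : IsSmoothSection a) (hb : IsSmoothSection b) (p : M₁ × M₂) :
    courant (prodForm H₁ H₂) (pullSnd I₁ M₁ b) (pullFst I₂ M₂ a) p = 0 := by
  rw [courant_swap ha.pullFst hb.pullSnd, courant_pullFst_pullSnd ha hb, neg_zero]

variable (h₁ : IsGenAlmostContact Φ₁ Ep₁ Em₁) (h₂ : IsGenAlmostContact Φ₂ Ep₂ Em₂)

include h₁ h₂

theorem nijenhuis_pullFst_eq_zero_iff {u v : BigSection I₁ M₁} (hus : IsSmoothSection u)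
    (hvs : IsSmoothSection v) (hu : IsHorizontal Φ₁ u) (hv : IsHorizontal Φ₁ v) :
    nijenhuis (prodForm H₁ H₂) (inducedEnd Φ₁ Ep₁ Em₁ Φ₂ Ep₂ Em₂) (pullFst I₂ M₂ u)
      (pullFst I₂ M₂ v) p = 0 ↔
    complexElt (courant H₁ u v p.1 - courant H₁ (mapSection Φ₁ u) (mapSection Φ₁ v) p.1)
      (-(courant H₁ u (mapSection Φ₁ v) p.1 + courant H₁ (mapSection Φ₁ u) v p.1))
      ∈ eigenbundle Φ₁ p.1 := by
  have hΦu := h₁.smooth.mapSection hus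
  have hΦv := h₁.smooth.mapSection hvs
  rw [nijenhuis, inducedEnd_pullFst h₁ h₂ hu, inducedEnd_pullFst h₁ h₂ hv, courant_pullFst hus hvs,
    courant_pullFst hus hΦv, courant_pullFst hΦu hvs, courant_pullFst hΦu hΦv,
    ← (bigInl I₁ I₂ p).map_sub, ← (bigInl I₁ I₂ p).map_add,
    bigInl_add_inducedEnd_eq_zero_iff h₁ h₂]

theorem nijenhuis_pullSnd_eq_zero_iff {u v : BigSection I₂ M₂} (hus : IsSmoothSection u)
    (hvs : IsSmoothSection v) (hu : IsHorizontal Φ₂ u) (hv : IsHorizontal Φ₂ v) :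
    nijenhuis (prodForm H₁ H₂) (inducedEnd Φ₁ Ep₁ Em₁ Φ₂ Ep₂ Em₂) (pullSnd I₁ M₁ u)
      (pullSnd I₁ M₁ v) p = 0 ↔
    complexElt (courant H₂ u v p.2 - courant H₂ (mapSection Φ₂ u) (mapSection Φ₂ v) p.2)
      (-(courant H₂ u (mapSection Φ₂ v) p.2 + courant H₂ (mapSection Φ₂ u) v p.2))
      ∈ eigenbundle Φ₂ p.2 := by
  have hΦu := h₂.smooth.mapSection hus
  have hΦv := h₂.smooth.mapSection hvs
  rw [nijenhuis, inducedEnd_pullSnd h₁ h₂ hu, inducedEnd_pullSnd h₁ h₂ hv, courant_pullSnd hus hvs,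
    courant_pullSnd hus hΦv, courant_pullSnd hΦu hvs, courant_pullSnd hΦu hΦv,
    ← (bigInr I₁ I₂ p).map_sub, ← (bigInr I₁ I₂ p).map_add,
    bigInr_add_inducedEnd_eq_zero_iff h₁ h₂]

theorem nijenhuis_pullFst_pullSnd {u : BigSection I₁ M₁} {v : BigSection I₂ M₂}
    (hus : IsSmoothSection u) (hvs : IsSmoothSection v) (hu : IsHorizontal Φ₁ u)
    (hv : IsHorizontal Φ₂ v) :
    nijenhuis (prodForm H₁ H₂) (inducedEnd Φ₁ Ep₁ Em₁ Φ₂ Ep₂ Em₂) (pullFst I₂ M₂ u)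
      (pullSnd I₁ M₁ v) p = 0 := by
  have hΦu := h₁.smooth.mapSection hus
  have hΦv := h₂.smooth.mapSection hvs
  rw [nijenhuis, inducedEnd_pullFst h₁ h₂ hu, inducedEnd_pullSnd h₁ h₂ hv,
    courant_pullFst_pullSnd hus hvs, courant_pullFst_pullSnd hus hΦv,
    courant_pullFst_pullSnd hΦu hvs, courant_pullFst_pullSnd hΦu hΦv, add_zero, bigEnd_zero,
    add_zero, sub_zero]

/-- As `J E₊₁ = E₋₂` comes from the other factor, the two brackets containing it vanish and `N`
reduces to `[[u, E₊₁]] + J[[Φ₁u, E₊₁]]`. -/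
theorem nijenhuis_pullFst_Ep_eq_zero_iff {u : BigSection I₁ M₁} (hus : IsSmoothSection u)
    (hu : IsHorizontal Φ₁ u) :
    nijenhuis (prodForm H₁ H₂) (inducedEnd Φ₁ Ep₁ Em₁ Φ₂ Ep₂ Em₂) (pullFst I₂ M₂ u)
      (pullFst I₂ M₂ Ep₁) p = 0 ↔
    complexElt (courant H₁ u Ep₁ p.1) (-courant H₁ (mapSection Φ₁ u) Ep₁ p.1)
      ∈ eigenbundle Φ₁ p.1 := by
  have hΦu := h₁.smooth.mapSection hus
  rw [nijenhuis, inducedEnd_pullFst h₁ h₂ hu, inducedEnd_pullFst_Ep h₁ h₂,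
    courant_pullFst hus h₁.smooth_Ep, courant_pullFst_pullSnd hΦu h₂.smooth_Em,
    courant_pullFst_pullSnd hus h₂.smooth_Em, courant_pullFst hΦu h₁.smooth_Ep, sub_zero, zero_add,
    bigInl_add_inducedEnd_eq_zero_iff h₁ h₂]

theorem nijenhuis_pullFst_Em_eq_zero_iff {u : BigSection I₁ M₁} (hus : IsSmoothSection u)
    (hu : IsHorizontal Φ₁ u) :
    nijenhuis (prodForm H₁ H₂) (inducedEnd Φ₁ Ep₁ Em₁ Φ₂ Ep₂ Em₂) (pullFst I₂ M₂ u)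
      (pullFst I₂ M₂ Em₁) p = 0 ↔
    complexElt (courant H₁ u Em₁ p.1) (-courant H₁ (mapSection Φ₁ u) Em₁ p.1)
      ∈ eigenbundle Φ₁ p.1 := by
  have hΦu := h₁.smooth.mapSection hus
  rw [nijenhuis, inducedEnd_pullFst h₁ h₂ hu, inducedEnd_pullFst_Em h₁ h₂,
    courant_pullFst hus h₁.smooth_Em, courant_pullFst_pullSnd hΦu h₂.smooth_Ep,
    courant_pullFst_pullSnd hus h₂.smooth_Ep, courant_pullFst hΦu h₁.smooth_Em, sub_zero, zero_add,
    bigInl_add_inducedEnd_eq_zero_iff h₁ h₂]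

theorem nijenhuis_pullSnd_Ep_eq_zero_iff {u : BigSection I₂ M₂} (hus : IsSmoothSection u)
    (hu : IsHorizontal Φ₂ u) :
    nijenhuis (prodForm H₁ H₂) (inducedEnd Φ₁ Ep₁ Em₁ Φ₂ Ep₂ Em₂) (pullSnd I₁ M₁ u)
      (pullSnd I₁ M₁ Ep₂) p = 0 ↔
    complexElt (courant H₂ u Ep₂ p.2) (-courant H₂ (mapSection Φ₂ u) Ep₂ p.2)
      ∈ eigenbundle Φ₂ p.2 := by
  have hΦu := h₂.smooth.mapSection hus
  have he := h₁.smooth_Em.pullFst (I₂ := I₂) (M₂ := M₂)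
  rw [nijenhuis, inducedEnd_pullSnd h₁ h₂ hu, inducedEnd_pullSnd_Ep h₁ h₂,
    courant_pullSnd hus h₂.smooth_Ep, courant_neg_right he hΦu.pullSnd,
    courant_neg_right he hus.pullSnd, courant_pullSnd_pullFst h₁.smooth_Em hΦu,
    courant_pullSnd_pullFst h₁.smooth_Em hus, courant_pullSnd hΦu h₂.smooth_Ep, neg_zero, sub_zero,
    zero_add, bigInr_add_inducedEnd_eq_zero_iff h₁ h₂]

theorem nijenhuis_pullSnd_Em_eq_zero_iff {u : BigSection I₂ M₂} (hus : IsSmoothSection u)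
    (hu : IsHorizontal Φ₂ u) :
    nijenhuis (prodForm H₁ H₂) (inducedEnd Φ₁ Ep₁ Em₁ Φ₂ Ep₂ Em₂) (pullSnd I₁ M₁ u)
      (pullSnd I₁ M₁ Em₂) p = 0 ↔
    complexElt (courant H₂ u Em₂ p.2) (-courant H₂ (mapSection Φ₂ u) Em₂ p.2)
      ∈ eigenbundle Φ₂ p.2 := by
  have hΦu := h₂.smooth.mapSection hus
  have he := h₁.smooth_Ep.pullFst (I₂ := I₂) (M₂ := M₂)
  rw [nijenhuis, inducedEnd_pullSnd h₁ h₂ hu, inducedEnd_pullSnd_Em h₁ h₂,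
    courant_pullSnd hus h₂.smooth_Em, courant_neg_right he hΦu.pullSnd,
    courant_neg_right he hus.pullSnd, courant_pullSnd_pullFst h₁.smooth_Ep hΦu,
    courant_pullSnd_pullFst h₁.smooth_Ep hus, courant_pullSnd hΦu h₂.smooth_Em, neg_zero, sub_zero,
    zero_add, bigInr_add_inducedEnd_eq_zero_iff h₁ h₂]

/-- Here `N` is `[[E₊₁, E₋₁]] - [[E₋₂, E₊₂]]`, the mixed brackets being zero. The two terms lie in
complementary summands, so one equation carries the condition `[[E₊, E₋]] = 0` on both factors. -/
theorem nijenhuis_pullFst_Ep_Em_eq_zero_iff :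
    nijenhuis (prodForm H₁ H₂) (inducedEnd Φ₁ Ep₁ Em₁ Φ₂ Ep₂ Em₂) (pullFst I₂ M₂ Ep₁)
      (pullFst I₂ M₂ Em₁) p = 0 ↔ courant H₁ Ep₁ Em₁ p.1 = 0 ∧ courant H₂ Ep₂ Em₂ p.2 = 0 := by
  rw [nijenhuis, inducedEnd_pullFst_Ep h₁ h₂, inducedEnd_pullFst_Em h₁ h₂,
    courant_pullFst h₁.smooth_Ep h₁.smooth_Em, courant_pullSnd h₂.smooth_Em h₂.smooth_Ep,
    courant_pullFst_pullSnd h₁.smooth_Ep h₂.smooth_Ep,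
    courant_pullSnd_pullFst h₁.smooth_Em h₂.smooth_Em, add_zero, bigEnd_zero, add_zero,
    courant_swap h₂.smooth_Ep h₂.smooth_Em, (bigInr I₁ I₂ p).map_neg, sub_neg_eq_add,
    big_ext_iff_zero, (bigFst I₁ I₂ p).map_add, (bigSnd I₁ I₂ p).map_add, bigFst_bigInl,
    bigFst_bigInr, bigSnd_bigInl, bigSnd_bigInr, add_zero, zero_add]

/-- Every section of `TM ⊕ T*M` over `M₁ × M₂` agrees at a given point with a combination of
pullbacks of horizontal sections, of `E₊`, `E₋` and of their images under the induced structure. -/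
theorem exists_pull_decomposition {c : BigSection (I₁.prod I₂) (M₁ × M₂)} (hc : IsSmoothSection c)
    (p : M₁ × M₂) : ∃ (u : BigSection I₁ M₁) (v : BigSection I₂ M₂) (r s t w : ℝ),
      IsSmoothSection u ∧ IsHorizontal Φ₁ u ∧ IsSmoothSection v ∧ IsHorizontal Φ₂ v ∧
      c p = (pullFst I₂ M₂ u + pullSnd I₁ M₁ v + r • pullFst I₂ M₂ Ep₁ + s • pullFst I₂ M₂ Em₁
        + mapSection (inducedEnd Φ₁ Ep₁ Em₁ Φ₂ Ep₂ Em₂)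
          (t • pullFst I₂ M₂ Ep₁ + w • pullFst I₂ M₂ Em₁)) p := by
  -- The horizontal projection is `-Φ²`. The coefficients along `E₊`, `E₋` are pairings with the
  -- opposite section, and the directions `E₋₂`, `E₊₂` are reached as `J E₊₁`, `J E₋₁`.
  refine ⟨mapSection Φ₁ (mapSection Φ₁ (-sliceFst c p.2)),
    mapSection Φ₂ (mapSection Φ₂ (-sliceSnd c p.1)),
    2 * pairing (Em₁ p.1) (bigFst I₁ I₂ p (c p)), 2 * pairing (Ep₁ p.1) (bigFst I₁ I₂ p (c p)),
    2 * pairing (Ep₂ p.2) (bigSnd I₁ I₂ p (c p)), 2 * pairing (Em₂ p.2) (bigSnd I₁ I₂ p (c p)),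
    h₁.smooth.mapSection (h₁.smooth.mapSection (hc.sliceFst p.2).neg), h₁.isHorizontal_mapSection _,
    h₂.smooth.mapSection (h₂.smooth.mapSection (hc.sliceSnd p.1).neg), h₂.isHorizontal_mapSection _,
    ?_⟩
  rw [mapSection_add, mapSection_smul, mapSection_smul, inducedEnd_pullFst_Ep h₁ h₂,
    inducedEnd_pullFst_Em h₁ h₂]
  have e₁ : mapSection Φ₁ (mapSection Φ₁ (-sliceFst c p.2)) p.1 = _ :=
    h₁.sq_apply (-bigFst I₁ I₂ p (c p))
  have e₂ : mapSection Φ₂ (mapSection Φ₂ (-sliceSnd c p.1)) p.2 = _ :=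
    h₂.sq_apply (-bigSnd I₁ I₂ p (c p))
  simp only [Pi.add_apply, Pi.smul_apply, pullFst, pullSnd, e₁, e₂]
  refine big_ext ?_ ?_
  · simp only [(bigFst I₁ I₂ p).map_add, (bigFst I₁ I₂ p).map_smul, bigFst_bigInl, bigFst_bigInr,
      pairing_neg_right]
    module
  · simp only [(bigSnd I₁ I₂ p).map_add, (bigSnd I₁ I₂ p).map_smul, bigSnd_bigInl, bigSnd_bigInr,
      pairing_neg_right]
    module

theorem nijenhuis_eq_zero_of_generators {b : BigSection (I₁.prod I₂) (M₁ × M₂)}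
    (hb : IsSmoothSection b) {p : M₁ × M₂}
    (hFst : ∀ u, IsSmoothSection u → IsHorizontal Φ₁ u → nijenhuis (prodForm H₁ H₂)
      (inducedEnd Φ₁ Ep₁ Em₁ Φ₂ Ep₂ Em₂) (pullFst I₂ M₂ u) b p = 0)
    (hSnd : ∀ v, IsSmoothSection v → IsHorizontal Φ₂ v → nijenhuis (prodForm H₁ H₂)
      (inducedEnd Φ₁ Ep₁ Em₁ Φ₂ Ep₂ Em₂) (pullSnd I₁ M₁ v) b p = 0)
    (hEp : nijenhuis (prodForm H₁ H₂) (inducedEnd Φ₁ Ep₁ Em₁ Φ₂ Ep₂ Em₂)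
      (pullFst I₂ M₂ Ep₁) b p = 0)
    (hEm : nijenhuis (prodForm H₁ H₂) (inducedEnd Φ₁ Ep₁ Em₁ Φ₂ Ep₂ Em₂)
      (pullFst I₂ M₂ Em₁) b p = 0)
    {a : BigSection (I₁.prod I₂) (M₁ × M₂)} (ha : IsSmoothSection a) :
    nijenhuis (prodForm H₁ H₂) (inducedEnd Φ₁ Ep₁ Em₁ Φ₂ Ep₂ Em₂) a b p = 0 := by
  have hJ := isGenAlmostComplex_inducedEnd h₁ h₂
  obtain ⟨u, v, r, s, t, w, hus, hu, hvs, hv, h⟩ := exists_pull_decomposition h₁ h₂ ha p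
  exact nijenhuis_eq_zero_of_combination hJ ha hb hus.pullFst hvs.pullSnd h₁.smooth_Ep.pullFst
    h₁.smooth_Em.pullFst r s t w h (hFst u hus hu) (hSnd v hvs hv) hEp hEm

section

variable (n₁ : NormalBrackets H₁ Φ₁ Ep₁ Em₁) (n₂ : NormalBrackets H₂ Φ₂ Ep₂ Em₂)

include n₂ in
-- Since `E₊₁ = -J E₋₂`, antilinearity reduces this to `N(E₋₂, v)`, which is governed by the
-- brackets of `v` with `E₋₂` on the second factor.
theorem nijenhuis_pullFst_Ep_pullSnd {v : BigSection I₂ M₂} (hvs : IsSmoothSection v)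
    (hv : IsHorizontal Φ₂ v) :
    nijenhuis (prodForm H₁ H₂) (inducedEnd Φ₁ Ep₁ Em₁ Φ₂ Ep₂ Em₂) (pullFst I₂ M₂ Ep₁)
      (pullSnd I₁ M₁ v) p = 0 := by
  have hJ := isGenAlmostComplex_inducedEnd h₁ h₂
  have h := (nijenhuis_pullSnd_Em_eq_zero_iff (H₁ := H₁) (p := p) h₁ h₂ hvs hv).2
    (n₂.minus v hvs hv p.2)
  exact nijenhuis_eq_zero_of_mapSection_eq_neg hJ hvs.pullSnd h₂.smooth_Em.pullSnd
    (inducedEnd_pullSnd_Em h₁ h₂)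
    (nijenhuis_eq_zero_swap hJ.smooth hvs.pullSnd h₂.smooth_Em.pullSnd h)

include n₂ in
theorem nijenhuis_pullFst_Em_pullSnd {v : BigSection I₂ M₂} (hvs : IsSmoothSection v)
    (hv : IsHorizontal Φ₂ v) :
    nijenhuis (prodForm H₁ H₂) (inducedEnd Φ₁ Ep₁ Em₁ Φ₂ Ep₂ Em₂) (pullFst I₂ M₂ Em₁)
      (pullSnd I₁ M₁ v) p = 0 := by
  have hJ := isGenAlmostComplex_inducedEnd h₁ h₂
  have h := (nijenhuis_pullSnd_Ep_eq_zero_iff (H₁ := H₁) (p := p) h₁ h₂ hvs hv).2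
    (n₂.plus v hvs hv p.2)
  exact nijenhuis_eq_zero_of_mapSection_eq_neg hJ hvs.pullSnd h₂.smooth_Ep.pullSnd
    (inducedEnd_pullSnd_Ep h₁ h₂)
    (nijenhuis_eq_zero_swap hJ.smooth hvs.pullSnd h₂.smooth_Ep.pullSnd h)

variable {c : BigSection (I₁.prod I₂) (M₁ × M₂)} (hc : IsSmoothSection c)

include hc

include n₁ in
theorem nijenhuis_right_pullFst {u : BigSection I₁ M₁} (hus : IsSmoothSection u)
    (hu : IsHorizontal Φ₁ u) :
    nijenhuis (prodForm H₁ H₂) (inducedEnd Φ₁ Ep₁ Em₁ Φ₂ Ep₂ Em₂) c (pullFst I₂ M₂ u) p = 0 := by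
  have hJ := (isGenAlmostComplex_inducedEnd h₁ h₂).smooth
  have hp := (nijenhuis_pullFst_Ep_eq_zero_iff (H₂ := H₂) (p := p) h₁ h₂ hus hu).2
    (n₁.plus u hus hu p.1)
  have hm := (nijenhuis_pullFst_Em_eq_zero_iff (H₂ := H₂) (p := p) h₁ h₂ hus hu).2
    (n₁.minus u hus hu p.1)
  have su := hus.pullFst (I₂ := I₂) (M₂ := M₂)
  refine nijenhuis_eq_zero_of_generators h₁ h₂ su (fun u' hus' hu' => ?_) (fun v hvs hv => ?_)
    (nijenhuis_eq_zero_swap hJ su h₁.smooth_Ep.pullFst hp)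
    (nijenhuis_eq_zero_swap hJ su h₁.smooth_Em.pullFst hm) hc
  · exact (nijenhuis_pullFst_eq_zero_iff h₁ h₂ hus' hus hu' hu).2
      (n₁.horizontal u' u hus' hus hu' hu p.1)
  · exact nijenhuis_eq_zero_swap hJ su hvs.pullSnd (nijenhuis_pullFst_pullSnd h₁ h₂ hus hvs hu hv)

include n₂ in
theorem nijenhuis_right_pullSnd {v : BigSection I₂ M₂} (hvs : IsSmoothSection v)
    (hv : IsHorizontal Φ₂ v) :
    nijenhuis (prodForm H₁ H₂) (inducedEnd Φ₁ Ep₁ Em₁ Φ₂ Ep₂ Em₂) c (pullSnd I₁ M₁ v) p = 0 := by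
  have hp := nijenhuis_pullFst_Ep_pullSnd (H₁ := H₁) (p := p) h₁ h₂ n₂ hvs hv
  have hm := nijenhuis_pullFst_Em_pullSnd (H₁ := H₁) (p := p) h₁ h₂ n₂ hvs hv
  refine nijenhuis_eq_zero_of_generators h₁ h₂ hvs.pullSnd (fun u hus hu => ?_)
    (fun v' hvs' hv' => ?_) hp hm hc
  · exact nijenhuis_pullFst_pullSnd h₁ h₂ hus hvs hu hv
  · exact (nijenhuis_pullSnd_eq_zero_iff h₁ h₂ hvs' hvs hv' hv).2
      (n₂.horizontal v' v hvs' hvs hv' hv p.2)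

include n₁ n₂

theorem nijenhuis_right_pullFst_Ep :
    nijenhuis (prodForm H₁ H₂) (inducedEnd Φ₁ Ep₁ Em₁ Φ₂ Ep₂ Em₂) c (pullFst I₂ M₂ Ep₁) p = 0 := by
  have hJ := (isGenAlmostComplex_inducedEnd h₁ h₂).smooth
  have sp := h₁.smooth_Ep.pullFst (I₂ := I₂) (M₂ := M₂)
  have pm := (nijenhuis_pullFst_Ep_Em_eq_zero_iff (p := p) h₁ h₂).2 ⟨n₁.reeb p.1, n₂.reeb p.2⟩
  refine nijenhuis_eq_zero_of_generators h₁ h₂ sp (fun u hus hu => ?_) (fun v hvs hv => ?_)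
    (nijenhuis_self hJ sp) (nijenhuis_eq_zero_swap hJ sp h₁.smooth_Em.pullFst pm) hc
  · exact (nijenhuis_pullFst_Ep_eq_zero_iff h₁ h₂ hus hu).2 (n₁.plus u hus hu p.1)
  · exact nijenhuis_eq_zero_swap hJ sp hvs.pullSnd (nijenhuis_pullFst_Ep_pullSnd h₁ h₂ n₂ hvs hv)

theorem nijenhuis_right_pullFst_Em :
    nijenhuis (prodForm H₁ H₂) (inducedEnd Φ₁ Ep₁ Em₁ Φ₂ Ep₂ Em₂) c (pullFst I₂ M₂ Em₁) p = 0 := by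
  have hJ := (isGenAlmostComplex_inducedEnd h₁ h₂).smooth
  have sm := h₁.smooth_Em.pullFst (I₂ := I₂) (M₂ := M₂)
  have pm := (nijenhuis_pullFst_Ep_Em_eq_zero_iff (p := p) h₁ h₂).2 ⟨n₁.reeb p.1, n₂.reeb p.2⟩
  refine nijenhuis_eq_zero_of_generators h₁ h₂ sm (fun u hus hu => ?_) (fun v hvs hv => ?_)
    pm (nijenhuis_self hJ sm) hc
  · exact (nijenhuis_pullFst_Em_eq_zero_iff h₁ h₂ hus hu).2 (n₁.minus u hus hu p.1)
  · exact nijenhuis_eq_zero_swap hJ sm hvs.pullSnd (nijenhuis_pullFst_Em_pullSnd h₁ h₂ n₂ hvs hv)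

/-- The preceding lemmas allow an arbitrary section in the first slot when the second holds a
generator. Skew-symmetry and a second reduction to generators remove the remaining restriction. -/
theorem nijenhuis_inducedEnd_eq_zero {d : BigSection (I₁.prod I₂) (M₁ × M₂)}
    (hd : IsSmoothSection d) :
    nijenhuis (prodForm H₁ H₂) (inducedEnd Φ₁ Ep₁ Em₁ Φ₂ Ep₂ Em₂) c d p = 0 := by
  have hJ := (isGenAlmostComplex_inducedEnd h₁ h₂).smooth
  refine nijenhuis_eq_zero_of_generators h₁ h₂ hd (fun u hus hu => ?_) (fun v hvs hv => ?_) ?_ ?_ hc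
  · exact nijenhuis_eq_zero_swap hJ hd hus.pullFst (nijenhuis_right_pullFst h₁ h₂ n₁ hd hus hu)
  · exact nijenhuis_eq_zero_swap hJ hd hvs.pullSnd (nijenhuis_right_pullSnd h₁ h₂ n₂ hd hvs hv)
  · exact nijenhuis_eq_zero_swap hJ hd h₁.smooth_Ep.pullFst
      (nijenhuis_right_pullFst_Ep h₁ h₂ n₁ n₂ hd)
  · exact nijenhuis_eq_zero_swap hJ hd h₁.smooth_Em.pullFst
      (nijenhuis_right_pullFst_Em h₁ h₂ n₁ n₂ hd)

end

section

variable (h : ∀ a b, IsSmoothSection a → IsSmoothSection b → ∀ p,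
  nijenhuis (prodForm H₁ H₂) (inducedEnd Φ₁ Ep₁ Em₁ Φ₂ Ep₂ Em₂) a b p = 0)

include h

/-- Each relation at `x` is the vanishing of `N` on pullbacks from `M₁` at `(x, q)`, for any point
`q` of `M₂`. -/
theorem normalBrackets_fst [Nonempty M₂] : NormalBrackets H₁ Φ₁ Ep₁ Em₁ := by
  obtain ⟨q⟩ := ‹Nonempty M₂›
  have sp := h₁.smooth_Ep.pullFst (I₂ := I₂) (M₂ := M₂)
  have sm := h₁.smooth_Em.pullFst (I₂ := I₂) (M₂ := M₂)
  refine ⟨fun u v hus hvs hu hv x => ?_, fun u hus hu x => ?_, fun u hus hu x => ?_, fun x => ?_⟩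
  · have h₀ := h _ _ hus.pullFst hvs.pullFst (x, q)
    rwa [nijenhuis_pullFst_eq_zero_iff h₁ h₂ hus hvs hu hv] at h₀
  · have h₀ := h _ _ hus.pullFst sp (x, q)
    rwa [nijenhuis_pullFst_Ep_eq_zero_iff h₁ h₂ hus hu] at h₀
  · have h₀ := h _ _ hus.pullFst sm (x, q)
    rwa [nijenhuis_pullFst_Em_eq_zero_iff h₁ h₂ hus hu] at h₀
  · exact ((nijenhuis_pullFst_Ep_Em_eq_zero_iff h₁ h₂).1 (h _ _ sp sm (x, q))).1

theorem normalBrackets_snd [Nonempty M₁] : NormalBrackets H₂ Φ₂ Ep₂ Em₂ := by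
  obtain ⟨q⟩ := ‹Nonempty M₁›
  have sp := h₂.smooth_Ep.pullSnd (I₁ := I₁) (M₁ := M₁)
  have sm := h₂.smooth_Em.pullSnd (I₁ := I₁) (M₁ := M₁)
  refine ⟨fun u v hus hvs hu hv x => ?_, fun u hus hu x => ?_, fun u hus hu x => ?_, fun x => ?_⟩
  · have h₀ := h _ _ hus.pullSnd hvs.pullSnd (q, x)
    rwa [nijenhuis_pullSnd_eq_zero_iff h₁ h₂ hus hvs hu hv] at h₀
  · have h₀ := h _ _ hus.pullSnd sp (q, x)
    rwa [nijenhuis_pullSnd_Ep_eq_zero_iff h₁ h₂ hus hu] at h₀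
  · have h₀ := h _ _ hus.pullSnd sm (q, x)
    rwa [nijenhuis_pullSnd_Em_eq_zero_iff h₁ h₂ hus hu] at h₀
  · exact ((nijenhuis_pullFst_Ep_Em_eq_zero_iff h₁ h₂).1
      (h _ _ h₁.smooth_Ep.pullFst h₁.smooth_Em.pullFst (q, x))).2

end

theorem isGenComplex_inducedEnd_iff [Nonempty M₁] [Nonempty M₂] :
    IsGenComplex (prodForm H₁ H₂) (inducedEnd Φ₁ Ep₁ Em₁ Φ₂ Ep₂ Em₂) ↔
      NormalBrackets H₁ Φ₁ Ep₁ Em₁ ∧ NormalBrackets H₂ Φ₂ Ep₂ Em₂ := by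
  have hJ := isGenAlmostComplex_inducedEnd h₁ h₂
  constructor
  · intro h
    have h' := (isInvolutive_eigenbundle_iff hJ).1 h.involutive
    exact ⟨normalBrackets_fst h₁ h₂ h', normalBrackets_snd h₁ h₂ h'⟩
  · rintro ⟨n₁, n₂⟩
    exact ⟨hJ, (isInvolutive_eigenbundle_iff hJ).2 fun a b ha hb p =>
      nijenhuis_inducedEnd_eq_zero h₁ h₂ n₁ n₂ ha hb⟩

end InducedIntegrability

/-! ### Consequences of compatibility with the generalized metric. -/

namespace IsGenAlmostContactMetric

variable {E : Type*} [NormedAddCommGroup E] [NormedSpace ℝ E]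
  {K : Type*} [TopologicalSpace K] {I : ModelWithCorners ℝ E K}
  {M : Type*} [TopologicalSpace M] [ChartedSpace K M] [IsManifold I ∞ M]
  {H : Form I M 3} {Φ G : BigEnd I M} {Ep Em : BigSection I M} {x : M}
  (h : IsGenAlmostContactMetric Φ Ep Em G)

include h

theorem compatible_apply (a : BigTangent I x) : Φ x (G x (Φ x a)) =
    -G x a + (2 * pairing (Ep x) a) • Ep x + (2 * pairing (Em x) a) • Em x := by
  have h₀ : -(Φ x (G x (Φ x a))) = G x a - tensorEnd (Ep x) (Ep x) a - tensorEnd (Em x) (Em x) a :=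
    DFunLike.congr_fun (h.compatible x) a
  rw [tensorEnd_apply, tensorEnd_apply] at h₀
  linear_combination (norm := module) -h₀

theorem metric_Ep (x : M) : G x (Ep x) = Em x := by
  have h₀ := h.compatible_apply (Ep x)
  rw [h.almostContact.map_Ep, bigEnd_zero, bigEnd_zero, h.almostContact.isotropic_Ep,
    h.almostContact.symm.dual, mul_zero, big_zero_smul, big_one_smul, add_zero] at h₀
  linear_combination (norm := module) h₀

theorem metric_Em (x : M) : G x (Em x) = Ep x := by
  rw [← h.metric_Ep, h.metric.sq]

/-- Apply `Φ` to the compatibility relation. `GΦa` is orthogonal to `E₊` and `E₋`, because `G` is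
self-adjoint and exchanges them, so `Φ²` acts on it as `-1`; on the other side `Φ` kills the terms
in `E₊` and `E₋`. -/
theorem metric_map (a : BigTangent I x) : G x (Φ x a) = Φ x (G x a) := by
  have c := h.almostContact
  have h₀ := congrArg (Φ x) (h.compatible_apply a)
  have hp : pairing (Ep x) (G x (Φ x a)) = 0 := by
    rw [← h.metric.selfAdjoint, h.metric_Ep, c.symm.pairing_Ep_map]
  have hm : pairing (Em x) (G x (Φ x a)) = 0 := by
    rw [← h.metric.selfAdjoint, h.metric_Em, c.pairing_Ep_map]
  rw [c.sq_apply, hp, hm, bigEnd_add, bigEnd_add, bigEnd_neg, bigEnd_smul, bigEnd_smul, c.map_Ep,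
    c.map_Em] at h₀
  linear_combination (norm := module) -h₀

theorem compEnd [I.Boundaryless] : IsGenAlmostContact (compEnd G Φ) Ep Em where
  smooth := h.metric.smooth.compEnd h.almostContact.smooth
  smooth_Ep := h.almostContact.smooth_Ep
  smooth_Em := h.almostContact.smooth_Em
  skew x a b := by
    change pairing (G x (Φ x a)) b + pairing a (G x (Φ x b)) = 0
    rw [h.metric.selfAdjoint, h.metric_map, h.almostContact.skew]
  sq x := by
    rw [← h.almostContact.sq]
    refine ContinuousLinearMap.ext fun a => ?_
    change G x (Φ x (G x (Φ x a))) = Φ x (Φ x a)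
    rw [h.metric_map, h.metric.sq]
  isotropic_Ep := h.almostContact.isotropic_Ep
  isotropic_Em := h.almostContact.isotropic_Em
  dual := h.almostContact.dual

/-- `G` exchanges `E₊` and `E₋` while strength is symmetric in them, and `[[E₊, E₋]] = 0` does not
involve the endomorphism. So strength of `GΦ` upgrades to normality, and coKähler means that `Φ` and
`GΦ` are both normal. -/
theorem isGenCoKahler_iff [CompleteSpace E] [I.Boundaryless] : IsGenCoKahler H Φ Ep Em G ↔
    NormalBrackets H Φ Ep Em ∧ NormalBrackets H (GenGeom.compEnd G Φ) Ep Em := by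
  have hp : (fun x => G x (Ep x)) = Em := funext h.metric_Ep
  have hm : (fun x => G x (Em x)) = Ep := funext h.metric_Em
  rw [← h.almostContact.isNormal_iff, ← h.compEnd.isNormal_iff]
  constructor
  · rintro ⟨-, hn, hs⟩
    rw [hp, hm] at hs
    exact ⟨hn, ⟨hs.2, hs.1⟩, hn.2⟩
  · rintro ⟨hn, hs, -⟩
    refine ⟨h, hn, ?_⟩
    rw [hp, hm]
    exact ⟨hs.2, hs.1⟩

end IsGenAlmostContactMetric

/-! ### The product metric and the algebraic part of the Kähler condition. -/

section Product

variable {E₁ : Type*} [NormedAddCommGroup E₁] [NormedSpace ℝ E₁]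
  {K₁ : Type*} [TopologicalSpace K₁] {I₁ : ModelWithCorners ℝ E₁ K₁} [I₁.Boundaryless]
  {M₁ : Type*} [TopologicalSpace M₁] [ChartedSpace K₁ M₁] [IsManifold I₁ ∞ M₁]
  {E₂ : Type*} [NormedAddCommGroup E₂] [NormedSpace ℝ E₂]
  {K₂ : Type*} [TopologicalSpace K₂] {I₂ : ModelWithCorners ℝ E₂ K₂} [I₂.Boundaryless]
  {M₂ : Type*} [TopologicalSpace M₂] [ChartedSpace K₂ M₂] [IsManifold I₂ ∞ M₂]
  {Φ₁ G₁ : BigEnd I₁ M₁} {Ep₁ Em₁ : BigSection I₁ M₁}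
  {Φ₂ G₂ : BigEnd I₂ M₂} {Ep₂ Em₂ : BigSection I₂ M₂}
  {H₁ : Form I₁ M₁ 3} {H₂ : Form I₂ M₂ 3}

omit [I₁.Boundaryless] [I₂.Boundaryless] [IsManifold I₁ ∞ M₁] [IsManifold I₂ ∞ M₂] in
theorem bigFst_prodEnd (p : M₁ × M₂) (c : BigTangent (I₁.prod I₂) p) :
    bigFst I₁ I₂ p (prodEnd G₁ G₂ p c) = G₁ p.1 (bigFst I₁ I₂ p c) := by
  refine ((bigFst I₁ I₂ p).map_add (bigInl I₁ I₂ p (G₁ p.1 (bigFst I₁ I₂ p c)))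
    (bigInr I₁ I₂ p (G₂ p.2 (bigSnd I₁ I₂ p c)))).trans ?_
  rw [bigFst_bigInl, bigFst_bigInr, add_zero]

omit [I₁.Boundaryless] [I₂.Boundaryless] [IsManifold I₁ ∞ M₁] [IsManifold I₂ ∞ M₂] in
theorem bigSnd_prodEnd (p : M₁ × M₂) (c : BigTangent (I₁.prod I₂) p) :
    bigSnd I₁ I₂ p (prodEnd G₁ G₂ p c) = G₂ p.2 (bigSnd I₁ I₂ p c) := by
  refine ((bigSnd I₁ I₂ p).map_add (bigInl I₁ I₂ p (G₁ p.1 (bigFst I₁ I₂ p c)))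
    (bigInr I₁ I₂ p (G₂ p.2 (bigSnd I₁ I₂ p c)))).trans ?_
  rw [bigSnd_bigInl, bigSnd_bigInr, zero_add]

theorem isGenMetric_prodEnd (h₁ : IsGenMetric G₁) (h₂ : IsGenMetric G₂) :
    IsGenMetric (prodEnd G₁ G₂) where
  smooth := (h₁.smooth.pullEndFst (I₂ := I₂) (M₂ := M₂)).add
    (h₂.smooth.pullEndSnd (I₁ := I₁) (M₁ := M₁))
  selfAdjoint p a b := by
    rw [pairing_eq_add, pairing_eq_add a, bigFst_prodEnd, bigFst_prodEnd, bigSnd_prodEnd,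
      bigSnd_prodEnd, h₁.selfAdjoint, h₂.selfAdjoint]
  sq p a := by
    refine big_ext ?_ ?_
    · rw [bigFst_prodEnd, bigFst_prodEnd, h₁.sq]
    · rw [bigSnd_prodEnd, bigSnd_prodEnd, h₂.sq]
  pos p a ha := by
    rw [pairing_eq_add, bigFst_prodEnd, bigSnd_prodEnd]
    by_cases h : bigFst I₁ I₂ p a = 0
    · have h' : bigSnd I₁ I₂ p a ≠ 0 := fun h' => ha (big_ext_iff_zero.2 ⟨h, h'⟩)
      rw [h, pairing_zero_right, zero_add]
      exact h₂.pos _ _ h'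
    · refine add_pos_of_pos_of_nonneg (h₁.pos _ _ h) ?_
      by_cases h' : bigSnd I₁ I₂ p a = 0
      · rw [h', pairing_zero_right]
      · exact (h₂.pos _ _ h').le

variable (h₁ : IsGenAlmostContactMetric Φ₁ Ep₁ Em₁ G₁) (h₂ : IsGenAlmostContactMetric Φ₂ Ep₂ Em₂ G₂)

include h₁ h₂

omit [I₁.Boundaryless] [I₂.Boundaryless] in
-- `G` exchanges `E₊` and `E₋` in the values of the off-diagonal terms but not in their pairings.
-- Swapping the names on `M₁` alone absorbs this in both components, so the second structure is
-- induced as well.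
theorem compEnd_prodEnd_inducedEnd :
    compEnd (prodEnd G₁ G₂) (inducedEnd Φ₁ Ep₁ Em₁ Φ₂ Ep₂ Em₂) =
      inducedEnd (compEnd G₁ Φ₁) Em₁ Ep₁ (compEnd G₂ Φ₂) Ep₂ Em₂ := by
  refine funext fun p => ContinuousLinearMap.ext fun c => ?_
  change prodEnd G₁ G₂ p (inducedEnd Φ₁ Ep₁ Em₁ Φ₂ Ep₂ Em₂ p c) = _
  refine big_ext ?_ ?_
  · rw [bigFst_prodEnd, bigFst_inducedEnd, bigFst_inducedEnd, bigEnd_sub, bigEnd_sub, bigEnd_smul,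
      bigEnd_smul, h₁.metric_Ep, h₁.metric_Em]
    rfl
  · rw [bigSnd_prodEnd, bigSnd_inducedEnd, bigSnd_inducedEnd, bigEnd_add, bigEnd_add, bigEnd_smul,
      bigEnd_smul, h₂.metric_Ep, h₂.metric_Em, add_assoc, add_comm (_ • Em₂ p.2), ← add_assoc]
    rfl

omit [I₁.Boundaryless] [I₂.Boundaryless] in
-- On the diagonal `G` commutes with `Φ`. Off it, `G` exchanges `E₊`, `E₋` of one factor when
-- applied after `J`, and those of the other, by self-adjointness, when applied before; the two
-- results are the same sum reordered.
theorem prodEnd_inducedEnd_comm (p : M₁ × M₂) (c : BigTangent (I₁.prod I₂) p) :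
    prodEnd G₁ G₂ p (inducedEnd Φ₁ Ep₁ Em₁ Φ₂ Ep₂ Em₂ p c) =
      inducedEnd Φ₁ Ep₁ Em₁ Φ₂ Ep₂ Em₂ p (prodEnd G₁ G₂ p c) := by
  refine big_ext ?_ ?_
  · rw [bigFst_prodEnd, bigFst_inducedEnd, bigFst_inducedEnd, bigFst_prodEnd, bigSnd_prodEnd,
      bigEnd_sub, bigEnd_sub, bigEnd_smul, bigEnd_smul, h₁.metric_Ep, h₁.metric_Em, h₁.metric_map,
      ← h₂.metric.selfAdjoint, ← h₂.metric.selfAdjoint, h₂.metric_Ep, h₂.metric_Em]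
    module
  · rw [bigSnd_prodEnd, bigSnd_inducedEnd, bigSnd_inducedEnd, bigFst_prodEnd, bigSnd_prodEnd,
      bigEnd_add, bigEnd_add, bigEnd_smul, bigEnd_smul, h₂.metric_Ep, h₂.metric_Em, h₂.metric_map,
      ← h₁.metric.selfAdjoint, ← h₁.metric.selfAdjoint, h₁.metric_Ep, h₁.metric_Em]
    module

/-- The induced pair is generalized Kähler exactly when both of its members are integrable. -/
theorem isGenKahler_inducedEnd_iff :
    IsGenKahler (prodForm H₁ H₂) (inducedEnd Φ₁ Ep₁ Em₁ Φ₂ Ep₂ Em₂)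
        (compEnd (prodEnd G₁ G₂) (inducedEnd Φ₁ Ep₁ Em₁ Φ₂ Ep₂ Em₂)) ↔
      IsGenComplex (prodForm H₁ H₂) (inducedEnd Φ₁ Ep₁ Em₁ Φ₂ Ep₂ Em₂) ∧
      IsGenComplex (prodForm H₁ H₂)
        (compEnd (prodEnd G₁ G₂) (inducedEnd Φ₁ Ep₁ Em₁ Φ₂ Ep₂ Em₂)) := by
  refine ⟨fun h => ⟨h.genComplex₁, h.genComplex₂⟩, fun h => ⟨h.1, h.2, fun p c => ?_, ?_⟩⟩
  · exact (prodEnd_inducedEnd_comm h₁ h₂ p (inducedEnd Φ₁ Ep₁ Em₁ Φ₂ Ep₂ Em₂ p c)).symm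
  -- Since `G` commutes with `J₁`, one has `-J₁J₂ = -J₁GJ₁ = -J₁²G = G`.
  · convert isGenMetric_prodEnd h₁.metric h₂.metric using 1
    refine funext fun p => ContinuousLinearMap.ext fun c => Eq.symm ?_
    change prodEnd G₁ G₂ p c = -(inducedEnd Φ₁ Ep₁ Em₁ Φ₂ Ep₂ Em₂ p
      (prodEnd G₁ G₂ p (inducedEnd Φ₁ Ep₁ Em₁ Φ₂ Ep₂ Em₂ p c)))
    rw [prodEnd_inducedEnd_comm h₁ h₂, h.1.sq, neg_neg]

end Product

end GenGeom

end

theorem theorem1p3 {n₁ n₂ : ℕ} (hn₁ : Odd n₁) (hn₂ : Odd n₂)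
    {M₁ : Type*} [TopologicalSpace M₁] [ChartedSpace (EuclideanSpace ℝ (Fin n₁)) M₁]
    [IsManifold (𝓡 n₁) ∞ M₁] [T2Space M₁] [SecondCountableTopology M₁] [Nonempty M₁]
    {M₂ : Type*} [TopologicalSpace M₂] [ChartedSpace (EuclideanSpace ℝ (Fin n₂)) M₂]
    [IsManifold (𝓡 n₂) ∞ M₂] [T2Space M₂] [SecondCountableTopology M₂] [Nonempty M₂]
    (H₁ : GenGeom.Form (𝓡 n₁) M₁ 3) (hH₁ : H₁.IsSmooth) (hdH₁ : H₁.IsClosed)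
    (H₂ : GenGeom.Form (𝓡 n₂) M₂ 3) (hH₂ : H₂.IsSmooth) (hdH₂ : H₂.IsClosed)
    (Φ₁ : GenGeom.BigEnd (𝓡 n₁) M₁) (Ep₁ Em₁ : GenGeom.BigSection (𝓡 n₁) M₁)
    (G₁ : GenGeom.BigEnd (𝓡 n₁) M₁)
    (h₁ : GenGeom.IsGenAlmostContactMetric Φ₁ Ep₁ Em₁ G₁)
    (Φ₂ : GenGeom.BigEnd (𝓡 n₂) M₂) (Ep₂ Em₂ : GenGeom.BigSection (𝓡 n₂) M₂)
    (G₂ : GenGeom.BigEnd (𝓡 n₂) M₂)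
    (h₂ : GenGeom.IsGenAlmostContactMetric Φ₂ Ep₂ Em₂ G₂) :
    GenGeom.IsGenKahler (GenGeom.prodForm H₁ H₂)
        (GenGeom.inducedEnd Φ₁ Ep₁ Em₁ Φ₂ Ep₂ Em₂)
        (GenGeom.compEnd (GenGeom.prodEnd G₁ G₂) (GenGeom.inducedEnd Φ₁ Ep₁ Em₁ Φ₂ Ep₂ Em₂)) ↔
      GenGeom.IsGenCoKahler H₁ Φ₁ Ep₁ Em₁ G₁ ∧ GenGeom.IsGenCoKahler H₂ Φ₂ Ep₂ Em₂ G₂ := by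
  have c₁ := h₁.compEnd
  -- `GJ` is induced with `E₊`, `E₋` interchanged on `M₁`; the bracket relations do not depend on
  -- their order.
  have swap : GenGeom.NormalBrackets H₁ (GenGeom.compEnd G₁ Φ₁) Em₁ Ep₁ ↔
      GenGeom.NormalBrackets H₁ (GenGeom.compEnd G₁ Φ₁) Ep₁ Em₁ :=
    ⟨fun h => h.symm c₁.smooth_Em c₁.smooth_Ep, fun h => h.symm c₁.smooth_Ep c₁.smooth_Em⟩
  rw [GenGeom.isGenKahler_inducedEnd_iff h₁ h₂, GenGeom.compEnd_prodEnd_inducedEnd h₁ h₂,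
    GenGeom.isGenComplex_inducedEnd_iff h₁.almostContact h₂.almostContact,
    GenGeom.isGenComplex_inducedEnd_iff c₁.symm h₂.compEnd, swap, h₁.isGenCoKahler_iff,
    h₂.isGenCoKahler_iff, and_and_and_comm]
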